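/- For real numbers $\kappa,\tau$ with $(\kappa,\tau)\neq(0,0)$ let $E^3(\kappa,\tau)$ denote the simply connected homogeneous Riemannian $3$-manifold that fibres over the simply connected surface of constant curvature $\kappa$ with bundle curvature $\tau$: it is $\mathbb{S}^2_\kappa\times\mathbb{R}$ if $\kappa>0,\ \tau=0$; the Berger sphere $\mathbb{S}^3_{\kappa,\tau}$ (the unit sphere of $\mathbb{C}^2$ with the metric $\frac4\kappa\big[\langle X,Y\rangle+(\frac{4\tau^2}{\kappa}-1)\langle X,V\rangle\langle Y,V\rangle\big]$, $V_{(z,w)}=(iz,iw)$) if $\kappa>0,\ \tau\ne0$; and, if $\kappa\le 0$, the domain $\{(x,y,t)\in\mathbb{R}^3:1+\frac\kappa4(x^2+y^2)>0\}$ with the metric $\rho^2(dx^2+dy^2)+\big(dt+\tau\rho\,(x\,dy-y\,dx)\big)^2$, $\rho=\big(1+\frac\kappa4(x^2+y^2)\big)^{-1}$, that is, $\mathbb{H}^2_\kappa\times\mathbb{R}$ if $\kappa<0,\ \tau=0$, the Heisenberg space $Nil_3(\kappa,\tau)$ if $\kappa=0,\ \tau\neq 0$, and $\widetilde{PSL_2}(\kappa,\tau)$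 if $\kappa<0,\ \tau\ne0$. (Its isometry group has dimension $4$ unless $\kappa=4\tau^2$, when it is a round sphere.) Theorem. Let $0<m<\infty$ and $\lambda$ be real constants, let $g$ be the metric of $E^3(\kappa,\tau)$, and let $f$ be a smooth function on $E^3(\kappa,\tau)$ with $$Ric+\nabla^2 f-\tfrac1m\,df\otimes df=\lambda g .$$ Then either $g$ is an Einstein metric, or $\kappa<0$, $\tau=0$ and $\lambda=\kappa$, so that the space is $\mathbb{H}^2_\kappa\times\mathbb{R}$, and, up to an isometry of the space and with $t$ the coordinate of the factor $\mathbb{R}$, there are real constants $a,b,c$ such that $$f=\pm\sqrt{-m\kappa}\;t+c\qquad\text{or}\qquad f=-m\ln\cosh\Big[\sqrt{-\tfrac{\lambda}{m}}\,(t+a)\Big]+b .$$ In particular, if $m=1$ and $\kappa\neq4\tau^2$, then $g$ is a static metric with cosmological constant $\lambda$: $\Delta e^{-f}+\lambda e^{-f}=0$. -/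

import Mathlib

open Bundle
open scoped Manifold ContDiff

set_option maxSynthPendingDepth 3

namespace QuasiEinstein

/-! ### Curvature of a metric given in coordinates

A metric on (an open subset of) the vector space `E` is a field `G` of bilinear forms on `E`. -/

section Coordinates

variable {E : Type*} [NormedAddCommGroup E] [NormedSpace ℝ E]

/-- Christoffel symbols of the first kind,
`Γ(u, v; w) = (∂_u G(v, w) + ∂_v G(u, w) - ∂_w G(u, v)) / 2` at the point `y`. -/
noncomputable def christoffelFirst (G : E → E →L[ℝ] E →L[ℝ] ℝ) (y : E) :
    E →L[ℝ] (E →L[ℝ] E →L[ℝ] ℝ) :=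
  let dG : E →L[ℝ] (E →L[ℝ] E →L[ℝ] ℝ) := fderiv ℝ G y
  let swap : (E →L[ℝ] E →L[ℝ] ℝ) →L[ℝ] (E →L[ℝ] E →L[ℝ] ℝ) :=
    (ContinuousLinearMap.flipₗᵢ ℝ E E ℝ).toContinuousLinearEquiv.toContinuousLinearMap
  (1 / 2 : ℝ) • (dG + dG.flip - swap.comp dG.flip)

theorem christoffelFirst_apply (G : E → E →L[ℝ] E →L[ℝ] ℝ) (y u v w : E) :
    christoffelFirst G y u v w =
      1 / 2 * (fderiv ℝ G y u v w + fderiv ℝ G y v u w - fderiv ℝ G y w u v) :=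
  rfl

/-- Christoffel symbols of the second kind: `Γ(u, v)` is the vector with
`G(Γ(u, v), w) = Γ(u, v; w)` for all `w`; so `∇_u v = ∂_u v + Γ(u, v)` is the Levi-Civita
connection of `G`. -/
noncomputable def christoffel (G : E → E →L[ℝ] E →L[ℝ] ℝ) (y : E) : E →L[ℝ] E →L[ℝ] E :=
  (ContinuousLinearMap.compL ℝ E (E →L[ℝ] ℝ) E (G y).inverse).comp (christoffelFirst G y)

/-- The endomorphism `u ↦ R(u, v) w`, where `R(u, v) w = ∇_u ∇_v w - ∇_v ∇_u w - ∇_[u, v] w`, in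
terms of the Christoffel symbols. -/
noncomputable def curvatureEndo (G : E → E →L[ℝ] E →L[ℝ] ℝ) (y v w : E) : E →L[ℝ] E :=
  let Γ : E →L[ℝ] E →L[ℝ] E := christoffel G y
  let dΓ : E →L[ℝ] (E →L[ℝ] E →L[ℝ] E) := fderiv ℝ (christoffel G) y
  (dΓ.flip v).flip w - (dΓ v).flip w + Γ.flip (Γ v w) - (Γ v).comp (Γ.flip w)

theorem curvatureEndo_apply (G : E → E →L[ℝ] E →L[ℝ] ℝ) (y u v w : E) :
    curvatureEndo G y v w u =
      fderiv ℝ (christoffel G) y u v w - fderiv ℝ (christoffel G) y v u w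
        + christoffel G y u (christoffel G y v w) - christoffel G y v (christoffel G y u w) :=
  rfl

/-- The Ricci tensor `Ric(v, w) = tr (u ↦ R(u, v) w)`. -/
noncomputable def coordRicci (G : E → E →L[ℝ] E →L[ℝ] ℝ) (y v w : E) : ℝ :=
  LinearMap.trace ℝ E (curvatureEndo G y v w : E →L[ℝ] E)

/-- The Hessian `(∇²f)(v, w) = ∂_v ∂_w f - df(Γ(v, w))`. -/
noncomputable def coordHessian (G : E → E →L[ℝ] E →L[ℝ] ℝ) (f : E → ℝ) (y : E) :
    E →L[ℝ] E →L[ℝ] ℝ :=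
  fderiv ℝ (fderiv ℝ f) y
    - (ContinuousLinearMap.compL ℝ E E ℝ (fderiv ℝ f y)).comp (christoffel G y)

/-- The Laplace-Beltrami operator `Δf = tr_G (∇²f)`. -/
noncomputable def coordLaplacian (G : E → E →L[ℝ] E →L[ℝ] ℝ) (f : E → ℝ) (y : E) : ℝ :=
  LinearMap.trace ℝ E ((G y).inverse.comp (coordHessian G f y) : E →L[ℝ] E)

end Coordinates

/-! ### Riemannian manifolds -/

/-- A smooth Riemannian manifold (without boundary, finite-dimensional). -/
structure RiemannianManifold where
  /-- the model vector space -/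
  E : Type
  [normedAddCommGroup : NormedAddCommGroup E]
  [normedSpace : NormedSpace ℝ E]
  [finiteDimensional : FiniteDimensional ℝ E]
  /-- the model space -/
  H : Type
  [topologicalSpaceH : TopologicalSpace H]
  /-- the model with corners -/
  I : ModelWithCorners ℝ E H
  [boundaryless : I.Boundaryless]
  /-- the underlying space -/
  M : Type
  [topologicalSpace : TopologicalSpace M]
  [t2Space : T2Space M]
  [secondCountable : SecondCountableTopology M]
  [chartedSpace : ChartedSpace H M]
  [isManifold : IsManifold I ∞ M]
  /-- the Riemannian metric -/
  metric : ContMDiffRiemannianMetric I ∞ E (fun x : M ↦ TangentSpace I x)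

attribute [instance] RiemannianManifold.normedAddCommGroup RiemannianManifold.normedSpace
  RiemannianManifold.finiteDimensional RiemannianManifold.topologicalSpaceH
  RiemannianManifold.boundaryless RiemannianManifold.topologicalSpace
  RiemannianManifold.t2Space RiemannianManifold.secondCountable
  RiemannianManifold.chartedSpace RiemannianManifold.isManifold

namespace RiemannianManifold

variable (X : RiemannianManifold)

/-- The metric of `X` read in the preferred chart around `x₀`: the pull-back of the metric under
the inverse of that chart. -/
noncomputable def metricInChart (x₀ : X.M) (y : X.E) : X.E →L[ℝ] X.E →L[ℝ] ℝ :=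
  ContinuousLinearMap.bilinearComp (E := X.E) (F := X.E)
    (X.metric.inner ((extChartAt X.I x₀).symm y))
    (mfderiv 𝓘(ℝ, X.E) X.I (extChartAt X.I x₀).symm y : X.E →L[ℝ] X.E)
    (mfderiv 𝓘(ℝ, X.E) X.I (extChartAt X.I x₀).symm y : X.E →L[ℝ] X.E)

/-- The Ricci tensor at `x`, computed in the preferred chart around `x`. (The tangent space at `x`
is by definition the model vector space, by means of that chart.) -/
noncomputable def ricci (x : X.M) (v w : TangentSpace X.I x) : ℝ :=
  coordRicci (X.metricInChart x) (extChartAt X.I x x) v w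

/-- The Hessian `∇²f` at `x` for the Levi-Civita connection, computed in the preferred chart
around `x`. -/
noncomputable def hessian (f : X.M → ℝ) (x : X.M) (v w : TangentSpace X.I x) : ℝ :=
  coordHessian (X.metricInChart x) (f ∘ (extChartAt X.I x).symm) (extChartAt X.I x x) v w

/-- The Laplace-Beltrami operator at `x`, computed in the preferred chart around `x`. -/
noncomputable def laplacian (f : X.M → ℝ) (x : X.M) : ℝ :=
  coordLaplacian (X.metricInChart x) (f ∘ (extChartAt X.I x).symm) (extChartAt X.I x x)

/-- The differential of a function. -/
noncomputable def differential (f : X.M → ℝ) (x : X.M) : TangentSpace X.I x →L[ℝ] ℝ :=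
  mfderiv X.I 𝓘(ℝ, ℝ) f x

/-- `X` is Einstein: `Ric = c g` for a constant `c`. -/
def IsEinstein : Prop :=
  ∃ c : ℝ, ∀ (x : X.M) (v w : TangentSpace X.I x), X.ricci x v w = c * X.metric.inner x v w

/-- `f` is the potential function of a gradient `m`-quasi-Einstein structure with constant `lam`
on `X`: `f` is smooth and `Ric + ∇²f - (1/m) df ⊗ df = lam g`. -/
def IsGradientQuasiEinstein (m lam : ℝ) (f : X.M → ℝ) : Prop :=
  ContMDiff X.I 𝓘(ℝ, ℝ) ∞ f ∧
    ∀ (x : X.M) (v w : TangentSpace X.I x),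
      X.ricci x v w + X.hessian f x v w - 1 / m * (X.differential f x v * X.differential f x w)
        = lam * X.metric.inner x v w

/-- The equation `Δ e⁻ᶠ + lam e⁻ᶠ = 0`, which makes a gradient `1`-quasi-Einstein structure a
static metric with cosmological constant `lam`. -/
def IsStatic (lam : ℝ) (f : X.M → ℝ) : Prop :=
  ∀ x : X.M, X.laplacian (fun p ↦ Real.exp (-f p)) x + lam * Real.exp (-f x) = 0

/-- An isometry between Riemannian manifolds: a diffeomorphism that preserves the metrics. -/
structure Isometry (X Y : RiemannianManifold) where
  /-- the underlying diffeomorphism -/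
  toDiffeomorph : Diffeomorph X.I Y.I X.M Y.M ∞
  inner_map : ∀ (x : X.M) (v w : TangentSpace X.I x),
    Y.metric.inner (toDiffeomorph x) (mfderiv X.I Y.I toDiffeomorph x v)
      (mfderiv X.I Y.I toDiffeomorph x w) = X.metric.inner x v w

end RiemannianManifold

/-! ### Metrics induced by maps into vector spaces -/

section Induced

variable {E : Type*} [NormedAddCommGroup E] [NormedSpace ℝ E] [FiniteDimensional ℝ E]
  {H : Type*} [TopologicalSpace H] (I : ModelWithCorners ℝ E H)
  {M : Type*} [TopologicalSpace M] [ChartedSpace H M]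
  {F : Type*} [NormedAddCommGroup F] [NormedSpace ℝ F]

/-- The pull-back, under a map `Φ` into a normed space `F`, of the field `B` of bilinear forms
on `F`: `(v, w) ↦ B (Φ x) (dΦ v) (dΦ w)`. -/
noncomputable def inducedForm (Φ : M → F) (B : F → F →L[ℝ] F →L[ℝ] ℝ) (x : M) :
    TangentSpace I x →L[ℝ] TangentSpace I x →L[ℝ] ℝ :=
  ContinuousLinearMap.bilinearComp (B (Φ x))
    (E' := E) (F' := E) (mfderiv I 𝓘(ℝ, F) Φ x : E →L[ℝ] F) (mfderiv I 𝓘(ℝ, F) Φ x : E →L[ℝ] F)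

set_option synthInstance.maxHeartbeats 400000 in
theorem isVonNBounded_of_pos (G : E →L[ℝ] E →L[ℝ] ℝ) (hG : ∀ v, v ≠ 0 → 0 < G v v) :
    Bornology.IsVonNBounded ℝ {v : E | G v v < 1} := by
  rw [NormedSpace.isVonNBounded_iff]
  by_cases hS : (Metric.sphere (0 : E) 1).Nonempty
  · obtain ⟨u, hu, hmin⟩ := (isCompact_sphere (0 : E) 1).exists_isMinOn hS
      (f := fun v => G v v) (by fun_prop)
    have hu1 : ‖u‖ = 1 := by simpa using hu
    have hc : 0 < G u u := hG u (by rintro rfl; simp at hu1)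
    refine (Metric.isBounded_iff_subset_closedBall 0).2 ⟨1 / G u u + 1, fun v hv => ?_⟩
    have hv' : G v v < 1 := hv
    rw [mem_closedBall_zero_iff]
    by_cases hv0 : v = 0
    · subst hv0; simp; positivity
    have hn : 0 < ‖v‖ := norm_pos_iff.2 hv0
    have hm : G u u ≤ G (‖v‖⁻¹ • v) (‖v‖⁻¹ • v) :=
      hmin (by simp [norm_smul, hn.ne'])
    simp only [map_smul, smul_apply, smul_eq_mul] at hm
    have h2 : G u u * ‖v‖ ^ 2 ≤ G v v := by
      have := mul_le_mul_of_nonneg_right hm (sq_nonneg ‖v‖)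
      field_simp at this
      linarith
    have h3 : ‖v‖ ^ 2 < 1 / G u u := by rw [lt_div_iff₀ hc]; linarith
    nlinarith [sq_nonneg (‖v‖ - 1), one_div_pos.2 hc]
  · have : Subsingleton E := by
      by_contra h
      rw [not_subsingleton_iff_nontrivial] at h
      exact hS (NormedSpace.sphere_nonempty.2 zero_le_one)
    exact (Set.toFinite {v : E | G v v < 1}).isBounded

set_option synthInstance.maxHeartbeats 400000 in
theorem contDiff_bilinearComp : ContDiff ℝ ∞
    (fun p : (F →L[ℝ] F →L[ℝ] ℝ) × (E →L[ℝ] F) => (p.1.bilinearComp p.2 p.2 : E →L[ℝ] E →L[ℝ] ℝ)) := by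
  rw [contDiff_clm_apply_iff]
  intro v
  rw [contDiff_clm_apply_iff]
  intro w
  simp only [ContinuousLinearMap.bilinearComp_apply]
  exact (contDiff_fst.clm_apply (contDiff_snd.clm_apply contDiff_const)).clm_apply
    (contDiff_snd.clm_apply contDiff_const)

set_option synthInstance.maxHeartbeats 400000 in
theorem contMDiff_inducedForm [IsManifold I ∞ M] {Φ : M → F} (hΦ : ContMDiff I 𝓘(ℝ, F) ∞ Φ)
    {B : F → F →L[ℝ] F →L[ℝ] ℝ} (hB : ∀ x, ContDiffAt ℝ ∞ B (Φ x)) :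
    ContMDiff I (I.prod 𝓘(ℝ, E →L[ℝ] E →L[ℝ] ℝ)) ∞
      (fun x : M ↦ TotalSpace.mk' (E →L[ℝ] E →L[ℝ] ℝ)
        (E := fun x : M ↦ (TangentSpace I x →L[ℝ] TangentSpace I x →L[ℝ] ℝ)) x
        (inducedForm I Φ B x)) := by
  intro x₀
  rw [contMDiffAt_section]
  have hA := (hΦ x₀).mfderiv_const (m := ∞) (by simp)
  have hBc : ContMDiffAt I 𝓘(ℝ, F →L[ℝ] F →L[ℝ] ℝ) ∞ (fun x => B (Φ x)) x₀ :=
    (hB x₀).contMDiffAt.comp x₀ (hΦ x₀)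
  have key := (contDiff_bilinearComp (E := E) (F := F)).contMDiff.contMDiffAt.comp x₀
    (hBc.prodMk_space hA)
  refine key.congr_of_eventuallyEq ?_
  have hs : (trivializationAt E (TangentSpace I) x₀).baseSet ∈ nhds x₀ :=
    (trivializationAt E (TangentSpace I) x₀).open_baseSet.mem_nhds
      (FiberBundle.mem_baseSet_trivializationAt' x₀)
  filter_upwards [hs] with x hx
  ext v w
  rw [hom_trivializationAt_apply]
  have h := inCoordinates_apply_eq₂ (𝕜 := ℝ) (F₁ := E) (F₂ := E) (F₃ := ℝ)
    (E₁ := fun x : M => TangentSpace I x)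
    (E₂ := fun x : M => TangentSpace I x) (E₃ := Bundle.Trivial M ℝ)
    (ϕ := inducedForm I Φ B x) (v := v) (w := w) hx hx (Set.mem_univ _)
  refine h.trans ?_
  have h1 : ∀ u : E, inTangentCoordinates I 𝓘(ℝ, F) id Φ (mfderiv I 𝓘(ℝ, F) Φ) x₀ x u
      = mfderiv I 𝓘(ℝ, F) Φ x ((trivializationAt E (TangentSpace I) x₀).symm x u) := by
    intro u
    simp only [inTangentCoordinates, ContinuousLinearMap.inCoordinates,
      TangentBundle.continuousLinearMapAt_model_space]
    refine (congrArg (fun z => (mfderiv I 𝓘(ℝ, F) Φ x) z)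
      (Trivialization.symmL_apply (R := ℝ) (trivializationAt E (TangentSpace I) x₀) hx u) :)
  simp only [Function.comp, ContinuousLinearMap.bilinearComp_apply, h1]
  simp
  rfl

/-- The Riemannian metric induced by a smooth immersion `Φ : M → F` and a field `B` of symmetric
bilinear forms on `F`, positive definite at the points of the image of `Φ`. -/
noncomputable def inducedMetric [IsManifold I ∞ M] (Φ : M → F) (B : F → F →L[ℝ] F →L[ℝ] ℝ)
    (hΦ : ContMDiff I 𝓘(ℝ, F) ∞ Φ)
    (hinj : ∀ x, Function.Injective (mfderiv I 𝓘(ℝ, F) Φ x))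
    (hB : ∀ x, ContDiffAt ℝ ∞ B (Φ x)) (hsymm : ∀ x v w, B (Φ x) v w = B (Φ x) w v)
    (hpos : ∀ x v, v ≠ 0 → 0 < B (Φ x) v v) :
    ContMDiffRiemannianMetric I ∞ E (fun x : M ↦ TangentSpace I x) where
  inner := inducedForm I Φ B
  symm x _ _ := hsymm x _ _
  pos x _ hv := hpos x _ fun h ↦ hv (hinj x (h.trans (map_zero _).symm))
  isVonNBounded x := isVonNBounded_of_pos (E := E) (inducedForm I Φ B x)
    fun _ hv ↦ hpos x _ fun h ↦ hv (hinj x (h.trans (map_zero _).symm))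
  contMDiff := contMDiff_inducedForm I hΦ hB

end Induced

/-! ### The homogeneous spaces `E³(κ, τ)` -/

section BianchiCartanVranceanu

/-- The conformal factor `ρ = 1 / (1 + (κ/4)(x² + y²))` of the metric `ρ² (dx² + dy²)` of constant
curvature `κ`. -/
noncomputable def conformalFactor (κ : ℝ) (q : EuclideanSpace ℝ (Fin 3)) : ℝ :=
  (1 + κ / 4 * (q 0 ^ 2 + q 1 ^ 2))⁻¹

/-- The coordinate domain `{(x, y, t) : 1 + (κ/4)(x² + y²) > 0}`: all of `ℝ³` for `κ ≥ 0`, and the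
product of a disc of radius `2 / √(-κ)` and a line for `κ < 0`. -/
def bcvDomain (κ : ℝ) : TopologicalSpace.Opens (EuclideanSpace ℝ (Fin 3)) where
  carrier := {q | 0 < 1 + κ / 4 * (q 0 ^ 2 + q 1 ^ 2)}
  is_open' := isOpen_lt continuous_const (by fun_prop)

/-- The coordinate covectors `dx`, `dy`, `dt` (for `i = 0, 1, 2`). -/
noncomputable def dcoord (i : Fin 3) : EuclideanSpace ℝ (Fin 3) →L[ℝ] ℝ :=
  EuclideanSpace.proj i

/-- The connection form `dt + τ ρ (x dy - y dx)`, the metric dual of the vertical field `∂_t`. -/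
noncomputable def verticalForm (κ τ : ℝ) (q : EuclideanSpace ℝ (Fin 3)) :
    EuclideanSpace ℝ (Fin 3) →L[ℝ] ℝ :=
  dcoord 2 + (τ * conformalFactor κ q) • (q 0 • dcoord 1 - q 1 • dcoord 0)

/-- The metric `ρ² (dx² + dy²) + (dt + τ ρ (x dy - y dx))²`. -/
noncomputable def bcvForm (κ τ : ℝ) (q : EuclideanSpace ℝ (Fin 3)) :
    EuclideanSpace ℝ (Fin 3) →L[ℝ] EuclideanSpace ℝ (Fin 3) →L[ℝ] ℝ :=
  conformalFactor κ q ^ 2 •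
      ((dcoord 0).smulRight (dcoord 0) + (dcoord 1).smulRight (dcoord 1))
    + (verticalForm κ τ q).smulRight (verticalForm κ τ q)

theorem bcvForm_apply (κ τ : ℝ) (q v w : EuclideanSpace ℝ (Fin 3)) :
    bcvForm κ τ q v w = conformalFactor κ q ^ 2 * (v 0 * w 0 + v 1 * w 1)
      + (v 2 + τ * conformalFactor κ q * (q 0 * v 1 - q 1 * v 0))
        * (w 2 + τ * conformalFactor κ q * (q 0 * w 1 - q 1 * w 0)) :=
  rfl

theorem contDiffAt_bcvForm (κ τ : ℝ) (q : bcvDomain κ) : ContDiffAt ℝ ∞ (bcvForm κ τ) q := by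
  have h : 1 + κ / 4 * ((q : EuclideanSpace ℝ (Fin 3)) 0 ^ 2
      + (q : EuclideanSpace ℝ (Fin 3)) 1 ^ 2) ≠ 0 := ne_of_gt q.2
  have hρ : ContDiffAt ℝ ∞ (conformalFactor κ) q :=
    ContDiffAt.inv (by fun_prop) h
  have h0 : ∀ i : Fin 3, ContDiffAt ℝ ∞ (fun p : EuclideanSpace ℝ (Fin 3) ↦ p i) q :=
    fun i ↦ by fun_prop
  have hθ : ContDiffAt ℝ ∞ (verticalForm κ τ) q :=
    contDiffAt_const.add ((contDiffAt_const.mul hρ).smul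
      (ContDiffAt.sub (ContDiffAt.smul (h0 0) contDiffAt_const)
        (ContDiffAt.smul (h0 1) contDiffAt_const)))
  exact ((hρ.pow 2).smul contDiffAt_const).add (hθ.smulRight hθ)

theorem bcvForm_pos (κ τ : ℝ) (q : bcvDomain κ) (v : EuclideanSpace ℝ (Fin 3)) (hv : v ≠ 0) :
    0 < bcvForm κ τ q v v := by
  have h : 0 < conformalFactor κ q := inv_pos.2 q.2
  rw [bcvForm_apply]
  by_contra! hle
  have h0 : conformalFactor κ q ^ 2 * (v 0 * v 0 + v 1 * v 1) = 0 := by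
    nlinarith [mul_self_nonneg (v 2 + τ * conformalFactor κ q
      * ((q : EuclideanSpace ℝ (Fin 3)) 0 * v 1 - (q : EuclideanSpace ℝ (Fin 3)) 1 * v 0)),
      mul_nonneg (sq_nonneg (conformalFactor κ q))
        (add_nonneg (mul_self_nonneg (v 0)) (mul_self_nonneg (v 1)))]
  have h1 : v 0 * v 0 + v 1 * v 1 = 0 := (mul_eq_zero.1 h0).resolve_left (by positivity)
  have hv0 : v 0 = 0 := by nlinarith [mul_self_nonneg (v 0), mul_self_nonneg (v 1)]
  have hv1 : v 1 = 0 := by nlinarith [mul_self_nonneg (v 0), mul_self_nonneg (v 1)]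
  rw [h0, hv0, hv1] at hle
  have hv2 : v 2 = 0 := by
    simp only [mul_zero, sub_zero, add_zero, zero_add] at hle
    nlinarith [mul_self_nonneg (v 2)]
  apply hv
  ext i
  fin_cases i <;> simp [hv0, hv1, hv2]

theorem injective_mfderiv_coe_bcvDomain (κ : ℝ) (q : bcvDomain κ) :
    Function.Injective (mfderiv 𝓘(ℝ, EuclideanSpace ℝ (Fin 3)) 𝓘(ℝ, EuclideanSpace ℝ (Fin 3))
      ((↑) : bcvDomain κ → EuclideanSpace ℝ (Fin 3)) q) := by
  classical
  let r : EuclideanSpace ℝ (Fin 3) → bcvDomain κ := fun y ↦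
    if h : y ∈ bcvDomain κ then ⟨y, h⟩ else q
  have hr : ContMDiffAt 𝓘(ℝ, EuclideanSpace ℝ (Fin 3)) 𝓘(ℝ, EuclideanSpace ℝ (Fin 3)) ∞ r q := by
    rw [← ContMDiffAt.subtypeVal_comp_iff]
    refine contMDiffAt_id.congr_of_eventuallyEq ?_
    filter_upwards [(bcvDomain κ).isOpen.mem_nhds q.2] with y hy
    have hy' : y ∈ bcvDomain κ := hy
    simp [r, hy']
  have hc : r ∘ ((↑) : bcvDomain κ → EuclideanSpace ℝ (Fin 3)) = id := by
    funext y
    simp [r]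
  have h := mfderiv_comp q (hr.mdifferentiableAt (by simp))
    ((contMDiff_subtype_val (n := ∞) (I := 𝓘(ℝ, EuclideanSpace ℝ (Fin 3)))
      (U := bcvDomain κ) q).mdifferentiableAt (by simp))
  rw [hc, mfderiv_id] at h
  intro v w hvw
  have hv := congrArg (fun L ↦ L v) h
  have hw := congrArg (fun L ↦ L w) h
  exact (hv.trans (congrArg (mfderiv 𝓘(ℝ, EuclideanSpace ℝ (Fin 3))
    𝓘(ℝ, EuclideanSpace ℝ (Fin 3)) r q) hvw)).trans hw.symm

/-- The simply connected space with base curvature `κ` and bundle curvature `τ`, as the coordinate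
domain with the metric `ρ² (dx² + dy²) + (dt + τ ρ (x dy - y dx))²`; this is the whole space
`E³(κ, τ)` if `κ ≤ 0`. -/
noncomputable def bcvSpace (κ τ : ℝ) : RiemannianManifold where
  E := EuclideanSpace ℝ (Fin 3)
  H := EuclideanSpace ℝ (Fin 3)
  I := 𝓘(ℝ, EuclideanSpace ℝ (Fin 3))
  M := bcvDomain κ
  metric := inducedMetric 𝓘(ℝ, EuclideanSpace ℝ (Fin 3))
    ((↑) : bcvDomain κ → EuclideanSpace ℝ (Fin 3)) (bcvForm κ τ)
    contMDiff_subtype_val (injective_mfderiv_coe_bcvDomain κ) (contDiffAt_bcvForm κ τ)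
    (fun q v w ↦ by rw [bcvForm_apply, bcvForm_apply]; ring) (bcvForm_pos κ τ)

/-- The product `ℍ²_κ × ℝ` (for `κ < 0`) of the hyperbolic plane of curvature `κ`, in the
Poincaré disc model, and the line: the metric is `ρ² (dx² + dy²) + dt²`. -/
noncomputable abbrev hyperbolicPlaneTimesLine (κ : ℝ) : RiemannianManifold :=
  bcvSpace κ 0

/-- The coordinate `t` on `ℍ²_κ × ℝ`. -/
def height (κ : ℝ) (p : (hyperbolicPlaneTimesLine κ).M) : ℝ :=
  (show bcvDomain κ from p).1 2

end BianchiCartanVranceanu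

/-- The inner product, as a bilinear form. -/
noncomputable def euclideanForm (F : Type*) [NormedAddCommGroup F] [InnerProductSpace ℝ F] :
    F →L[ℝ] F →L[ℝ] ℝ :=
  innerSL ℝ (E := F)

instance fact_finrank_three : Fact (Module.finrank ℝ (EuclideanSpace ℝ (Fin 3)) = 2 + 1) :=
  ⟨finrank_euclideanSpace_fin⟩

instance fact_finrank_four : Fact (Module.finrank ℝ (EuclideanSpace ℝ (Fin 4)) = 3 + 1) :=
  ⟨finrank_euclideanSpace_fin⟩

section SphereTimesLine

/-- The product of `1 / κ` times the Euclidean metric of `ℝ³` and the metric of the line. -/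
noncomputable def productForm (κ : ℝ) :
    (EuclideanSpace ℝ (Fin 3) × ℝ) →L[ℝ] (EuclideanSpace ℝ (Fin 3) × ℝ) →L[ℝ] ℝ :=
  κ⁻¹ • ContinuousLinearMap.bilinearComp
      (euclideanForm (EuclideanSpace ℝ (Fin 3)))
      (ContinuousLinearMap.fst ℝ (EuclideanSpace ℝ (Fin 3)) ℝ)
      (ContinuousLinearMap.fst ℝ (EuclideanSpace ℝ (Fin 3)) ℝ)
    + (ContinuousLinearMap.snd ℝ (EuclideanSpace ℝ (Fin 3)) ℝ).smulRight
      (ContinuousLinearMap.snd ℝ (EuclideanSpace ℝ (Fin 3)) ℝ)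

theorem productForm_apply (κ : ℝ) (v w : EuclideanSpace ℝ (Fin 3) × ℝ) :
    productForm κ v w = κ⁻¹ * inner ℝ v.1 w.1 + v.2 * w.2 :=
  rfl

/-- The inclusion of the product of the unit sphere and the line into `ℝ³ × ℝ`. -/
def sphereLineIncl (p : Metric.sphere (0 : EuclideanSpace ℝ (Fin 3)) 1 × ℝ) :
    EuclideanSpace ℝ (Fin 3) × ℝ :=
  (p.1, p.2)

theorem contMDiff_sphereLineIncl :
    ContMDiff ((𝓡 2).prod 𝓘(ℝ, ℝ)) 𝓘(ℝ, EuclideanSpace ℝ (Fin 3) × ℝ) ∞ sphereLineIncl :=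
  (contMDiff_coe_sphere.comp contMDiff_fst).prodMk_space contMDiff_snd

theorem injective_mfderiv_sphereLineIncl
    (p : Metric.sphere (0 : EuclideanSpace ℝ (Fin 3)) 1 × ℝ) :
    Function.Injective (mfderiv ((𝓡 2).prod 𝓘(ℝ, ℝ)) 𝓘(ℝ, EuclideanSpace ℝ (Fin 3) × ℝ)
      sphereLineIncl p) := by
  have hΦ : MDifferentiableAt ((𝓡 2).prod 𝓘(ℝ, ℝ)) 𝓘(ℝ, EuclideanSpace ℝ (Fin 3) × ℝ)
      sphereLineIncl p := (contMDiff_sphereLineIncl p).mdifferentiableAt (by simp)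
  have h1 := (ContinuousLinearMap.fst ℝ (EuclideanSpace ℝ (Fin 3)) ℝ).hasMFDerivAt.comp p
    hΦ.hasMFDerivAt
  have h2 := (ContinuousLinearMap.snd ℝ (EuclideanSpace ℝ (Fin 3)) ℝ).hasMFDerivAt.comp p
    hΦ.hasMFDerivAt
  have h1' := (((contMDiff_coe_sphere (E := EuclideanSpace ℝ (Fin 3)) (n := 2) (m := ∞))
    p.1).mdifferentiableAt (by simp)).hasMFDerivAt.comp p
      (hasMFDerivAt_fst (I := 𝓡 2) (I' := 𝓘(ℝ, ℝ)) (x := p))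
  have h2' := hasMFDerivAt_snd (I := 𝓡 2) (I' := 𝓘(ℝ, ℝ)) (x := p)
  have e1 := hasMFDerivAt_unique h1 h1'
  have e2 := hasMFDerivAt_unique h2 h2'
  intro v w hvw
  refine Prod.ext ?_ ?_
  · refine injective_mvfderiv_subtypeVal_sphere p.1 ?_
    exact (congrArg (fun L ↦ L v) e1).symm.trans
      ((congrArg Prod.fst hvw).trans (congrArg (fun L ↦ L w) e1))
  · exact (congrArg (fun L ↦ L v) e2).symm.trans
      ((congrArg Prod.snd hvw).trans (congrArg (fun L ↦ L w) e2))

theorem productForm_pos {κ : ℝ} (hκ : 0 < κ) (v : EuclideanSpace ℝ (Fin 3) × ℝ) (hv : v ≠ 0) :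
    0 < productForm κ v v := by
  rw [productForm_apply, real_inner_self_eq_norm_sq]
  by_cases h : v.1 = 0
  · have h2 : v.2 ≠ 0 := fun h2 ↦ hv (Prod.ext h h2)
    have : 0 < v.2 * v.2 := mul_self_pos.2 h2
    simpa [h] using this
  · have : 0 < ‖v.1‖ := norm_pos_iff.2 h
    nlinarith [mul_self_nonneg v.2, mul_pos (inv_pos.2 hκ) (pow_pos this 2)]

/-- The product `𝕊²_κ × ℝ` of the sphere of curvature `κ > 0` (the unit sphere with `1 / κ` times
its metric) and the line. -/
noncomputable def sphereTimesLine (κ : ℝ) (hκ : 0 < κ) : RiemannianManifold where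
  E := EuclideanSpace ℝ (Fin 2) × ℝ
  H := ModelProd (EuclideanSpace ℝ (Fin 2)) ℝ
  I := (𝓡 2).prod 𝓘(ℝ, ℝ)
  M := Metric.sphere (0 : EuclideanSpace ℝ (Fin 3)) 1 × ℝ
  isManifold := IsManifold.of_le (n := ω) le_top
  metric := inducedMetric ((𝓡 2).prod 𝓘(ℝ, ℝ)) sphereLineIncl (fun _ ↦ productForm κ)
    contMDiff_sphereLineIncl injective_mfderiv_sphereLineIncl (fun _ ↦ contDiffAt_const)
    (fun _ v w ↦ by
      rw [productForm_apply, productForm_apply, real_inner_comm, mul_comm v.2])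
    (fun _ ↦ productForm_pos hκ)

end SphereTimesLine

section BergerSphere

/-- The Hopf vector field `V(z, w) = (i z, i w)` on `ℂ² = ℝ⁴`. -/
noncomputable def hopfField (z : EuclideanSpace ℝ (Fin 4)) : EuclideanSpace ℝ (Fin 4) :=
  !₂[-z 1, z 0, -z 3, z 2]

/-- The bilinear form `(4/κ) (⟨X, Y⟩ + (4τ²/κ - 1) ⟨X, V⟩ ⟨Y, V⟩)`. -/
noncomputable def bergerForm (κ τ : ℝ) (z : EuclideanSpace ℝ (Fin 4)) :
    EuclideanSpace ℝ (Fin 4) →L[ℝ] EuclideanSpace ℝ (Fin 4) →L[ℝ] ℝ :=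
  (4 / κ) • (euclideanForm (EuclideanSpace ℝ (Fin 4))
    + (4 * τ ^ 2 / κ - 1) •
    (euclideanForm _ (hopfField z)).smulRight (euclideanForm _ (hopfField z)))

theorem bergerForm_apply (κ τ : ℝ) (z v w : EuclideanSpace ℝ (Fin 4)) :
    bergerForm κ τ z v w = 4 / κ * (inner ℝ v w + (4 * τ ^ 2 / κ - 1) *
      (inner ℝ (hopfField z) v * inner ℝ (hopfField z) w)) :=
  rfl

theorem contDiff_bergerForm (κ τ : ℝ) : ContDiff ℝ ∞ (bergerForm κ τ) := by
  have hV : ContDiff ℝ ∞ hopfField := by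
    rw [contDiff_euclidean]
    intro i
    fin_cases i <;> simp [hopfField] <;> fun_prop
  have hθ : ContDiff ℝ ∞ fun z ↦ euclideanForm _ (hopfField z) :=
    (euclideanForm (EuclideanSpace ℝ (Fin 4))).contDiff.comp hV
  exact (contDiff_const (c := 4 / κ)).smul (contDiff_const.add (ContDiff.smul
    (contDiff_const (c := 4 * τ ^ 2 / κ - 1)) (hθ.smulRight hθ)))

theorem bergerForm_pos {κ τ : ℝ} (hκ : 0 < κ) (hτ : τ ≠ 0)
    (z : Metric.sphere (0 : EuclideanSpace ℝ (Fin 4)) 1)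
    (v : EuclideanSpace ℝ (Fin 4)) (hv : v ≠ 0) : 0 < bergerForm κ τ z v v := by
  have hz : ‖hopfField z‖ = 1 := by
    have h : ‖(z : EuclideanSpace ℝ (Fin 4))‖ = 1 := norm_eq_of_mem_sphere z
    rw [EuclideanSpace.norm_eq] at h ⊢
    refine Eq.trans ?_ h
    congr 1
    simp [hopfField, Fin.sum_univ_four]
    ring
  have hcs := real_inner_mul_inner_self_le (hopfField z) v
  rw [real_inner_self_eq_norm_sq (hopfField z), hz] at hcs
  rw [bergerForm_apply]
  have hvv : 0 < inner ℝ v v := real_inner_self_pos.2 hv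
  have hc : 0 < 4 * τ ^ 2 / κ := by positivity
  refine mul_pos (by positivity) ?_
  by_cases h0 : inner ℝ (hopfField z) v = 0
  · simpa [h0] using hvv
  · have : 0 < inner ℝ (hopfField z) v * inner ℝ (hopfField z) v := mul_self_pos.2 h0
    nlinarith [mul_pos hc this]

/-- The Berger sphere `𝕊³_{κ,τ}`, for `κ > 0` and `τ ≠ 0`: the unit sphere of `ℂ² = ℝ⁴` with the
metric `(4/κ) (⟨X, Y⟩ + (4τ²/κ - 1) ⟨X, V⟩ ⟨Y, V⟩)`, where `V` is the Hopf field. -/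
noncomputable def bergerSphere (κ τ : ℝ) (hκ : 0 < κ) (hτ : τ ≠ 0) : RiemannianManifold where
  E := EuclideanSpace ℝ (Fin 3)
  H := EuclideanSpace ℝ (Fin 3)
  I := 𝓡 3
  M := Metric.sphere (0 : EuclideanSpace ℝ (Fin 4)) 1
  isManifold := IsManifold.of_le (n := ω) le_top
  metric := inducedMetric (𝓡 3)
    ((↑) : Metric.sphere (0 : EuclideanSpace ℝ (Fin 4)) 1 → EuclideanSpace ℝ (Fin 4))
    (bergerForm κ τ) contMDiff_coe_sphere (fun z ↦ injective_mvfderiv_subtypeVal_sphere z)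
    (fun _ ↦ (contDiff_bergerForm κ τ).contDiffAt)
    (fun z v w ↦ by
      rw [bergerForm_apply, bergerForm_apply, real_inner_comm,
        mul_comm (inner ℝ (hopfField z) v)])
    (bergerForm_pos hκ hτ)

end BergerSphere

/-- The simply connected homogeneous space `E³(κ, τ)`, a Riemannian fibration with bundle
curvature `τ` over the simply connected surface of constant curvature `κ`:
* `ℍ²_κ × ℝ` for `κ < 0`, `τ = 0`; the Heisenberg group `Nil₃` for `κ = 0`, `τ ≠ 0`; the universal
  cover of `PSL₂(ℝ)` for `κ < 0`, `τ ≠ 0` (all of these are given by the same formula);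
* `𝕊²_κ × ℝ` for `κ > 0`, `τ = 0`;
* the Berger sphere `𝕊³_{κ,τ}` for `κ > 0`, `τ ≠ 0`.
(For `κ = τ = 0` the formula gives flat space, which is not counted among these spaces.) -/
noncomputable def E3 (κ τ : ℝ) : RiemannianManifold :=
  if hκ : 0 < κ then
    if hτ : τ = 0 then sphereTimesLine κ hκ else bergerSphere κ τ hκ hτ
  else bcvSpace κ τ

end QuasiEinstein

namespace QuasiEinstein

section CoordinateCurvature

variable {E : Type*} [NormedAddCommGroup E] [NormedSpace ℝ E]

open Filter Topology ContinuousLinearMap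

theorem isSymmSndFDerivAt_of_contDiffAt {F : Type*} [NormedAddCommGroup F] [NormedSpace ℝ F]
    {ψ : E → F} {y : E} (hψ : ContDiffAt ℝ ∞ ψ y) : IsSymmSndFDerivAt ℝ ψ y := by
  refine hψ.isSymmSndFDerivAt ?_
  rw [minSmoothness_of_isRCLikeNormedField]
  exact WithTop.coe_le_coe.2 le_top

theorem isInvertible_of_pos [FiniteDimensional ℝ E] {B : E →L[ℝ] E →L[ℝ] ℝ}
    (hB : ∀ v, v ≠ 0 → 0 < B v v) : B.IsInvertible := by
  have hinj : Function.Injective (B : E →ₗ[ℝ] E →L[ℝ] ℝ) := by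
    rw [← LinearMap.ker_eq_bot, LinearMap.ker_eq_bot']
    intro v hv
    by_contra h
    have h1 := hB v h
    have h2 : B v = 0 := hv
    rw [h2] at h1
    simp at h1
  have hfr : Module.finrank ℝ E = Module.finrank ℝ (E →L[ℝ] ℝ) := by
    rw [← (LinearMap.toContinuousLinearMap (𝕜 := ℝ) (E := E) (F' := ℝ)).finrank_eq]
    exact Subspace.dual_finrank_eq.symm
  refine ⟨(LinearMap.linearEquivOfInjective _ hinj hfr).toContinuousLinearEquiv, ?_⟩
  ext v w
  rfl

theorem eventually_isInvertible [CompleteSpace E] {F : Type*} [NormedAddCommGroup F]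
    [NormedSpace ℝ F] {G : E → E →L[ℝ] F} {y : E} (hG : ContinuousAt G y)
    (hy : (G y).IsInvertible) : ∀ᶠ p in 𝓝 y, (G p).IsInvertible := by
  obtain ⟨e, he⟩ := hy
  have h := hG.eventually (he ▸ ContinuousLinearEquiv.nhds e)
  filter_upwards [h] with p hp
  exact hp

theorem christoffel_eq {G : E → E →L[ℝ] E →L[ℝ] ℝ} {y u v X : E} (hG : (G y).IsInvertible)
    (h : ∀ w, christoffelFirst G y u v w = G y X w) : christoffel G y u v = X := by
  have h1 : christoffelFirst G y u v = G y X := ContinuousLinearMap.ext h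
  change (G y).inverse (christoffelFirst G y u v) = X
  rw [h1, hG.inverse_apply_self]

theorem apply_christoffel {G : E → E →L[ℝ] E →L[ℝ] ℝ} {y : E} (hG : (G y).IsInvertible)
    (u v w : E) : G y (christoffel G y u v) w = christoffelFirst G y u v w := by
  change G y ((G y).inverse (christoffelFirst G y u v)) w = _
  rw [hG.self_apply_inverse]

theorem contDiffAt_christoffel [CompleteSpace E] {G : E → E →L[ℝ] E →L[ℝ] ℝ} {y : E}
    (hG : ContDiffAt ℝ ∞ G y) (hy : (G y).IsInvertible) :
    ContDiffAt ℝ ∞ (christoffel G) y := by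
  have h1 : ContDiffAt ℝ ∞ (fderiv ℝ G) y := hG.fderiv_right (by simp)
  have h2 : ContDiffAt ℝ ∞ (fun p ↦ (fderiv ℝ G p).flip) y :=
    (ContinuousLinearMap.flipₗᵢ ℝ E E (E →L[ℝ] ℝ)).contDiff.contDiffAt.comp y h1
  have h3 : ContDiffAt ℝ ∞ (christoffelFirst G) y :=
    (contDiffAt_const (c := (1 / 2 : ℝ))).smul ((h1.add h2).sub (contDiffAt_const.clm_comp h2))
  have h4 : ContDiffAt ℝ ∞ (fun p ↦ (G p).inverse) y :=
    hy.contDiffAt_map_inverse.comp y hG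
  exact (((ContinuousLinearMap.compL ℝ E (E →L[ℝ] ℝ) E).contDiff.contDiffAt.comp y h4).clm_comp h3)

theorem christoffel_congr {G G' : E → E →L[ℝ] E →L[ℝ] ℝ} {y : E} (h : G =ᶠ[𝓝 y] G') :
    christoffel G y = christoffel G' y := by
  have h1 : christoffelFirst G y = christoffelFirst G' y := by
    unfold christoffelFirst
    rw [h.fderiv_eq]
  unfold christoffel
  rw [h1, h.eq_of_nhds]

theorem coordRicci_congr {G G' : E → E →L[ℝ] E →L[ℝ] ℝ} {y : E} (h : G =ᶠ[𝓝 y] G') :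
    coordRicci G y = coordRicci G' y := by
  have h1 : christoffel G =ᶠ[𝓝 y] christoffel G' := by
    filter_upwards [h.eventually_nhds] with p hp using christoffel_congr hp
  funext v w
  unfold coordRicci curvatureEndo
  rw [h1.fderiv_eq, h1.eq_of_nhds]

theorem coordHessian_congr {G G' : E → E →L[ℝ] E →L[ℝ] ℝ} {f f' : E → ℝ} {y : E}
    (h : G =ᶠ[𝓝 y] G') (hf : f =ᶠ[𝓝 y] f') : coordHessian G f y = coordHessian G' f' y := by
  have h1 : fderiv ℝ f =ᶠ[𝓝 y] fderiv ℝ f' := hf.fderiv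
  unfold coordHessian
  rw [h1.fderiv_eq, h1.eq_of_nhds, christoffel_congr h]

theorem coordHessian_apply (G : E → E →L[ℝ] E →L[ℝ] ℝ) (f : E → ℝ) (y v w : E) :
    coordHessian G f y v w = fderiv ℝ (fderiv ℝ f) y v w - fderiv ℝ f y (christoffel G y v w) :=
  rfl

theorem christoffel_symm {G : E → E →L[ℝ] E →L[ℝ] ℝ} {y : E} (hG : DifferentiableAt ℝ G y)
    (hy : (G y).IsInvertible) (hsymm : ∀ᶠ p in 𝓝 y, ∀ v w, G p v w = G p w v) (u v : E) :
    christoffel G y u v = christoffel G y v u := by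
  have hd : ∀ u v w, fderiv ℝ G y u v w = fderiv ℝ G y u w v := by
    intro u v w
    have e : (fun p ↦ G p v w) =ᶠ[𝓝 y] fun p ↦ G p w v := by
      filter_upwards [hsymm] with p hp using hp v w
    have h1 := ((hG.hasFDerivAt.clm_apply (hasFDerivAt_const v y)).clm_apply
      (hasFDerivAt_const w y))
    have h2 := ((hG.hasFDerivAt.clm_apply (hasFDerivAt_const w y)).clm_apply
      (hasFDerivAt_const v y))
    have h3 := congrArg (fun L ↦ L u) (h1.unique (h2.congr_of_eventuallyEq e))
    simpa using h3
  refine christoffel_eq hy fun w ↦ ?_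
  rw [apply_christoffel hy, christoffelFirst_apply, christoffelFirst_apply, hd w u v]
  ring

/-- Let `e` be a moving frame (an isomorphism onto `E` at each point), and let the connection be
`∇_{e U} (e V) = e (Ω (U, V))`. The curvature in this frame. -/
theorem curvatureEndo_frame [CompleteSpace E] {W : Type*} [NormedAddCommGroup W]
    [NormedSpace ℝ W] {G : E → E →L[ℝ] E →L[ℝ] ℝ} {y : E} {e : E → W →L[ℝ] E}
    {Ω : E → W →L[ℝ] W →L[ℝ] W} (hΓ : DifferentiableAt ℝ (christoffel G) y)
    (hsymm : ∀ u v, christoffel G y u v = christoffel G y v u)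
    (he : ContDiffAt ℝ ∞ e y) (hΩ : DifferentiableAt ℝ Ω y)
    (h : ∀ᶠ p in 𝓝 y, ∀ U V,
      christoffel G p (e p U) (e p V) + fderiv ℝ e p (e p U) V = e p (Ω p U V)) (T V Z : W) :
    curvatureEndo G y (e y V) (e y Z) (e y T) =
      e y (fderiv ℝ Ω y (e y T) V Z - fderiv ℝ Ω y (e y V) T Z + Ω y T (Ω y V Z)
        - Ω y V (Ω y T Z) - Ω y (Ω y T V - Ω y V T) Z) := by
  have hde : DifferentiableAt ℝ (fderiv ℝ e) y :=
    (he.fderiv_right (m := ∞) (by simp)).differentiableAt (by simp)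
  have he1 : HasFDerivAt e (fderiv ℝ e y) y := (he.differentiableAt (by simp)).hasFDerivAt
  have hs := isSymmSndFDerivAt_of_contDiffAt he
  have hy := h.self_of_nhds
  have key : ∀ X V Z, fderiv ℝ (christoffel G) y X (e y V) (e y Z)
      + christoffel G y (fderiv ℝ e y X V) (e y Z) + christoffel G y (e y V) (fderiv ℝ e y X Z)
      + fderiv ℝ (fderiv ℝ e) y X (e y V) Z + fderiv ℝ e y (fderiv ℝ e y X V) Z
      = fderiv ℝ e y X (Ω y V Z) + e y (fderiv ℝ Ω y X V Z) := by
    intro X V Z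
    have eV : HasFDerivAt (fun p ↦ e p V) _ y := he1.clm_apply (hasFDerivAt_const V y)
    have eZ : HasFDerivAt (fun p ↦ e p Z) _ y := he1.clm_apply (hasFDerivAt_const Z y)
    have l1 := (hΓ.hasFDerivAt.clm_apply eV).clm_apply eZ
    have l2 := (hde.hasFDerivAt.clm_apply eV).clm_apply (hasFDerivAt_const Z y)
    have r := he1.clm_apply ((hΩ.hasFDerivAt.clm_apply (hasFDerivAt_const V y)).clm_apply
      (hasFDerivAt_const Z y))
    have ee : (fun p ↦ christoffel G p (e p V) (e p Z) + fderiv ℝ e p (e p V) Z)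
        =ᶠ[𝓝 y] fun p ↦ e p (Ω p V Z) := by
      filter_upwards [h] with p hp using hp V Z
    have h3 := congrArg (fun L ↦ L X) ((l1.add l2).unique (r.congr_of_eventuallyEq ee))
    simp at h3
    rw [add_comm (fderiv ℝ e y X (Ω y V Z)), ← h3]
    abel
  have k1 := key (e y T) V Z
  have k2 := key (e y V) T Z
  have s1 : fderiv ℝ (fderiv ℝ e) y (e y T) (e y V) = fderiv ℝ (fderiv ℝ e) y (e y V) (e y T) :=
    hs.eq _ _
  have s2 : fderiv ℝ e y (e y T) V - fderiv ℝ e y (e y V) T = e y (Ω y T V - Ω y V T) := by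
    rw [map_sub, ← hy T V, ← hy V T, hsymm]
    abel
  have a1 : ∀ U V, fderiv ℝ e y (e y U) V = e y (Ω y U V) - christoffel G y (e y U) (e y V) :=
    fun U V ↦ eq_sub_of_add_eq' (hy U V)
  have c := hy (Ω y T V - Ω y V T) Z
  rw [← s2] at c
  simp only [map_sub, sub_apply] at c
  rw [a1 T (Ω y V Z), a1 T Z, s1] at k1
  rw [a1 V (Ω y T Z), a1 V Z] at k2
  simp only [map_sub] at k1 k2
  rw [curvatureEndo_apply, eq_sub_of_add_eq (eq_sub_of_add_eq (eq_sub_of_add_eq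
    (eq_sub_of_add_eq k1))), eq_sub_of_add_eq (eq_sub_of_add_eq (eq_sub_of_add_eq
    (eq_sub_of_add_eq k2)))]
  simp only [map_sub, map_add, sub_apply]
  rw [← c]
  abel

/-- A map `ψ : E → F` is totally geodesic for the connection `d + q` on `F`. The Gauss equation. -/
theorem fderiv_curvatureEndo [CompleteSpace E] {F : Type*} [NormedAddCommGroup F]
    [NormedSpace ℝ F] {G : E → E →L[ℝ] E →L[ℝ] ℝ} {y : E} {ψ : E → F}
    {q : F → F →L[ℝ] F →L[ℝ] F} (hΓ : DifferentiableAt ℝ (christoffel G) y)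
    (hψ : ContDiffAt ℝ ∞ ψ y) (hq : DifferentiableAt ℝ q (ψ y))
    (h : ∀ᶠ p in 𝓝 y, ∀ u v, fderiv ℝ ψ p (christoffel G p u v) =
      fderiv ℝ (fderiv ℝ ψ) p u v + q (ψ p) (fderiv ℝ ψ p u) (fderiv ℝ ψ p v)) (u v w : E) :
    fderiv ℝ ψ y (curvatureEndo G y v w u) =
      fderiv ℝ q (ψ y) (fderiv ℝ ψ y u) (fderiv ℝ ψ y v) (fderiv ℝ ψ y w)
      - fderiv ℝ q (ψ y) (fderiv ℝ ψ y v) (fderiv ℝ ψ y u) (fderiv ℝ ψ y w)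
      + q (ψ y) (fderiv ℝ ψ y u) (q (ψ y) (fderiv ℝ ψ y v) (fderiv ℝ ψ y w))
      - q (ψ y) (fderiv ℝ ψ y v) (q (ψ y) (fderiv ℝ ψ y u) (fderiv ℝ ψ y w)) := by
  have hψ1 : HasFDerivAt ψ (fderiv ℝ ψ y) y := (hψ.differentiableAt (by simp)).hasFDerivAt
  have hd1 : ContDiffAt ℝ ∞ (fderiv ℝ ψ) y := hψ.fderiv_right (by simp)
  have hd2 : ContDiffAt ℝ ∞ (fderiv ℝ (fderiv ℝ ψ)) y := hd1.fderiv_right (by simp)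
  have h1 : HasFDerivAt (fderiv ℝ ψ) (fderiv ℝ (fderiv ℝ ψ) y) y :=
    (hd1.differentiableAt (by simp)).hasFDerivAt
  have h2 : HasFDerivAt (fderiv ℝ (fderiv ℝ ψ)) (fderiv ℝ (fderiv ℝ (fderiv ℝ ψ)) y) y :=
    (hd2.differentiableAt (by simp)).hasFDerivAt
  have hs := isSymmSndFDerivAt_of_contDiffAt hψ
  have hs3 : ∀ u v, fderiv ℝ (fderiv ℝ (fderiv ℝ ψ)) y u v
      = fderiv ℝ (fderiv ℝ (fderiv ℝ ψ)) y v u :=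
    fun u v ↦ (isSymmSndFDerivAt_of_contDiffAt hd1).eq u v
  have hy := h.self_of_nhds
  have key : ∀ u v w, fderiv ℝ (fderiv ℝ ψ) y u (christoffel G y v w)
      + fderiv ℝ ψ y (fderiv ℝ (christoffel G) y u v w)
      = fderiv ℝ (fderiv ℝ (fderiv ℝ ψ)) y u v w
        + fderiv ℝ q (ψ y) (fderiv ℝ ψ y u) (fderiv ℝ ψ y v) (fderiv ℝ ψ y w)
        + q (ψ y) (fderiv ℝ (fderiv ℝ ψ) y u v) (fderiv ℝ ψ y w)
        + q (ψ y) (fderiv ℝ ψ y v) (fderiv ℝ (fderiv ℝ ψ) y u w) := by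
    intro u v w
    have l := h1.clm_apply ((hΓ.hasFDerivAt.clm_apply (hasFDerivAt_const v y)).clm_apply
      (hasFDerivAt_const w y))
    have r1 := (h2.clm_apply (hasFDerivAt_const v y)).clm_apply (hasFDerivAt_const w y)
    have r2 := ((hq.hasFDerivAt.comp y hψ1).clm_apply
      (h1.clm_apply (hasFDerivAt_const v y))).clm_apply (h1.clm_apply (hasFDerivAt_const w y))
    have e : (fun p ↦ fderiv ℝ ψ p (christoffel G p v w)) =ᶠ[𝓝 y]
        fun p ↦ fderiv ℝ (fderiv ℝ ψ) p v w
          + (q ∘ ψ) p (fderiv ℝ ψ p v) (fderiv ℝ ψ p w) := by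
      filter_upwards [h] with p hp using hp v w
    have h3 := congrArg (fun L ↦ L u) (l.unique ((r1.add r2).congr_of_eventuallyEq e))
    simp at h3
    rw [add_comm, h3]
    abel
  have k1 := eq_sub_of_add_eq' (key u v w)
  have k2 := eq_sub_of_add_eq' (key v u w)
  have b : ∀ u v w, q (ψ y) (fderiv ℝ ψ y u) (fderiv ℝ (fderiv ℝ ψ) y v w)
      = q (ψ y) (fderiv ℝ ψ y u) (fderiv ℝ ψ y (christoffel G y v w))
        - q (ψ y) (fderiv ℝ ψ y u) (q (ψ y) (fderiv ℝ ψ y v) (fderiv ℝ ψ y w)) := by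
    intro u v w
    rw [hy v w, map_add]
    abel
  have s : fderiv ℝ (fderiv ℝ ψ) y v u = fderiv ℝ (fderiv ℝ ψ) y u v := hs.eq v u
  rw [curvatureEndo_apply]
  simp only [map_sub, map_add]
  rw [k1, k2, hy u (christoffel G y v w), hy v (christoffel G y u w), b u v w, b v u w, s,
    hs3 v u]
  abel

end CoordinateCurvature

section InducedCurvature

variable {E : Type*} [NormedAddCommGroup E] [NormedSpace ℝ E]

open Filter Topology ContinuousLinearMap

/-- The Levi-Civita connection in a moving frame with constant scalar products. -/
theorem christoffel_frame {W : Type*} [NormedAddCommGroup W]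
    [NormedSpace ℝ W] {G : E → E →L[ℝ] E →L[ℝ] ℝ} {y : E} {e : E → W →L[ℝ] E}
    {A : W →L[ℝ] W →L[ℝ] W} (β : W → W → ℝ) (hG : DifferentiableAt ℝ G y)
    (hinv : (G y).IsInvertible) (hGs : ∀ v w, G y v w = G y w v) (he : DifferentiableAt ℝ e y)
    (hsurj : Function.Surjective (e y))
    (hβ : ∀ᶠ p in 𝓝 y, ∀ V Z, G p (e p V) (e p Z) = β V Z)
    (hA : ∀ U V Z, β (A U V) Z + β V (A U Z) = 0)
    (hT : ∀ U V, e y (A U V) - e y (A V U) = fderiv ℝ e y (e y U) V - fderiv ℝ e y (e y V) U)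
    (U V : W) :
    christoffel G y (e y U) (e y V) + fderiv ℝ e y (e y U) V = e y (A U V) := by
  have hd : ∀ U V Z, fderiv ℝ G y (e y U) (e y V) (e y Z)
      = G y (e y (A U V) - fderiv ℝ e y (e y U) V) (e y Z)
        + G y (e y V) (e y (A U Z) - fderiv ℝ e y (e y U) Z) := by
    intro U V Z
    have eV : HasFDerivAt (fun p ↦ e p V) _ y := he.hasFDerivAt.clm_apply (hasFDerivAt_const V y)
    have eZ : HasFDerivAt (fun p ↦ e p Z) _ y := he.hasFDerivAt.clm_apply (hasFDerivAt_const Z y)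
    have h1 := (hG.hasFDerivAt.clm_apply eV).clm_apply eZ
    have ee : (fun p ↦ G p (e p V) (e p Z)) =ᶠ[𝓝 y] fun _ ↦ β V Z := by
      filter_upwards [hβ] with p hp using hp V Z
    have h2 := congrArg (fun L ↦ L (e y U))
      (h1.unique ((hasFDerivAt_const (β V Z) y).congr_of_eventuallyEq ee))
    simp at h2
    have h3 := hA U V Z
    rw [← hβ.self_of_nhds, ← hβ.self_of_nhds] at h3
    simp only [map_sub, sub_apply]
    linarith
  rw [← eq_sub_iff_add_eq]
  refine christoffel_eq hinv fun w ↦ ?_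
  obtain ⟨Z, rfl⟩ := hsurj w
  have t : ∀ U V, e y (A U V) - fderiv ℝ e y (e y U) V
      = e y (A V U) - fderiv ℝ e y (e y V) U := fun U V ↦ by
    rw [sub_eq_sub_iff_sub_eq_sub]; exact hT U V
  rw [christoffelFirst_apply, hd, hd, hd, t V U, t Z U, t Z V,
    hGs (e y V) (e y (A U Z) - _)]
  ring

variable {F : Type*} [NormedAddCommGroup F] [NormedSpace ℝ F]

theorem contDiffAt_bilinearComp {B : E → F →L[ℝ] F →L[ℝ] ℝ} {L : E → E →L[ℝ] F} {y : E}
    [FiniteDimensional ℝ E] (hB : ContDiffAt ℝ ∞ B y) (hL : ContDiffAt ℝ ∞ L y) :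
    ContDiffAt ℝ ∞ (fun p ↦ ((B p).bilinearComp (L p) (L p) : E →L[ℝ] E →L[ℝ] ℝ)) y :=
  ContDiffAt.comp (g := fun p : (F →L[ℝ] F →L[ℝ] ℝ) × (E →L[ℝ] F) ↦
    (p.1.bilinearComp p.2 p.2 : E →L[ℝ] E →L[ℝ] ℝ)) (f := fun p ↦ (B p, L p)) y
    contDiff_bilinearComp.contDiffAt (hB.prodMk hL)

theorem fderiv_christoffel_induced [FiniteDimensional ℝ E]
    {G : E → E →L[ℝ] E →L[ℝ] ℝ} {y : E} {ψ : E → F}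
    {B : F → F →L[ℝ] F →L[ℝ] ℝ} {q : F →L[ℝ] F →L[ℝ] F}
    (hψ : ContDiffAt ℝ ∞ ψ y) (hB : ContDiffAt ℝ ∞ B (ψ y))
    (hG : G =ᶠ[𝓝 y] fun p ↦ (B (ψ p)).bilinearComp (fderiv ℝ ψ p) (fderiv ℝ ψ p))
    (hinv : (G y).IsInvertible) (hBs : ∀ V W, B (ψ y) V W = B (ψ y) W V)
    (hqs : ∀ U V, q U V = q V U)
    (hq : ∀ u v w, fderiv ℝ B (ψ y) (fderiv ℝ ψ y u) (fderiv ℝ ψ y v) (fderiv ℝ ψ y w) =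
      B (ψ y) (q (fderiv ℝ ψ y u) (fderiv ℝ ψ y v)) (fderiv ℝ ψ y w)
      + B (ψ y) (fderiv ℝ ψ y v) (q (fderiv ℝ ψ y u) (fderiv ℝ ψ y w)))
    (hr : ∀ u v, ∃ w, fderiv ℝ ψ y w =
      fderiv ℝ (fderiv ℝ ψ) y u v + q (fderiv ℝ ψ y u) (fderiv ℝ ψ y v)) (u v : E) :
    fderiv ℝ ψ y (christoffel G y u v) =
      fderiv ℝ (fderiv ℝ ψ) y u v + q (fderiv ℝ ψ y u) (fderiv ℝ ψ y v) := by
  have hψ1 : HasFDerivAt ψ (fderiv ℝ ψ y) y := (hψ.differentiableAt (by simp)).hasFDerivAt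
  have hc1 : ContDiffAt ℝ ∞ (fderiv ℝ ψ) y := hψ.fderiv_right (by simp)
  have hd1 : HasFDerivAt (fderiv ℝ ψ) (fderiv ℝ (fderiv ℝ ψ) y) y :=
    (hc1.differentiableAt (by simp)).hasFDerivAt
  have hGd : DifferentiableAt ℝ G y := by
    have h1 := contDiffAt_bilinearComp (hB.comp y hψ) hc1
    exact (h1.differentiableAt (by simp)).congr_of_eventuallyEq hG
  have hs := isSymmSndFDerivAt_of_contDiffAt hψ
  have hGy : ∀ v w, G y v w = B (ψ y) (fderiv ℝ ψ y v) (fderiv ℝ ψ y w) := fun v w ↦ by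
    rw [hG.self_of_nhds]; rfl
  have hd : ∀ u v w, fderiv ℝ G y u v w
      = B (ψ y) (fderiv ℝ (fderiv ℝ ψ) y u v + q (fderiv ℝ ψ y u) (fderiv ℝ ψ y v))
          (fderiv ℝ ψ y w)
        + B (ψ y) (fderiv ℝ (fderiv ℝ ψ) y u w + q (fderiv ℝ ψ y u) (fderiv ℝ ψ y w))
          (fderiv ℝ ψ y v) := by
    intro u v w
    have h1 := (hGd.hasFDerivAt.clm_apply (hasFDerivAt_const v y)).clm_apply
      (hasFDerivAt_const w y)
    have hBd := (hB.differentiableAt (by simp)).hasFDerivAt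
    have h2 := ((hBd.comp y hψ1).clm_apply (hd1.clm_apply (hasFDerivAt_const v y))).clm_apply
      (hd1.clm_apply (hasFDerivAt_const w y))
    have ee : (fun p ↦ G p v w) =ᶠ[𝓝 y]
        fun p ↦ (B ∘ ψ) p (fderiv ℝ ψ p v) (fderiv ℝ ψ p w) := by
      filter_upwards [hG] with p hp
      rw [hp]; rfl
    have h3 := congrArg (fun L ↦ L u) (h1.unique (h2.congr_of_eventuallyEq ee))
    simp at h3
    rw [h3, hq, hBs _ (fderiv ℝ ψ y v)]
    simp only [map_add, add_apply]
    rw [hBs (fderiv ℝ (fderiv ℝ ψ) y u v) (fderiv ℝ ψ y w),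
      hBs (q (fderiv ℝ ψ y u) (fderiv ℝ ψ y v)) (fderiv ℝ ψ y w)]
    ring
  obtain ⟨X, hX⟩ := hr u v
  rw [← hX]
  congr 1
  refine christoffel_eq hinv fun w ↦ ?_
  rw [christoffelFirst_apply, hd, hd, hd, hGy, hX, hs.eq v u, hs.eq w u, hs.eq w v,
    hqs (fderiv ℝ ψ y v) (fderiv ℝ ψ y u), hqs (fderiv ℝ ψ y w) (fderiv ℝ ψ y u),
    hqs (fderiv ℝ ψ y w) (fderiv ℝ ψ y v)]
  ring

/-- The range of an injective map into the kernel of a nonzero functional, in codimension one. -/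
theorem exists_apply_eq_of_finrank [FiniteDimensional ℝ E] [FiniteDimensional ℝ F]
    (hdim : Module.finrank ℝ F = Module.finrank ℝ E + 1) {L : E →L[ℝ] F}
    (hL : Function.Injective L) {N : F →L[ℝ] ℝ} {n : F} (hn : N n = 1) (hNL : ∀ v, N (L v) = 0)
    {X : F} (hX : N X = 0) : ∃ v, L v = X := by
  have hle : LinearMap.range (L : E →ₗ[ℝ] F) ≤ LinearMap.ker (N : F →ₗ[ℝ] ℝ) := by
    rintro _ ⟨v, rfl⟩
    exact hNL v
  have h1 : Module.finrank ℝ (LinearMap.range (L : E →ₗ[ℝ] F)) = Module.finrank ℝ E :=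
    LinearMap.finrank_range_of_inj hL
  have hs : LinearMap.range (N : F →ₗ[ℝ] ℝ) = ⊤ := by
    rw [LinearMap.range_eq_top]
    intro c
    exact ⟨c • n, by simp [hn]⟩
  have h2 := LinearMap.finrank_range_add_finrank_ker (N : F →ₗ[ℝ] ℝ)
  rw [hs, finrank_top, Module.finrank_self] at h2
  have h3 := Submodule.eq_of_le_of_finrank_eq hle (by omega)
  have h4 : X ∈ LinearMap.ker (N : F →ₗ[ℝ] ℝ) := hX
  rw [← h3] at h4
  exact h4

/-- The trace on a complement of the line spanned by `n`. -/
theorem trace_eq_trace_sub [FiniteDimensional ℝ E] [FiniteDimensional ℝ F]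
    (hdim : Module.finrank ℝ F = Module.finrank ℝ E + 1) {L : E →L[ℝ] F}
    (hL : Function.Injective L) {N : F →L[ℝ] ℝ} {n : F} (hn : N n = 1) (hNL : ∀ v, N (L v) = 0)
    (A : E →ₗ[ℝ] E) (T : F →ₗ[ℝ] F) (hA : ∀ v, L (A v) = T (L v)) :
    LinearMap.trace ℝ E A = LinearMap.trace ℝ F T - N (T n) := by
  obtain ⟨P, hP⟩ := (L : E →ₗ[ℝ] F).exists_leftInverse_of_injective (LinearMap.ker_eq_bot.2 hL)
  have hP' : ∀ v, P (L v) = v := fun v ↦ congrArg (fun M ↦ M v) hP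
  let Q : F →ₗ[ℝ] E := P.comp (LinearMap.id - (N : F →ₗ[ℝ] ℝ).smulRight n)
  have hLQ : ∀ X, L (Q X) = X - N X • n := by
    intro X
    obtain ⟨v, hv⟩ := exists_apply_eq_of_finrank hdim hL hn hNL (X := X - N X • n) (by simp [hn])
    change L (P (X - N X • n)) = _
    rw [← hv, hP']
  have hT : T = (L : E →ₗ[ℝ] F) ∘ₗ (A ∘ₗ Q) + (N : F →ₗ[ℝ] ℝ).smulRight (T n) := by
    ext X
    change T X = L (A (Q X)) + N X • T n
    rw [hA, hLQ, map_sub, map_smul]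
    abel
  have hQ : Q ∘ₗ (L : E →ₗ[ℝ] F) = LinearMap.id := by
    ext v
    change P (L v - N (L v) • n) = v
    rw [hNL, zero_smul, sub_zero, hP']
  have h1 := congrArg (LinearMap.trace ℝ F) hT
  rw [map_add, LinearMap.trace_comp_comm', LinearMap.trace_smulRight, LinearMap.comp_assoc, hQ,
    LinearMap.comp_id] at h1
  rw [h1]
  simp

set_option maxHeartbeats 1000000 in
/-- The Levi-Civita connection and the Ricci tensor of a hypersurface `ψ`, with conormal field `N`,
which is totally geodesic for the metric connection `d + q` on the ambient space. -/
theorem christoffel_coordRicci_hypersurface [FiniteDimensional ℝ E] [FiniteDimensional ℝ F]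
    (hdim : Module.finrank ℝ F = Module.finrank ℝ E + 1)
    {G : E → E →L[ℝ] E →L[ℝ] ℝ} {y : E} {ψ : E → F}
    {B : F → F →L[ℝ] F →L[ℝ] ℝ} {q : F → F →L[ℝ] F →L[ℝ] F} {N : F → F →L[ℝ] ℝ} {n : F → F}
    {S : Set F}
    (hψ : ∀ᶠ p in 𝓝 y, ContDiffAt ℝ ∞ ψ p) (hB : ContDiff ℝ ∞ B) (hq : Differentiable ℝ q)
    (hN : Differentiable ℝ N) (hS : ∀ᶠ p in 𝓝 y, ψ p ∈ S)
    (hG : G =ᶠ[𝓝 y] fun p ↦ (B (ψ p)).bilinearComp (fderiv ℝ ψ p) (fderiv ℝ ψ p))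
    (hpos : ∀ v, v ≠ 0 → 0 < G y v v)
    (hBs : ∀ z V W, B z V W = B z W V) (hqs : ∀ z U V, q z U V = q z V U)
    (hNn : ∀ z ∈ S, N z (n z) = 1) (hNψ : ∀ᶠ p in 𝓝 y, ∀ v, N (ψ p) (fderiv ℝ ψ p v) = 0)
    (hNq : ∀ z ∈ S, ∀ U V, N z U = 0 → N z V = 0 → N z (q z U V) = fderiv ℝ N z U V)
    (hcompat : ∀ z ∈ S, ∀ U V W, N z U = 0 → N z V = 0 → N z W = 0 →
      fderiv ℝ B z U V W = B z (q z U V) W + B z V (q z U W)) :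
    (∀ u v, fderiv ℝ ψ y (christoffel G y u v) =
      fderiv ℝ (fderiv ℝ ψ) y u v + q (ψ y) (fderiv ℝ ψ y u) (fderiv ℝ ψ y v)) ∧
    (∀ X, N (ψ y) X = 0 → ∃ v, fderiv ℝ ψ y v = X) ∧
    ∀ (v w : E) (T : F →ₗ[ℝ] F), (∀ X, N (ψ y) X = 0 → T X =
      fderiv ℝ q (ψ y) X (fderiv ℝ ψ y v) (fderiv ℝ ψ y w)
      - fderiv ℝ q (ψ y) (fderiv ℝ ψ y v) X (fderiv ℝ ψ y w)
      + q (ψ y) X (q (ψ y) (fderiv ℝ ψ y v) (fderiv ℝ ψ y w))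
      - q (ψ y) (fderiv ℝ ψ y v) (q (ψ y) X (fderiv ℝ ψ y w))) →
      coordRicci G y v w = LinearMap.trace ℝ F T - N (ψ y) (T (n (ψ y))) := by
  have hGc : ContDiffAt ℝ ∞ G y := by
    have h1 := contDiffAt_bilinearComp (hB.contDiffAt.comp y hψ.self_of_nhds)
      (hψ.self_of_nhds.fderiv_right (m := ∞) (by simp))
    exact h1.congr_of_eventuallyEq hG
  have hinvy := isInvertible_of_pos hpos
  have hinj : ∀ᶠ p in 𝓝 y, (G p).IsInvertible ∧ Function.Injective (fderiv ℝ ψ p) := by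
    filter_upwards [eventually_isInvertible hGc.continuousAt hinvy, hG] with p hp hGp
    refine ⟨hp, (injective_iff_map_eq_zero _).2 fun v hv ↦ ?_⟩
    refine hp.injective ?_
    rw [hGp, map_zero]
    ext w
    simp [hv]
  have hΓ : ∀ᶠ p in 𝓝 y, ∀ u v, fderiv ℝ ψ p (christoffel G p u v) =
      fderiv ℝ (fderiv ℝ ψ) p u v + q (ψ p) (fderiv ℝ ψ p u) (fderiv ℝ ψ p v) := by
    filter_upwards [hψ, hS, hG.eventually_nhds, hinj, hNψ.eventually_nhds]
      with p hψp hSp hGp hip hNp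
    refine fderiv_christoffel_induced hψp hB.contDiffAt hGp hip.1 (hBs _) (hqs _)
      (fun u v w ↦ hcompat _ hSp _ _ _ (hNp.self_of_nhds u) (hNp.self_of_nhds v)
        (hNp.self_of_nhds w)) fun u v ↦ ?_
    refine exists_apply_eq_of_finrank hdim hip.2 (hNn _ hSp) hNp.self_of_nhds ?_
    rw [map_add, hNq _ hSp _ _ (hNp.self_of_nhds u) (hNp.self_of_nhds v)]
    have hψ1 : HasFDerivAt ψ (fderiv ℝ ψ p) p := (hψp.differentiableAt (by simp)).hasFDerivAt
    have hc1 : ContDiffAt ℝ ∞ (fderiv ℝ ψ) p := hψp.fderiv_right (by simp)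
    have hd1 : HasFDerivAt (fderiv ℝ ψ) (fderiv ℝ (fderiv ℝ ψ) p) p :=
      (hc1.differentiableAt (by simp)).hasFDerivAt
    have h1 := ((hN (ψ p)).hasFDerivAt.comp p hψ1).clm_apply
      (hd1.clm_apply (hasFDerivAt_const v p))
    have ee : (fun r ↦ (N ∘ ψ) r (fderiv ℝ ψ r v)) =ᶠ[𝓝 p] fun _ ↦ (0 : ℝ) := by
      filter_upwards [hNp] with r hr using hr v
    have h2 := congrArg (fun L ↦ L u)
      (h1.unique ((hasFDerivAt_const (0 : ℝ) p).congr_of_eventuallyEq ee))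
    simpa using h2
  refine ⟨hΓ.self_of_nhds, fun X hX ↦ exists_apply_eq_of_finrank hdim hinj.self_of_nhds.2
    (hNn _ hS.self_of_nhds) hNψ.self_of_nhds hX, fun v w T hT ↦ ?_⟩
  refine trace_eq_trace_sub hdim hinj.self_of_nhds.2 (hNn _ hS.self_of_nhds) hNψ.self_of_nhds _ T
    fun u ↦ ?_
  rw [hT _ (hNψ.self_of_nhds u)]
  exact fderiv_curvatureEndo ((contDiffAt_christoffel hGc hinvy).differentiableAt (by simp))
    hψ.self_of_nhds (hq _) hΓ u v w

end InducedCurvature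

section ManifoldCharts

open Filter Topology

namespace RiemannianManifold

variable (X : RiemannianManifold) {F : Type*} [NormedAddCommGroup F] [NormedSpace ℝ F]

theorem extChartAt_target_mem_nhds' (x : X.M) :
    (extChartAt X.I x).target ∈ 𝓝 (extChartAt X.I x x) :=
  extChartAt_target_mem_nhds x

theorem contDiffAt_comp_extChartAt_symm {Φ : X.M → F} (hΦ : ContMDiff X.I 𝓘(ℝ, F) ∞ Φ) (x : X.M)
    {y : X.E} (hy : y ∈ (extChartAt X.I x).target) :
    ContDiffAt ℝ ∞ (Φ ∘ (extChartAt X.I x).symm) y := by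
  rw [← contMDiffAt_iff_contDiffAt]
  have h := (contMDiffOn_extChartAt_symm (I := X.I) (n := ∞) x).contMDiffAt
    ((isOpen_extChartAt_target x).mem_nhds hy)
  exact (hΦ _).comp y h

theorem eventually_contDiffAt {Φ : X.M → F} (hΦ : ContMDiff X.I 𝓘(ℝ, F) ∞ Φ) (x : X.M) :
    ∀ᶠ y in 𝓝 (extChartAt X.I x x), ContDiffAt ℝ ∞ (Φ ∘ (extChartAt X.I x).symm) y := by
  filter_upwards [X.extChartAt_target_mem_nhds' x] with y hy
    using X.contDiffAt_comp_extChartAt_symm hΦ x hy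

theorem mfderiv_eq_fderiv_extChartAt {Φ : X.M → F} (hΦ : ContMDiff X.I 𝓘(ℝ, F) ∞ Φ) (x : X.M) :
    (mfderiv X.I 𝓘(ℝ, F) Φ x : X.E →L[ℝ] F)
      = fderiv ℝ (Φ ∘ (extChartAt X.I x).symm) (extChartAt X.I x x) := by
  rw [((hΦ x).mdifferentiableAt (by simp)).mfderiv, ModelWithCorners.range_eq_univ,
    fderivWithin_univ]
  rfl

theorem metricInChart_eventuallyEq {Φ : X.M → F} (hΦ : ContMDiff X.I 𝓘(ℝ, F) ∞ Φ)
    {B : F → F →L[ℝ] F →L[ℝ] ℝ}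
    (hX : ∀ p, X.metric.inner p = inducedForm X.I Φ B p) (x : X.M) :
    X.metricInChart x =ᶠ[𝓝 (extChartAt X.I x x)] fun y ↦
      (B ((Φ ∘ (extChartAt X.I x).symm) y)).bilinearComp
        (fderiv ℝ (Φ ∘ (extChartAt X.I x).symm) y)
        (fderiv ℝ (Φ ∘ (extChartAt X.I x).symm) y) := by
  filter_upwards [X.extChartAt_target_mem_nhds' x] with y hy
  have h := (contMDiffOn_extChartAt_symm (I := X.I) (n := ∞) x).contMDiffAt
    ((isOpen_extChartAt_target x).mem_nhds hy)
  have h1 := mfderiv_comp y ((hΦ ((extChartAt X.I x).symm y)).mdifferentiableAt (by simp))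
    (h.mdifferentiableAt (by simp))
  rw [_root_.mfderiv_eq_fderiv] at h1
  rw [h1]
  unfold metricInChart
  rw [hX]
  rfl

theorem inner_eq {Φ : X.M → F} (hΦ : ContMDiff X.I 𝓘(ℝ, F) ∞ Φ)
    {B : F → F →L[ℝ] F →L[ℝ] ℝ}
    (hX : ∀ p, X.metric.inner p = inducedForm X.I Φ B p) (x : X.M) (v w : TangentSpace X.I x) :
    X.metric.inner x v w = B (Φ x)
        (fderiv ℝ (Φ ∘ (extChartAt X.I x).symm) (extChartAt X.I x x) v)
        (fderiv ℝ (Φ ∘ (extChartAt X.I x).symm) (extChartAt X.I x x) w) := by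
  rw [hX, ← X.mfderiv_eq_fderiv_extChartAt hΦ]
  rfl

theorem metricInChart_pos {Φ : X.M → F} (hΦ : ContMDiff X.I 𝓘(ℝ, F) ∞ Φ)
    {B : F → F →L[ℝ] F →L[ℝ] ℝ}
    (hX : ∀ p, X.metric.inner p = inducedForm X.I Φ B p) (x : X.M) (v : X.E) (hv : v ≠ 0) :
    0 < X.metricInChart x (extChartAt X.I x x) v v := by
  have h1 := X.metric.pos x v hv
  have h2 := X.inner_eq hΦ hX x v v
  rw [(X.metricInChart_eventuallyEq hΦ hX x).self_of_nhds]
  simp only [Function.comp_apply, extChartAt_to_inv, ContinuousLinearMap.bilinearComp_apply]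
  exact h2 ▸ h1

end RiemannianManifold

end ManifoldCharts

section HopfConnection

open ContinuousLinearMap

variable {F : Type*} [NormedAddCommGroup F] [InnerProductSpace ℝ F]

/-- The connection form of the Berger metric with parameter `b`, for the complex structure `J`. -/
noncomputable def hopfConnection (J : F →L[ℝ] F) (b : ℝ) (z : F) : F →L[ℝ] F →L[ℝ] F :=
  ((smulRightL ℝ F F).flip z).comp (euclideanForm F)
    + b • ((euclideanForm F (J z)).smulRight J + ((euclideanForm F (J z)).smulRight J).flip)
    + (2 * b) • (euclideanForm F (J z)).smulRight ((euclideanForm F (J z)).smulRight z)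

theorem hopfConnection_apply (J : F →L[ℝ] F) (b : ℝ) (z U V : F) :
    hopfConnection J b z U V = inner ℝ U V • z
      + b • (inner ℝ (J z) U • J V + inner ℝ (J z) V • J U)
      + (2 * b) • inner ℝ (J z) U • inner ℝ (J z) V • z :=
  rfl

variable [FiniteDimensional ℝ F] (J : F →L[ℝ] F) (b : ℝ)

theorem contDiff_hopfConnection : ContDiff ℝ ∞ (hopfConnection J b) := by
  rw [contDiff_clm_apply_iff]
  intro U
  rw [contDiff_clm_apply_iff]
  intro V
  have l : ∀ U, ContDiff ℝ ∞ fun z ↦ inner ℝ (J z) U := fun U ↦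
    J.contDiff.inner ℝ contDiff_const
  simp only [hopfConnection_apply]
  exact ((contDiff_const.smul contDiff_id).add (contDiff_const.smul
    (((l U).smul contDiff_const).add ((l V).smul contDiff_const)))).add
    (contDiff_const.smul ((l U).smul ((l V).smul contDiff_id)))

theorem fderiv_hopfConnection (z X U V : F) :
    fderiv ℝ (hopfConnection J b) z X U V = inner ℝ U V • X
      + b • (inner ℝ (J X) U • J V + inner ℝ (J X) V • J U)
      + (2 * b) • (inner ℝ (J z) U * inner ℝ (J X) V + inner ℝ (J X) U * inner ℝ (J z) V) • z
      + (2 * b) • (inner ℝ (J z) U * inner ℝ (J z) V) • X := by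
  have hq := (contDiff_hopfConnection J b).differentiable (by simp) z
  have h1 := (hq.hasFDerivAt.clm_apply (hasFDerivAt_const U z)).clm_apply (hasFDerivAt_const V z)
  have l : ∀ U, HasFDerivAt (fun z ↦ inner ℝ (J z) U) ((innerSL ℝ U).comp J) z := fun U ↦
    ((innerSL ℝ U).comp J).hasFDerivAt.congr_of_eventuallyEq
      (.of_forall fun z ↦ by simp [real_inner_comm])
  have h2 := (((hasFDerivAt_id z).const_smul (inner ℝ U V)).add
    ((((l U).smul_const (J V)).add ((l V).smul_const (J U))).const_smul b)).add
    (((l U).smul ((l V).smul (hasFDerivAt_id z))).const_smul (2 * b))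
  have h3 := congrArg (fun L ↦ L X) (h1.unique h2)
  simp at h3
  rw [h3, real_inner_comm U (J X), real_inner_comm V (J X)]
  module

variable {J b}

theorem trace_eq_zero_of_skew (hJ : ∀ x y, inner ℝ (J x) y = -inner ℝ x (J y)) :
    LinearMap.trace ℝ F (J : F →ₗ[ℝ] F) = 0 := by
  rw [LinearMap.trace_eq_sum_inner _ (stdOrthonormalBasis ℝ F)]
  refine Finset.sum_eq_zero fun i _ ↦ ?_
  have h := hJ (stdOrthonormalBasis ℝ F i) (stdOrthonormalBasis ℝ F i)
  rw [real_inner_comm] at h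
  change inner ℝ _ (J _) = 0
  linarith

theorem exists_trace_hopfConnection (hF : Module.finrank ℝ F = 4)
    (hJ : ∀ x y, inner ℝ (J x) y = -inner ℝ x (J y)) (hJJ : ∀ x, J (J x) = -x) {z V W : F}
    (hz : inner ℝ z z = 1) (hV : inner ℝ z V = 0) (hW : inner ℝ z W = 0) :
    ∃ T : F →ₗ[ℝ] F, (∀ X, inner ℝ z X = 0 → T X =
      fderiv ℝ (hopfConnection J b) z X V W - fderiv ℝ (hopfConnection J b) z V X W
      + hopfConnection J b z X (hopfConnection J b z V W)
      - hopfConnection J b z V (hopfConnection J b z X W)) ∧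
      LinearMap.trace ℝ F T - inner ℝ z (T z) = (2 - 2 * b) * inner ℝ V W
        + (6 * b + 2 * b ^ 2) * (inner ℝ (J z) V * inner ℝ (J z) W) := by
  have hJI : ∀ x y, inner ℝ (J x) (J y) = inner ℝ x y := fun x y ↦ by
    rw [hJ, hJJ, inner_neg_right, neg_neg]
  have hJz : ∀ x, inner ℝ x (J x) = 0 := fun x ↦ by
    have h := hJ x x
    rw [real_inner_comm] at h
    linarith
  let ℓ : F → F →ₗ[ℝ] ℝ := fun x ↦ (innerSL ℝ x : F →L[ℝ] ℝ)
  have hℓ : ∀ x y, ℓ x y = inner ℝ x y := fun _ _ ↦ rfl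
  set Y := hopfConnection J b z V W with hY
  set v := inner ℝ (J z) V with hv
  set w := inner ℝ (J z) W with hw
  let s : F →ₗ[ℝ] ℝ := (-(4 * b) * w) • ℓ (J V) - (2 * b * v) • ℓ (J W)
    - (2 * b * inner ℝ W (J V)) • ℓ (J z) + ℓ Y - (b * inner ℝ V (J W)) • ℓ (J z)
    + (b * w) • ℓ (J V)
  let T : F →ₗ[ℝ] F := (inner ℝ V W + 2 * b * (v * w)) • LinearMap.id
    - (2 * b) • (ℓ (J V)).smulRight (J W) - b • (ℓ (J W)).smulRight (J V) - (ℓ W).smulRight V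
    - (b * inner ℝ W (J V)) • (J : F →ₗ[ℝ] F) - (2 * b * w) • (ℓ (J z)).smulRight V
    + b • (ℓ (J z)).smulRight (J Y)
    - (b * v) • ((ℓ W).smulRight (J z) - b • (ℓ (J z)).smulRight W
      - (b * w) • LinearMap.id + (2 * b * w) • (ℓ (J z)).smulRight (J z))
    + s.smulRight z
  have hθ : ∀ A B, inner ℝ z A = 0 → inner ℝ z B = 0 →
      inner ℝ (J z) (hopfConnection J b z A B) = 0 := fun A B hA hB ↦ by
    simp only [hopfConnection_apply, inner_add_right, inner_smul_right, hJI, hA, hB,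
      real_inner_comm z (J z), hJz]
    ring
  have hY0 : inner ℝ (J z) Y = 0 := hθ V W hV hW
  have hVz : inner ℝ V z = 0 := by rw [real_inner_comm, hV]
  have hzY : inner ℝ z Y = inner ℝ V W := by
    rw [hY]
    simp only [hopfConnection_apply, inner_add_right, inner_smul_right, hz]
    rw [← neg_neg (inner ℝ z (J V)), ← neg_neg (inner ℝ z (J W)), ← hJ, ← hJ, ← hv, ← hw]
    ring
  refine ⟨T, fun X hX ↦ ?_, ?_⟩
  · have hQ := hθ X W hX hW
    have hVQ : inner ℝ V (hopfConnection J b z X W)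
        = b * (inner ℝ (J z) X * inner ℝ V (J W) - w * inner ℝ (J V) X) := by
      simp only [hopfConnection_apply, inner_add_right, inner_smul_right, hVz, ← hw]
      rw [hJ V X]
      ring
    have hJQ : J (hopfConnection J b z X W) = inner ℝ X W • J z
        - (b * inner ℝ (J z) X) • W - (b * w) • X + (2 * b * w * inner ℝ (J z) X) • J z := by
      simp only [hopfConnection_apply, map_add, map_smul, hJJ, ← hw]
      module
    rw [hopfConnection_apply J b z V (hopfConnection J b z X W), hQ, hVQ, hJQ,
      hopfConnection_apply J b z X Y, hY0, fderiv_hopfConnection, fderiv_hopfConnection,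
      hJ X V, hJ X W, real_inner_comm (J V) X, real_inner_comm (J W) X, ← hv, ← hw]
    simp only [T, s, hℓ, LinearMap.add_apply, LinearMap.sub_apply, LinearMap.smul_apply,
      LinearMap.smulRight_apply, LinearMap.id_apply, ContinuousLinearMap.coe_coe, smul_eq_mul,
      real_inner_comm W X, real_inner_comm Y X, real_inner_comm W (J V)]
    module
  · simp only [T, map_add, map_sub, map_smul, LinearMap.trace_smulRight, LinearMap.trace_id, hF,
      trace_eq_zero_of_skew hJ, hℓ, LinearMap.add_apply, LinearMap.sub_apply,
      LinearMap.smul_apply, LinearMap.smulRight_apply, LinearMap.id_apply,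
      ContinuousLinearMap.coe_coe, smul_eq_mul, inner_add_right, inner_sub_right,
      inner_smul_right, hz, hV, hW, hJz, hJI, real_inner_comm V W]
    have e1 : inner ℝ W (J z) = w := real_inner_comm _ _
    have e2 : inner ℝ (J z) z = 0 := by rw [real_inner_comm, hJz]
    have e3 : ∀ A, inner ℝ (J A) z = -inner ℝ (J z) A := fun A ↦ by rw [hJ, real_inner_comm]
    have e4 : ∀ A, inner ℝ z (J A) = -inner ℝ (J z) A := fun A ↦ by rw [hJ, neg_neg]
    rw [hzY, e1, e2, e3, e3, e4, e4, ← hv, ← hw]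
    push_cast
    ring

end HopfConnection

section SecondDerivativeTest

open Filter Topology

variable {E : Type*} [NormedAddCommGroup E] [NormedSpace ℝ E]
  {F : Type*} [NormedAddCommGroup F] [NormedSpace ℝ F]

theorem deriv_line_eventuallyEq {φ : E → F} {y : E} (hφ : ContDiffAt ℝ ∞ φ y) (v : E) :
    deriv (fun s : ℝ ↦ φ (y + s • v)) =ᶠ[𝓝 0] fun s ↦ fderiv ℝ φ (y + s • v) v := by
  have hc : Tendsto (fun s : ℝ ↦ y + s • v) (𝓝 0) (𝓝 y) := by
    have : Continuous fun s : ℝ ↦ y + s • v := by fun_prop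
    simpa using this.tendsto 0
  have hd : ∀ᶠ p in 𝓝 y, DifferentiableAt ℝ φ p := by
    filter_upwards [(hφ.of_le (m := 1) (by simp)).eventually (by simp)] with p hp
      using hp.differentiableAt (by simp)
  filter_upwards [hc.eventually hd] with s hs
  have h1 : HasDerivAt (fun s : ℝ ↦ y + s • v) v s := by
    simpa using ((hasDerivAt_id s).smul_const v).const_add y
  exact (hs.hasFDerivAt.comp_hasDerivAt s h1).deriv

theorem deriv_deriv_line {φ : E → F} {y : E} (hφ : ContDiffAt ℝ ∞ φ y) (v : E) :
    deriv (deriv fun s : ℝ ↦ φ (y + s • v)) 0 = fderiv ℝ (fderiv ℝ φ) y v v := by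
  rw [(deriv_line_eventuallyEq hφ v).deriv_eq]
  have h1 : HasDerivAt (fun s : ℝ ↦ y + s • v) v 0 := by
    simpa using ((hasDerivAt_id (0 : ℝ)).smul_const v).const_add y
  have h2 : HasFDerivAt (fderiv ℝ φ) (fderiv ℝ (fderiv ℝ φ) y) (y + (0 : ℝ) • v) := by
    rw [zero_smul, add_zero]
    exact ((hφ.fderiv_right (m := ∞) (by simp)).differentiableAt (by simp)).hasFDerivAt
  have h3 : HasDerivAt (fun s : ℝ ↦ fderiv ℝ φ (y + s • v)) (fderiv ℝ (fderiv ℝ φ) y v) 0 :=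
    h2.comp_hasDerivAt (0 : ℝ) h1
  have h4 := h3.clm_apply (hasDerivAt_const (0 : ℝ) v)
  rw [h4.deriv]
  simp

theorem deriv_line {φ : E → F} {y : E} (hφ : ContDiffAt ℝ ∞ φ y) (v : E) :
    deriv (fun s : ℝ ↦ φ (y + s • v)) 0 = fderiv ℝ φ y v := by
  simpa using (deriv_line_eventuallyEq hφ v).self_of_nhds

theorem fderiv_fderiv_nonpos_of_isLocalMax {φ : E → ℝ} {y v : E} (hφ : ContDiffAt ℝ ∞ φ y)
    (h : IsLocalMax (fun s : ℝ ↦ φ (y + s • v)) 0) :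
    fderiv ℝ φ y v = 0 ∧ fderiv ℝ (fderiv ℝ φ) y v v ≤ 0 := by
  refine ⟨by rw [← deriv_line hφ, h.deriv_eq_zero], ?_⟩
  by_contra! hpos
  rw [← deriv_deriv_line hφ] at hpos
  have hc : ContinuousAt (fun s : ℝ ↦ φ (y + s • v)) 0 := by
    refine ContinuousAt.comp (g := φ) ?_ (by fun_prop)
    simpa using hφ.continuousAt
  have hmin := isLocalMin_of_deriv_deriv_pos hpos h.deriv_eq_zero hc
  have he : (fun s : ℝ ↦ φ (y + s • v)) =ᶠ[𝓝 0] fun _ ↦ φ (y + (0 : ℝ) • v) := by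
    filter_upwards [h, hmin] with s h1 h2 using le_antisymm h1 h2
  rw [he.deriv.deriv_eq] at hpos
  simp at hpos

theorem fderiv_fderiv_nonneg_of_isLocalMin {φ : E → ℝ} {y v : E} (hφ : ContDiffAt ℝ ∞ φ y)
    (h : IsLocalMin (fun s : ℝ ↦ φ (y + s • v)) 0) :
    fderiv ℝ φ y v = 0 ∧ 0 ≤ fderiv ℝ (fderiv ℝ φ) y v v := by
  have h1 := fderiv_fderiv_nonpos_of_isLocalMax hφ.neg (v := v) h.neg
  have h2 : fderiv ℝ (fun p ↦ -φ p) = fun p ↦ -fderiv ℝ φ p := funext fun p ↦ fderiv_fun_neg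
  rw [h2, fderiv_fun_neg] at h1
  simpa using h1

end SecondDerivativeTest

section BergerSphereRicci

open Filter Topology

/-- The Hopf field as a linear map. -/
noncomputable def hopfMap : EuclideanSpace ℝ (Fin 4) →L[ℝ] EuclideanSpace ℝ (Fin 4) :=
  LinearMap.toContinuousLinearMap
    { toFun := hopfField
      map_add' := fun x y ↦ by
        ext i; fin_cases i <;> simp [hopfField] <;> ring
      map_smul' := fun c x ↦ by
        ext i; fin_cases i <;> simp [hopfField] }

theorem hopfMap_apply (z : EuclideanSpace ℝ (Fin 4)) : hopfMap z = hopfField z := rfl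

theorem inner_hopfMap (x y : EuclideanSpace ℝ (Fin 4)) :
    inner ℝ (hopfMap x) y = -inner ℝ x (hopfMap y) := by
  simp [hopfMap_apply, hopfField, PiLp.inner_apply, Fin.sum_univ_four]
  ring

theorem hopfMap_hopfMap (x : EuclideanSpace ℝ (Fin 4)) : hopfMap (hopfMap x) = -x := by
  ext i
  fin_cases i <;> simp [hopfMap_apply, hopfField]

theorem fderiv_bergerForm (κ τ : ℝ) (z X V W : EuclideanSpace ℝ (Fin 4)) :
    fderiv ℝ (bergerForm κ τ) z X V W = 4 / κ * ((4 * τ ^ 2 / κ - 1) *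
      (inner ℝ (hopfMap X) V * inner ℝ (hopfMap z) W
        + inner ℝ (hopfMap z) V * inner ℝ (hopfMap X) W)) := by
  have hq := (contDiff_bergerForm κ τ).differentiable (by simp) z
  have h1 := (hq.hasFDerivAt.clm_apply (hasFDerivAt_const V z)).clm_apply (hasFDerivAt_const W z)
  have l : ∀ U, HasFDerivAt (fun z ↦ inner ℝ (hopfMap z) U) ((innerSL ℝ U).comp hopfMap) z :=
    fun U ↦ ((innerSL ℝ U).comp hopfMap).hasFDerivAt.congr_of_eventuallyEq
      (.of_forall fun z ↦ by simp [real_inner_comm])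
  have h2 := ((((l V).mul (l W)).const_mul (4 * τ ^ 2 / κ - 1)).const_add
    (inner ℝ V W)).const_mul (4 / κ)
  have h3 := congrArg (fun L ↦ L X) (h1.unique h2)
  simp at h3
  rw [h3, real_inner_comm V (hopfMap X), real_inner_comm W (hopfMap X)]
  ring

theorem finrank_euclidean_four :
    Module.finrank ℝ (EuclideanSpace ℝ (Fin 4)) = Module.finrank ℝ (EuclideanSpace ℝ (Fin 3)) + 1 :=
  by simp

theorem bergerSphere_chart (κ τ : ℝ) (hκ : 0 < κ) (hτ : τ ≠ 0) (x : (bergerSphere κ τ hκ hτ).M) :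
    ∃ (x' : EuclideanSpace ℝ (Fin 4))
      (L : (bergerSphere κ τ hκ hτ).E →L[ℝ] EuclideanSpace ℝ (Fin 4)), inner ℝ x' x' = 1 ∧
      (∀ v, inner ℝ x' (L v) = 0) ∧ (∀ X, inner ℝ x' X = 0 → ∃ v, L v = X) ∧
      (∀ v w : (bergerSphere κ τ hκ hτ).E,
        (bergerSphere κ τ hκ hτ).metric.inner x v w = bergerForm κ τ x' (L v) (L w)) ∧
      ∀ v w : (bergerSphere κ τ hκ hτ).E, (bergerSphere κ τ hκ hτ).ricci x v w =
        (2 - 2 * (4 * τ ^ 2 / κ - 1)) * inner ℝ (L v) (L w)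
        + (6 * (4 * τ ^ 2 / κ - 1) + 2 * (4 * τ ^ 2 / κ - 1) ^ 2)
          * (inner ℝ (hopfMap x') (L v) * inner ℝ (hopfMap x') (L w)) := by
  let X := bergerSphere κ τ hκ hτ
  let Φ : X.M → EuclideanSpace ℝ (Fin 4) :=
    ((↑) : Metric.sphere (0 : EuclideanSpace ℝ (Fin 4)) 1 → EuclideanSpace ℝ (Fin 4))
  have hΦ : ContMDiff X.I 𝓘(ℝ, EuclideanSpace ℝ (Fin 4)) ∞ Φ := contMDiff_coe_sphere
  have hXm : ∀ p, X.metric.inner p = inducedForm X.I Φ (bergerForm κ τ) p := fun _ ↦ rfl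
  have hS : ∀ p, inner ℝ (Φ p) (Φ p) = 1 := fun p ↦ by
    have h : ‖Φ p‖ = 1 := norm_eq_of_mem_sphere (r := 1) p
    rw [real_inner_self_eq_norm_sq, h, one_pow]
  have hψ := X.eventually_contDiffAt hΦ x
  set b := 4 * τ ^ 2 / κ - 1 with hb
  have hNψ : ∀ᶠ p in 𝓝 (extChartAt X.I x x), ∀ v, innerSL ℝ ((Φ ∘ (extChartAt X.I x).symm) p)
      (fderiv ℝ (Φ ∘ (extChartAt X.I x).symm) p v) = 0 := by
    filter_upwards [hψ] with p hp v
    have h1 := (hp.differentiableAt (by simp)).hasFDerivAt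
    have h2 := congrArg (fun L ↦ L v) ((h1.inner ℝ h1).unique
      ((hasFDerivAt_const (1 : ℝ) p).congr_of_eventuallyEq (.of_forall fun r ↦ hS _)))
    simp [real_inner_comm] at h2
    simpa [real_inner_comm] using h2
  obtain ⟨-, hr, hric⟩ := christoffel_coordRicci_hypersurface
    (F := EuclideanSpace ℝ (Fin 4)) (G := X.metricInChart x)
    (N := fun z ↦ innerSL ℝ z) (n := fun z ↦ z) (S := {z | inner ℝ z z = 1})
    (q := hopfConnection hopfMap b)
    finrank_euclidean_four hψ (contDiff_bergerForm κ τ)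
    ((contDiff_hopfConnection hopfMap b).differentiable (by simp)) (innerSL ℝ).differentiable
    (.of_forall fun p ↦ hS _) (X.metricInChart_eventuallyEq hΦ hXm x) (X.metricInChart_pos hΦ hXm x)
    (fun z V W ↦ by
      rw [bergerForm_apply, bergerForm_apply, real_inner_comm, mul_comm (inner ℝ _ V)])
    (fun z U V ↦ by
      rw [hopfConnection_apply, hopfConnection_apply, real_inner_comm]
      module)
    (fun z hz ↦ hz) hNψ
    (fun z hz U V hU hV ↦ by
      have h1 : ∀ A, inner ℝ z (hopfMap A) = -inner ℝ (hopfMap z) A := fun A ↦ by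
        rw [inner_hopfMap, neg_neg]
      have hz' : inner ℝ z z = 1 := hz
      rw [(innerSL ℝ).fderiv, innerSL_apply_apply, innerSL_apply_apply, hopfConnection_apply]
      simp only [inner_add_right, inner_smul_right, h1, hz']
      ring)
    (fun z hz U V W hU hV hW ↦ by
      have hU : inner ℝ z U = 0 := hU
      have hV : inner ℝ z V = 0 := hV
      have hW : inner ℝ z W = 0 := hW
      have h0 : ∀ A, inner ℝ (hopfMap z) (hopfMap A) = inner ℝ z A := fun A ↦ by
        rw [inner_hopfMap, hopfMap_hopfMap, inner_neg_right, neg_neg]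
      have h1 : inner ℝ (hopfMap z) z = 0 := by
        have h := inner_hopfMap z z
        rw [real_inner_comm] at h ⊢
        linarith
      rw [fderiv_bergerForm, bergerForm_apply, bergerForm_apply, hopfConnection_apply,
        hopfConnection_apply]
      simp only [← hopfMap_apply, inner_add_right, inner_smul_right, inner_add_left,
        real_inner_smul_left, h0, h1, hU, hV, hW, real_inner_comm z V]
      rw [← hb, inner_hopfMap V W, real_inner_comm V (hopfMap U)]
      ring)
  have hx : (Φ ∘ (extChartAt X.I x).symm) (extChartAt X.I x x) = Φ x := by
    simp
  rw [hx] at hr hric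
  have hNx : ∀ v, inner ℝ (Φ x)
      (fderiv ℝ (Φ ∘ (extChartAt X.I x).symm) (extChartAt X.I x x) v) = 0 := fun v ↦ by
    have h := hNψ.self_of_nhds v
    rwa [hx, innerSL_apply_apply] at h
  simp only [innerSL_apply_apply] at hr hric
  refine ⟨Φ x, fderiv ℝ (Φ ∘ (extChartAt X.I x).symm) (extChartAt X.I x x), hS x, hNx,
    hr, fun v w ↦ X.inner_eq hΦ hXm x v w, fun v w ↦ ?_⟩
  · obtain ⟨T, hT, hT'⟩ := exists_trace_hopfConnection (J := hopfMap) (b := b) (by simp)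
      inner_hopfMap hopfMap_hopfMap (hS x) (hNx v) (hNx w)
    exact (hric v w T hT).trans hT'

end BergerSphereRicci

section BergerSphereRigidity

open Filter Topology

namespace RiemannianManifold

variable {X : RiemannianManifold} {m lam : ℝ} {f : X.M → ℝ}

theorem IsGradientQuasiEinstein.equation_in_chart (hf : X.IsGradientQuasiEinstein m lam f)
    (x : X.M) (v w : X.E) :
    X.ricci x v w
      + (fderiv ℝ (fderiv ℝ (f ∘ (extChartAt X.I x).symm)) (extChartAt X.I x x) v w
        - fderiv ℝ (f ∘ (extChartAt X.I x).symm) (extChartAt X.I x x)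
          (christoffel (X.metricInChart x) (extChartAt X.I x x) v w))
      - 1 / m * (fderiv ℝ (f ∘ (extChartAt X.I x).symm) (extChartAt X.I x x) v
        * fderiv ℝ (f ∘ (extChartAt X.I x).symm) (extChartAt X.I x x) w)
      = lam * X.metric.inner x v w := by
  have h : X.ricci x v w + X.hessian f x v w - 1 / m * (X.differential f x v
      * X.differential f x w) = lam * X.metric.inner x v w := hf.2 x v w
  have e : (X.differential f x : X.E →L[ℝ] ℝ)
      = fderiv ℝ (f ∘ (extChartAt X.I x).symm) (extChartAt X.I x x) :=
    X.mfderiv_eq_fderiv_extChartAt hf.1 x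
  exact (congrArg₂ (fun a b : ℝ ↦ X.ricci x v w + X.hessian f x v w - 1 / m * (a * b))
    (DFunLike.congr_fun e v) (DFunLike.congr_fun e w)).symm.trans h

theorem IsGradientQuasiEinstein.le_ricci (hf : X.IsGradientQuasiEinstein m lam f) {x : X.M}
    (hx : ∀ p, f p ≤ f x) (v : X.E) :
    lam * X.metric.inner x v v ≤ X.ricci x v v := by
  have hc := (X.eventually_contDiffAt hf.1 x).self_of_nhds
  have h (v : X.E) := fderiv_fderiv_nonpos_of_isLocalMax hc (v := v)
    (.of_forall fun s ↦ by simpa using hx _)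
  have h1 := hf.equation_in_chart x v v
  rw [(h _).1, (h v).1] at h1
  have h2 := (h v).2
  linarith

theorem IsGradientQuasiEinstein.ricci_le (hf : X.IsGradientQuasiEinstein m lam f) {x : X.M}
    (hx : ∀ p, f x ≤ f p) (v : X.E) :
    X.ricci x v v ≤ lam * X.metric.inner x v v := by
  have hc := (X.eventually_contDiffAt hf.1 x).self_of_nhds
  have h (v : X.E) := fderiv_fderiv_nonneg_of_isLocalMin hc (v := v)
    (.of_forall fun s ↦ by simpa using hx _)
  have h1 := hf.equation_in_chart x v v
  rw [(h _).1, (h v).1] at h1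
  have h2 := (h v).2
  linarith

end RiemannianManifold

theorem isEinstein_bergerSphere {κ τ : ℝ} (hκ : 0 < κ) (hτ : τ ≠ 0) (h : κ = 4 * τ ^ 2) :
    (bergerSphere κ τ hκ hτ).IsEinstein := by
  refine ⟨κ / 2, fun x v w ↦ ?_⟩
  obtain ⟨z, L, -, -, -, hg, hric⟩ := bergerSphere_chart κ τ hκ hτ x
  refine (hric v w).trans (Eq.trans ?_ (congrArg (κ / 2 * ·) (hg v w).symm))
  rw [bergerForm_apply, ← h, div_self hκ.ne']
  field_simp
  ring

theorem bergerSphere_quasiEinstein {κ τ : ℝ} (hκ : 0 < κ) (hτ : τ ≠ 0) {m lam : ℝ}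
    {f : (bergerSphere κ τ hκ hτ).M → ℝ}
    (hf : (bergerSphere κ τ hκ hτ).IsGradientQuasiEinstein m lam f) : κ = 4 * τ ^ 2 := by
  have hcont : Continuous f := hf.1.continuous
  have : CompactSpace (bergerSphere κ τ hκ hτ).M :=
    inferInstanceAs (CompactSpace (Metric.sphere (0 : EuclideanSpace ℝ (Fin 4)) 1))
  have : Nonempty (bergerSphere κ τ hκ hτ).M :=
    (NormedSpace.sphere_nonempty (x := (0 : EuclideanSpace ℝ (Fin 4))).2 zero_le_one).to_subtype
  obtain ⟨x, -, hx⟩ := isCompact_univ.exists_isMaxOn Set.univ_nonempty hcont.continuousOn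
  obtain ⟨y, -, hy⟩ := isCompact_univ.exists_isMinOn Set.univ_nonempty hcont.continuousOn
  have hmax := hf.le_ricci fun p ↦ hx (Set.mem_univ p)
  have hmin := hf.ricci_le fun p ↦ hy (Set.mem_univ p)
  set b := 4 * τ ^ 2 / κ - 1 with hb
  have key : ∀ x, ∃ v w : (bergerSphere κ τ hκ hτ).E,
      (bergerSphere κ τ hκ hτ).metric.inner x v v = 4 / κ * (1 + b) ∧
      (bergerSphere κ τ hκ hτ).ricci x v v = 2 * (1 + b) ^ 2 ∧
      (bergerSphere κ τ hκ hτ).metric.inner x w w = 4 / κ ∧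
      (bergerSphere κ τ hκ hτ).ricci x w w = 2 - 2 * b := by
    intro x
    obtain ⟨z, L, hz, -, hr, hg, hric⟩ := bergerSphere_chart κ τ hκ hτ x
    have hz' : z 0 ^ 2 + z 1 ^ 2 + z 2 ^ 2 + z 3 ^ 2 = 1 := by
      rw [← hz, real_inner_self_eq_norm_sq, EuclideanSpace.norm_sq_eq]
      simp [Fin.sum_univ_four]
    obtain ⟨v, hv⟩ := hr (hopfMap z) (by
      simp [hopfMap_apply, hopfField, PiLp.inner_apply, Fin.sum_univ_four]
      ring)
    obtain ⟨w, hw⟩ := hr !₂[-z 2, z 3, z 0, -z 1] (by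
      simp [PiLp.inner_apply, Fin.sum_univ_four]
      ring)
    have e1 : inner ℝ (hopfMap z) (hopfMap z) = 1 := by
      rw [inner_hopfMap, hopfMap_hopfMap, inner_neg_right, neg_neg, hz]
    have e2 : inner ℝ (hopfMap z) !₂[-z 2, z 3, z 0, -z 1] = 0 := by
      simp [hopfMap_apply, hopfField, PiLp.inner_apply, Fin.sum_univ_four]
      ring
    have e3 : inner ℝ !₂[-z 2, z 3, z 0, -z 1] !₂[-z 2, z 3, z 0, -z 1] = (1 : ℝ) := by
      rw [← hz', real_inner_self_eq_norm_sq, EuclideanSpace.norm_sq_eq]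
      simp [Fin.sum_univ_four]
      ring
    refine ⟨v, w, ?_, ?_, ?_, ?_⟩
    · rw [hg, hv, bergerForm_apply, ← hopfMap_apply, e1, ← hb]
      ring
    · rw [hric, hv, e1, ← hb]
      ring
    · rw [hg, hw, bergerForm_apply, ← hopfMap_apply, e2, e3]
      ring
    · rw [hric, hw, e2, e3, ← hb]
      ring
  obtain ⟨v, w, h1, h2, h3, h4⟩ := key x
  obtain ⟨v', w', h1', h2', h3', h4'⟩ := key y
  have i1 := hmax v
  have i2 := hmax w
  have j1 := hmin v'
  have j2 := hmin w'
  rw [h1, h2] at i1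
  rw [h3, h4] at i2
  rw [h1', h2'] at j1
  rw [h3', h4'] at j2
  have hb1 : 0 < 1 + b := by
    rw [hb]
    have : 0 < 4 * τ ^ 2 / κ := by positivity
    linarith
  have k1 : lam * (4 / κ) = 2 - 2 * b := le_antisymm i2 j2
  have k2 : (lam * (4 / κ)) * (1 + b) = (2 * (1 + b)) * (1 + b) := by linarith
  have k3 := mul_right_cancel₀ hb1.ne' k2
  have hb0 : b = 0 := by linarith
  rw [hb0] at hb
  field_simp at hb
  linarith

end BergerSphereRigidity

section SphereTimesLineRigidity

open Filter Topology ContinuousLinearMap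

theorem finrank_sphereTimesLine : Module.finrank ℝ (EuclideanSpace ℝ (Fin 3) × ℝ)
    = Module.finrank ℝ (EuclideanSpace ℝ (Fin 2) × ℝ) + 1 := by
  simp

/-- The inner product of the first components. -/
noncomputable def innerFst : (EuclideanSpace ℝ (Fin 3) × ℝ) →L[ℝ]
    (EuclideanSpace ℝ (Fin 3) × ℝ) →L[ℝ] ℝ :=
  ContinuousLinearMap.bilinearComp (euclideanForm (EuclideanSpace ℝ (Fin 3)))
    (ContinuousLinearMap.fst ℝ (EuclideanSpace ℝ (Fin 3)) ℝ)
    (ContinuousLinearMap.fst ℝ (EuclideanSpace ℝ (Fin 3)) ℝ)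

theorem innerFst_apply (v w : EuclideanSpace ℝ (Fin 3) × ℝ) :
    innerFst v w = inner ℝ v.1 w.1 :=
  rfl

/-- The connection form on `ℝ³ × ℝ` for which the cylinder over the sphere is totally geodesic. -/
noncomputable def cylinderConnection : (EuclideanSpace ℝ (Fin 3) × ℝ) →L[ℝ]
    (EuclideanSpace ℝ (Fin 3) × ℝ) →L[ℝ] (EuclideanSpace ℝ (Fin 3) × ℝ) →L[ℝ]
    (EuclideanSpace ℝ (Fin 3) × ℝ) :=
  ((compL ℝ (EuclideanSpace ℝ (Fin 3) × ℝ) ((EuclideanSpace ℝ (Fin 3) × ℝ) →L[ℝ] ℝ)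
      ((EuclideanSpace ℝ (Fin 3) × ℝ) →L[ℝ] (EuclideanSpace ℝ (Fin 3) × ℝ))).flip innerFst).comp
    ((smulRightL ℝ (EuclideanSpace ℝ (Fin 3) × ℝ) (EuclideanSpace ℝ (Fin 3) × ℝ)).flip.comp
      ((ContinuousLinearMap.inl ℝ (EuclideanSpace ℝ (Fin 3)) ℝ).comp
        (ContinuousLinearMap.fst ℝ (EuclideanSpace ℝ (Fin 3)) ℝ)))

theorem cylinderConnection_apply (z U V : EuclideanSpace ℝ (Fin 3) × ℝ) :
    cylinderConnection z U V = (inner ℝ U.1 V.1 : ℝ) • (z.1, (0 : ℝ)) :=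
  rfl

theorem exists_trace_cylinderConnection {z V W : EuclideanSpace ℝ (Fin 3) × ℝ}
    (hz : inner ℝ z.1 z.1 = (1 : ℝ)) (hV : inner ℝ z.1 V.1 = (0 : ℝ)) :
    ∃ T : (EuclideanSpace ℝ (Fin 3) × ℝ) →ₗ[ℝ] (EuclideanSpace ℝ (Fin 3) × ℝ),
      (∀ X, innerFst z X = 0 → T X =
      fderiv ℝ cylinderConnection z X V W - fderiv ℝ cylinderConnection z V X W
      + cylinderConnection z X (cylinderConnection z V W)
      - cylinderConnection z V (cylinderConnection z X W)) ∧
      LinearMap.trace ℝ _ T - innerFst z (T (z.1, 0)) = inner ℝ V.1 W.1 := by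
  let P : (EuclideanSpace ℝ (Fin 3) × ℝ) →ₗ[ℝ] (EuclideanSpace ℝ (Fin 3) × ℝ) :=
    LinearMap.prodMap LinearMap.id 0
  have hP : ∀ X, P X = (X.1, 0) := fun X ↦ rfl
  refine ⟨(inner ℝ V.1 W.1 : ℝ) • P - (innerFst W : _ →ₗ[ℝ] ℝ).smulRight (V.1, (0 : ℝ)),
    fun X hX ↦ ?_, ?_⟩
  · have hX' : inner ℝ z.1 X.1 = (0 : ℝ) := hX
    simp only [ContinuousLinearMap.fderiv, cylinderConnection_apply, Prod.smul_fst,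
      real_inner_smul_right, LinearMap.sub_apply, LinearMap.smul_apply, hP,
      LinearMap.smulRight_apply, ContinuousLinearMap.coe_coe, innerFst_apply,
      real_inner_comm z.1 X.1, real_inner_comm z.1 V.1, hX', hV, real_inner_comm X.1 W.1]
    simp
  · rw [map_sub, map_smul, LinearMap.trace_smulRight, LinearMap.trace_prodMap']
    simp only [LinearMap.trace_id, innerFst_apply, LinearMap.sub_apply, LinearMap.smul_apply, hP,
      LinearMap.smulRight_apply, ContinuousLinearMap.coe_coe, Prod.fst_sub, Prod.smul_fst,
      inner_sub_right, real_inner_smul_right, hz, hV, real_inner_comm V.1 W.1]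
    simp
    ring

theorem sphereLine_extChartAt_symm_snd (x : Metric.sphere (0 : EuclideanSpace ℝ (Fin 3)) 1 × ℝ)
    (y : EuclideanSpace ℝ (Fin 2) × ℝ) :
    ((extChartAt ((𝓡 2).prod 𝓘(ℝ, ℝ)) x).symm y).2 = y.2 := by
  rw [extChartAt_prod]
  simp only [PartialEquiv.prod_symm, PartialEquiv.prod_coe, extChartAt_model_space_eq_id,
    PartialEquiv.refl_symm, PartialEquiv.refl_coe, id]

theorem sphereLine_extChartAt_snd (x : Metric.sphere (0 : EuclideanSpace ℝ (Fin 3)) 1 × ℝ) :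
    (extChartAt ((𝓡 2).prod 𝓘(ℝ, ℝ)) x x).2 = x.2 := by
  rw [extChartAt_prod]
  simp only [PartialEquiv.prod_coe, extChartAt_model_space_eq_id, PartialEquiv.refl_coe, id]

theorem sphereLine_extChartAt_symm_fst (x : Metric.sphere (0 : EuclideanSpace ℝ (Fin 3)) 1 × ℝ)
    (y : EuclideanSpace ℝ (Fin 2) × ℝ) (h : y.1 = (extChartAt ((𝓡 2).prod 𝓘(ℝ, ℝ)) x x).1) :
    ((extChartAt ((𝓡 2).prod 𝓘(ℝ, ℝ)) x).symm y).1 = x.1 := by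
  rw [extChartAt_prod] at h ⊢
  exact (congrArg (extChartAt (𝓡 2) x.1).symm h).trans (extChartAt_to_inv x.1)

set_option maxHeartbeats 1000000 in
theorem sphereTimesLine_chart (κ : ℝ) (hκ : 0 < κ)
    (x : Metric.sphere (0 : EuclideanSpace ℝ (Fin 3)) 1 × ℝ) :
    ∃ (L : (EuclideanSpace ℝ (Fin 2) × ℝ) →L[ℝ] EuclideanSpace ℝ (Fin 3) × ℝ)
      (Γ : EuclideanSpace ℝ (Fin 2) × ℝ → EuclideanSpace ℝ (Fin 2) × ℝ →
        EuclideanSpace ℝ (Fin 2) × ℝ),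
      (∀ v, (L v).2 = v.2) ∧ L (0, 1) = (0, 1) ∧ (∀ v, L v = 0 → v = 0) ∧
      (∀ v, v.2 = 0 → (Γ v v).2 = 0) ∧ Γ (0, 1) (0, 1) = 0 ∧
      ∀ (m lam : ℝ) (f : Metric.sphere (0 : EuclideanSpace ℝ (Fin 3)) 1 × ℝ → ℝ),
        (sphereTimesLine κ hκ).IsGradientQuasiEinstein m lam f →
        ContDiffAt ℝ ∞ (f ∘ (extChartAt ((𝓡 2).prod 𝓘(ℝ, ℝ)) x).symm)
          (extChartAt ((𝓡 2).prod 𝓘(ℝ, ℝ)) x x) ∧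
        ∀ v w : EuclideanSpace ℝ (Fin 2) × ℝ,
        inner ℝ (L v).1 (L w).1
        + (fderiv ℝ (fderiv ℝ (f ∘ (extChartAt ((𝓡 2).prod 𝓘(ℝ, ℝ)) x).symm))
            (extChartAt ((𝓡 2).prod 𝓘(ℝ, ℝ)) x x) v w
          - fderiv ℝ (f ∘ (extChartAt ((𝓡 2).prod 𝓘(ℝ, ℝ)) x).symm)
            (extChartAt ((𝓡 2).prod 𝓘(ℝ, ℝ)) x x) (Γ v w))
        - 1 / m * (fderiv ℝ (f ∘ (extChartAt ((𝓡 2).prod 𝓘(ℝ, ℝ)) x).symm)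
            (extChartAt ((𝓡 2).prod 𝓘(ℝ, ℝ)) x x) v
          * fderiv ℝ (f ∘ (extChartAt ((𝓡 2).prod 𝓘(ℝ, ℝ)) x).symm)
            (extChartAt ((𝓡 2).prod 𝓘(ℝ, ℝ)) x x) w)
        = lam * productForm κ (L v) (L w) := by
  let X := sphereTimesLine κ hκ
  let Φ : X.M → EuclideanSpace ℝ (Fin 3) × ℝ := sphereLineIncl
  have hΦ : ContMDiff X.I 𝓘(ℝ, EuclideanSpace ℝ (Fin 3) × ℝ) ∞ Φ := contMDiff_sphereLineIncl
  have hXm : ∀ p, X.metric.inner p = inducedForm X.I Φ (fun _ ↦ productForm κ) p := fun _ ↦ rfl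
  have hS : ∀ p, inner ℝ (Φ p).1 (Φ p).1 = (1 : ℝ) := fun p ↦ by
    have h : ‖(Φ p).1‖ = 1 :=
      norm_eq_of_mem_sphere (r := 1)
        (show Metric.sphere (0 : EuclideanSpace ℝ (Fin 3)) 1 × ℝ from p).1
    rw [real_inner_self_eq_norm_sq, h, one_pow]
  let ψ : EuclideanSpace ℝ (Fin 2) × ℝ → EuclideanSpace ℝ (Fin 3) × ℝ :=
    sphereLineIncl ∘ (extChartAt ((𝓡 2).prod 𝓘(ℝ, ℝ)) (M := Metric.sphere _ _ × ℝ) x).symm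
  let c : EuclideanSpace ℝ (Fin 2) × ℝ :=
    extChartAt ((𝓡 2).prod 𝓘(ℝ, ℝ)) (M := Metric.sphere _ _ × ℝ) x x
  have hψ : ∀ᶠ p in 𝓝 c, ContDiffAt ℝ ∞ ψ p := X.eventually_contDiffAt hΦ x
  have hSψ : ∀ r, inner ℝ (ψ r).1 (ψ r).1 = (1 : ℝ) := fun r ↦
    hS ((extChartAt ((𝓡 2).prod 𝓘(ℝ, ℝ)) x).symm r)
  let G : EuclideanSpace ℝ (Fin 2) × ℝ →
      (EuclideanSpace ℝ (Fin 2) × ℝ) →L[ℝ] (EuclideanSpace ℝ (Fin 2) × ℝ) →L[ℝ] ℝ :=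
    X.metricInChart x
  have hG : G =ᶠ[𝓝 c] fun p ↦ (productForm κ).bilinearComp (fderiv ℝ ψ p) (fderiv ℝ ψ p) :=
    X.metricInChart_eventuallyEq hΦ hXm x
  have hGpos : ∀ v, v ≠ 0 → 0 < G c v v := X.metricInChart_pos hΦ hXm x
  have hc0 := hψ.self_of_nhds
  have hNψ : ∀ᶠ p in 𝓝 c, ∀ v, innerFst (ψ p) (fderiv ℝ ψ p v) = 0 := by
    filter_upwards [hψ] with p hp v
    have h1 := (hp.differentiableAt (by simp)).hasFDerivAt.fst
    have h2 := congrArg (fun L ↦ L v) ((h1.inner ℝ h1).unique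
      ((hasFDerivAt_const (1 : ℝ) p).congr_of_eventuallyEq (.of_forall hSψ)))
    simp [real_inner_comm] at h2
    simpa [real_inner_comm, innerFst_apply] using h2
  obtain ⟨hΓ, -, hric⟩ := christoffel_coordRicci_hypersurface
    (B := fun _ ↦ productForm κ)
    (N := fun z ↦ innerFst z) (n := fun z ↦ (z.1, 0)) (S := {z | inner ℝ z.1 z.1 = (1 : ℝ)})
    (q := fun z ↦ cylinderConnection z)
    finrank_sphereTimesLine hψ contDiff_const
    cylinderConnection.differentiable innerFst.differentiable
    (.of_forall hSψ) hG hGpos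
    (fun z V W ↦ by
      rw [productForm_apply, productForm_apply, real_inner_comm, mul_comm V.2])
    (fun z U V ↦ by
      rw [cylinderConnection_apply, cylinderConnection_apply, real_inner_comm])
    (fun z hz ↦ hz) hNψ
    (fun z hz U V hU hV ↦ by
      have hz' : inner ℝ z.1 z.1 = (1 : ℝ) := hz
      rw [ContinuousLinearMap.fderiv, cylinderConnection_apply, map_smul, innerFst_apply,
        innerFst_apply, hz']
      simp)
    (fun z hz U V W hU hV hW ↦ by
      have hV : inner ℝ z.1 V.1 = (0 : ℝ) := hV
      have hW : inner ℝ z.1 W.1 = (0 : ℝ) := hW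
      simp [productForm_apply, cylinderConnection_apply, real_inner_smul_left,
        real_inner_smul_right, hW, real_inner_comm z.1 V.1, hV])
  have hinj : ∀ v, fderiv ℝ ψ c v = 0 → v = 0 := fun v hv ↦ by
    by_contra h
    have h1 := hGpos v h
    rw [hG.self_of_nhds] at h1
    simp [hv] at h1
  have hd1 : ∀ v, HasFDerivAt (fun p ↦ fderiv ℝ ψ p v) _ c := fun v ↦
    (((hc0.fderiv_right (m := ∞) (by simp)).differentiableAt (by simp)).hasFDerivAt).clm_apply
      (hasFDerivAt_const v c)
  have hsnd' : ∀ᶠ p in 𝓝 c, ∀ v, (fderiv ℝ ψ p v).2 = v.2 := by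
    filter_upwards [hψ] with p hp v
    have h1 := (hp.differentiableAt (by simp)).hasFDerivAt.snd
    have h2 : HasFDerivAt (fun y : EuclideanSpace ℝ (Fin 2) × ℝ ↦ y.2)
        (ContinuousLinearMap.snd ℝ _ _) p := hasFDerivAt_snd
    have e : (fun y ↦ (ψ y).2) = fun y ↦ y.2 :=
      funext fun y ↦ sphereLine_extChartAt_symm_snd x y
    rw [e] at h1
    exact congrArg (fun L ↦ L v) (h1.unique h2)
  have hsnd2 : ∀ u v, (fderiv ℝ (fderiv ℝ ψ) c u v).2 = 0 := fun u v ↦ by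
    have h1 := (hd1 v).snd
    have h2 := congrArg (fun L ↦ L u) (h1.unique
      ((hasFDerivAt_const (𝕜 := ℝ) v.2 c).congr_of_eventuallyEq
      (by filter_upwards [hsnd'] with p hp using hp v)))
    simpa using h2
  have hline : (fun s : ℝ ↦ ψ (c + s • ((0, 1) : EuclideanSpace ℝ (Fin 2) × ℝ)))
      = fun s ↦ ψ c + s • (0, 1) := by
    funext s
    refine Prod.ext ?_ ?_
    · have e1 : ∀ y : EuclideanSpace ℝ (Fin 2) × ℝ, y.1 = c.1 → (ψ y).1 = (Φ x).1 := fun y hy ↦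
        congrArg Subtype.val (sphereLine_extChartAt_symm_fst x y hy)
      rw [e1 _ (by simp)]
      simp [e1 c rfl]
    · have e2 : ∀ y : EuclideanSpace ℝ (Fin 2) × ℝ, (ψ y).2 = y.2 :=
        sphereLine_extChartAt_symm_snd x
      simp [e2]
  have hder : ∀ s, deriv (fun s : ℝ ↦ ψ c + s • ((0, 1) : EuclideanSpace ℝ (Fin 3) × ℝ)) s
      = (0, 1) := fun s ↦ by
    have h : HasDerivAt (fun s : ℝ ↦ ψ c + s • ((0, 1) : EuclideanSpace ℝ (Fin 3) × ℝ))
        ((1 : ℝ) • (0, 1)) s := ((hasDerivAt_id s).smul_const _).const_add _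
    rw [h.deriv, one_smul]
  have hL1 : fderiv ℝ ψ c (0, 1) = (0, 1) := by
    rw [← deriv_line hc0, hline, hder]
  have hL2 : fderiv ℝ (fderiv ℝ ψ) c (0, 1) (0, 1) = 0 := by
    rw [← deriv_deriv_line hc0, hline, funext hder, deriv_const]
  have hNc : ∀ v, inner ℝ (ψ c).1 (fderiv ℝ ψ c v).1 = (0 : ℝ) := hNψ.self_of_nhds
  have hsndc : ∀ v, (fderiv ℝ ψ c v).2 = v.2 := hsnd'.self_of_nhds
  refine ⟨fderiv ℝ ψ c, fun v w ↦ christoffel G c v w, hsndc, hL1, hinj, fun v hv ↦ ?_, ?_,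
    fun m lam f hf ↦ ⟨(X.eventually_contDiffAt hf.1 x).self_of_nhds, fun v w ↦ ?_⟩⟩
  · have h := congrArg Prod.snd (hΓ v v)
    rw [hsndc, Prod.snd_add, hsnd2, cylinderConnection_apply] at h
    simpa using h
  · refine hinj _ ((hΓ _ _).trans ?_)
    rw [hL1, hL2, cylinderConnection_apply]
    simp
  · obtain ⟨T, hT, hT'⟩ := exists_trace_cylinderConnection (z := ψ c) (W := fderiv ℝ ψ c w)
      (hSψ c) (hNc v)
    have e1 : coordRicci G c v w = inner ℝ (fderiv ℝ ψ c v).1 (fderiv ℝ ψ c w).1 :=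
      (hric v w T hT).trans hT'
    have e2 : X.metric.inner x v w = productForm κ (fderiv ℝ ψ c v) (fderiv ℝ ψ c w) :=
      X.inner_eq hΦ hXm x v w
    rw [← e1, ← e2]
    exact hf.equation_in_chart x v w

theorem not_forall_riccati {κ m : ℝ} (hκ : 0 < κ) (hm : 0 < m) {g : ℝ → ℝ}
    (hg : ∀ t, HasDerivAt g (κ + g t ^ 2 / m) t) : False := by
  set a := √(κ * m) with ha
  have ha0 : 0 < a := Real.sqrt_pos.2 (by positivity)
  have ha2 : a ^ 2 = κ * m := Real.sq_sqrt (by positivity)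
  have h1 : ∀ t, HasDerivAt (fun t ↦ Real.arctan (g t / a) - a / m * t) 0 t := fun t ↦ by
    have h := ((hg t).div_const a).arctan.sub ((hasDerivAt_id t).const_mul (a / m))
    refine h.congr_deriv ?_
    have : a ^ 2 + g t ^ 2 ≠ 0 := by positivity
    have e : κ = a ^ 2 / m := by rw [ha2]; field_simp
    rw [e]
    field_simp
    ring
  have h2 := is_const_of_deriv_eq_zero (fun t ↦ (h1 t).differentiableAt) fun t ↦ (h1 t).deriv
  have h3 := h2 (m / a * Real.pi) 0
  have e : a / m * (m / a * Real.pi) = Real.pi := by field_simp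
  simp only [e, mul_zero, sub_zero] at h3
  have := Real.arctan_lt_pi_div_two (g (m / a * Real.pi) / a)
  have := Real.neg_pi_div_two_lt_arctan (g 0 / a)
  linarith

theorem sphereTimesLine_horizontal_equation {κ : ℝ} (hκ : 0 < κ) {m lam : ℝ}
    {f : Metric.sphere (0 : EuclideanSpace ℝ (Fin 3)) 1 × ℝ → ℝ}
    (hf : (sphereTimesLine κ hκ).IsGradientQuasiEinstein m lam f)
    (x : Metric.sphere (0 : EuclideanSpace ℝ (Fin 3)) 1 × ℝ)
    (h : ∀ v : EuclideanSpace ℝ (Fin 2) × ℝ, v.2 = 0 →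
      fderiv ℝ (f ∘ (extChartAt ((𝓡 2).prod 𝓘(ℝ, ℝ)) x).symm)
        (extChartAt ((𝓡 2).prod 𝓘(ℝ, ℝ)) x x) v = 0) :
    ∃ v : EuclideanSpace ℝ (Fin 2) × ℝ, v.2 = 0 ∧ ∃ P : ℝ, 0 < P ∧
      P + fderiv ℝ (fderiv ℝ (f ∘ (extChartAt ((𝓡 2).prod 𝓘(ℝ, ℝ)) x).symm))
        (extChartAt ((𝓡 2).prod 𝓘(ℝ, ℝ)) x x) v v = lam * (κ⁻¹ * P) := by
  obtain ⟨L, Γ, hL, -, hinj, hΓ, -, heq⟩ := sphereTimesLine_chart κ hκ x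
  let v : EuclideanSpace ℝ (Fin 2) × ℝ := (EuclideanSpace.single 0 1, 0)
  have hv0 : v ≠ 0 := fun h0 ↦ by
    have h1 := congrArg (fun w : EuclideanSpace ℝ (Fin 2) × ℝ ↦ w.1 0) h0
    simp [v] at h1
  have hpos : (L v).1 ≠ 0 := fun h0 ↦ hv0 (hinj v (Prod.ext h0 (hL v)))
  refine ⟨v, rfl, inner ℝ (L v).1 (L v).1, real_inner_self_pos.2 hpos, ?_⟩
  have e := (heq m lam f hf).2 v v
  rw [h v rfl, h _ (hΓ v rfl), productForm_apply, hL] at e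
  simp only [v] at e ⊢
  linarith

theorem sphereTimesLine_quasiEinstein_eq {κ : ℝ} (hκ : 0 < κ) {m lam : ℝ}
    {f : (sphereTimesLine κ hκ).M → ℝ}
    (hf : (sphereTimesLine κ hκ).IsGradientQuasiEinstein m lam f) : lam = κ := by
  let f' : Metric.sphere (0 : EuclideanSpace ℝ (Fin 3)) 1 × ℝ → ℝ := f
  have hcont : Continuous f' := hf.1.continuous
  have : Nonempty (Metric.sphere (0 : EuclideanSpace ℝ (Fin 3)) 1) :=
    (NormedSpace.sphere_nonempty.2 zero_le_one).to_subtype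
  have hcont0 : Continuous fun p ↦ f' (p, 0) := by fun_prop
  obtain ⟨p, -, hp⟩ := isCompact_univ.exists_isMaxOn Set.univ_nonempty hcont0.continuousOn
  obtain ⟨q, -, hq⟩ := isCompact_univ.exists_isMinOn Set.univ_nonempty hcont0.continuousOn
  let φ (x : Metric.sphere (0 : EuclideanSpace ℝ (Fin 3)) 1 × ℝ) :
      EuclideanSpace ℝ (Fin 2) × ℝ → ℝ := f' ∘ (extChartAt ((𝓡 2).prod 𝓘(ℝ, ℝ)) x).symm
  let c (x : Metric.sphere (0 : EuclideanSpace ℝ (Fin 3)) 1 × ℝ) :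
      EuclideanSpace ℝ (Fin 2) × ℝ := extChartAt ((𝓡 2).prod 𝓘(ℝ, ℝ)) x x
  have hφ : ∀ x, ContDiffAt ℝ ∞ (φ x) (c x) := fun x ↦
    ((sphereTimesLine_chart κ hκ x).choose_spec.choose_spec.2.2.2.2.2 m lam f hf).1
  have hφc : ∀ x, φ x (c x) = f' x := fun x ↦ congrArg f'
    (extChartAt_to_inv (I := (𝓡 2).prod 𝓘(ℝ, ℝ)) x)
  have hslice : ∀ x v (s : ℝ), v.2 = 0 → ∃ p, φ x (c x + s • v) = f' (p, x.2) := by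
    intro x v s hv
    refine ⟨((extChartAt ((𝓡 2).prod 𝓘(ℝ, ℝ)) x).symm (c x + s • v)).1, congrArg f' ?_⟩
    refine Prod.ext rfl ?_
    rw [sphereLine_extChartAt_symm_snd, Prod.snd_add, sphereLine_extChartAt_snd]
    simp [hv]
  have hmax := fun v (hv : v.2 = 0) ↦ fderiv_fderiv_nonpos_of_isLocalMax (hφ (p, 0)) (v := v)
    (.of_forall fun s ↦ by
      obtain ⟨p', hp'⟩ := hslice (p, 0) v s hv
      simp only [hp', zero_smul, add_zero, hφc]
      exact hp (Set.mem_univ p'))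
  have hmin := fun v (hv : v.2 = 0) ↦ fderiv_fderiv_nonneg_of_isLocalMin (hφ (q, 0)) (v := v)
    (.of_forall fun s ↦ by
      obtain ⟨p', hp'⟩ := hslice (q, 0) v s hv
      simp only [hp', zero_smul, add_zero, hφc]
      exact hq (Set.mem_univ p'))
  obtain ⟨v, hv, P, hP, e⟩ := sphereTimesLine_horizontal_equation hκ hf (p, 0)
    fun v hv ↦ (hmax v hv).1
  obtain ⟨w, hw, Q, hQ, e'⟩ := sphereTimesLine_horizontal_equation hκ hf (q, 0)
    fun v hv ↦ (hmin v hv).1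
  have i1 := (hmax v hv).2
  have i2 := (hmin w hw).2
  have j1 : lam * κ⁻¹ * P ≤ 1 * P := by linarith
  have j2 : 1 * Q ≤ lam * κ⁻¹ * Q := by linarith
  have j3 := le_antisymm (le_of_mul_le_mul_right j1 hP) (le_of_mul_le_mul_right j2 hQ)
  field_simp at j3
  exact j3

theorem not_quasiEinstein_sphereTimesLine {κ : ℝ} (hκ : 0 < κ) {m lam : ℝ} (hm : 0 < m)
    {f : (sphereTimesLine κ hκ).M → ℝ}
    (hf : (sphereTimesLine κ hκ).IsGradientQuasiEinstein m lam f) : False := by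
  have hlam := sphereTimesLine_quasiEinstein_eq hκ hf
  let f' : Metric.sphere (0 : EuclideanSpace ℝ (Fin 3)) 1 × ℝ → ℝ := f
  obtain ⟨p⟩ : Nonempty (Metric.sphere (0 : EuclideanSpace ℝ (Fin 3)) 1) :=
    (NormedSpace.sphere_nonempty.2 zero_le_one).to_subtype
  have hsm : ContMDiff 𝓘(ℝ, ℝ) 𝓘(ℝ, ℝ) ∞ fun t : ℝ ↦ f' (p, t) :=
    ContMDiff.comp (I' := (𝓡 2).prod 𝓘(ℝ, ℝ)) (g := f') hf.1
      (contMDiff_const.prodMk contMDiff_id)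
  have hsm' := hsm.contDiff
  have hd : Differentiable ℝ (deriv fun t : ℝ ↦ f' (p, t)) :=
    (contDiff_infty_iff_deriv.1 hsm').2.differentiable (by simp)
  refine not_forall_riccati hκ hm (g := deriv fun t : ℝ ↦ f' (p, t)) fun t ↦ ?_
  obtain ⟨L, Γ, -, hL1, -, -, hΓ, heq⟩ := sphereTimesLine_chart κ hκ (p, t)
  obtain ⟨hφ, e⟩ := heq m lam f hf
  replace e := e (0, 1) (0, 1)
  let φ : EuclideanSpace ℝ (Fin 2) × ℝ → ℝ :=
    f' ∘ (extChartAt ((𝓡 2).prod 𝓘(ℝ, ℝ)) (p, t)).symm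
  let c : EuclideanSpace ℝ (Fin 2) × ℝ := extChartAt ((𝓡 2).prod 𝓘(ℝ, ℝ)) (p, t) (p, t)
  have hline : (fun s : ℝ ↦ φ (c + s • ((0, 1) : EuclideanSpace ℝ (Fin 2) × ℝ)))
      = fun s ↦ f' (p, s + t) := by
    funext s
    refine congrArg f' (Prod.ext (sphereLine_extChartAt_symm_fst (p, t) _ (by simp [c])) ?_)
    rw [sphereLine_extChartAt_symm_snd, Prod.snd_add, sphereLine_extChartAt_snd]
    simp [add_comm]
  have e1 : fderiv ℝ φ c (0, 1) = deriv (fun t : ℝ ↦ f' (p, t)) t := by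
    rw [← deriv_line hφ, hline, deriv_comp_add_const (fun t ↦ f' (p, t)), zero_add]
  have e2 : fderiv ℝ (fderiv ℝ φ) c (0, 1) (0, 1)
      = deriv (deriv fun t : ℝ ↦ f' (p, t)) t := by
    rw [← deriv_deriv_line hφ, hline, funext (deriv_comp_add_const (fun t ↦ f' (p, t)) t),
      deriv_comp_add_const, zero_add]
  change _ + (fderiv ℝ (fderiv ℝ φ) c (0, 1) (0, 1) - fderiv ℝ φ c _)
    - 1 / m * (fderiv ℝ φ c (0, 1) * fderiv ℝ φ c (0, 1)) = _ at e
  rw [hL1, productForm_apply, hΓ, map_zero, e1, e2, hlam] at e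
  simp only [inner_zero_left, mul_zero, zero_add, mul_one] at e
  have e5 := (hd t).hasDerivAt
  refine e5.congr_deriv ?_
  linear_combination e

end SphereTimesLineRigidity

section PositiveSolutions

/-- The positive solutions of `u'' = μ² u` on the line. -/
theorem positive_solution_of_deriv_deriv {μ : ℝ} (hμ : 0 < μ) {u u' : ℝ → ℝ}
    (h1 : ∀ t, HasDerivAt u (u' t) t) (h2 : ∀ t, HasDerivAt u' (μ ^ 2 * u t) t)
    (hu : ∀ t, 0 < u t) :
    (∃ A, 0 < A ∧ ∀ t, u t = A * Real.exp (μ * t)) ∨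
    (∃ A, 0 < A ∧ ∀ t, u t = A * Real.exp (-(μ * t))) ∨
    ∃ A a, 0 < A ∧ ∀ t, u t = A * Real.cosh (μ * (t + a)) := by
  have e1 : ∀ t, HasDerivAt (fun t ↦ Real.exp (μ * t)) (Real.exp (μ * t) * μ) t := fun t ↦ by
    simpa using ((hasDerivAt_id t).const_mul μ).exp
  have e2 : ∀ t, HasDerivAt (fun t ↦ Real.exp (-(μ * t))) (Real.exp (-(μ * t)) * -μ) t := fun t ↦ by
    simpa using ((hasDerivAt_id t).const_mul μ).neg.exp
  have d1 : ∀ t, HasDerivAt (fun t ↦ (μ * u t + u' t) * Real.exp (-(μ * t))) 0 t := fun t ↦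
    ((((h1 t).const_mul μ).add (h2 t)).mul (e2 t)).congr_deriv (by simp only [Pi.add_apply]; ring)
  have d2 : ∀ t, HasDerivAt (fun t ↦ (μ * u t - u' t) * Real.exp (μ * t)) 0 t := fun t ↦
    ((((h1 t).const_mul μ).sub (h2 t)).mul (e1 t)).congr_deriv (by simp only [Pi.sub_apply]; ring)
  have c1 := is_const_of_deriv_eq_zero (fun t ↦ (d1 t).differentiableAt) fun t ↦ (d1 t).deriv
  have c2 := is_const_of_deriv_eq_zero (fun t ↦ (d2 t).differentiableAt) fun t ↦ (d2 t).deriv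
  obtain ⟨A, hA⟩ : ∃ A, ∀ t, (μ * u t + u' t) * Real.exp (-(μ * t)) = 2 * μ * A :=
    ⟨(μ * u 0 + u' 0) / (2 * μ), fun t ↦ by rw [c1 t 0]; field_simp; simp⟩
  obtain ⟨B, hB⟩ : ∃ B, ∀ t, (μ * u t - u' t) * Real.exp (μ * t) = 2 * μ * B :=
    ⟨(μ * u 0 - u' 0) / (2 * μ), fun t ↦ by rw [c2 t 0]; field_simp; simp⟩
  have hsol : ∀ t, u t = A * Real.exp (μ * t) + B * Real.exp (-(μ * t)) := fun t ↦ by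
    have i : Real.exp (μ * t) * Real.exp (-(μ * t)) = 1 := by rw [← Real.exp_add]; simp
    have j : 2 * μ * u t = 2 * μ * (A * Real.exp (μ * t) + B * Real.exp (-(μ * t))) := by
      linear_combination Real.exp (μ * t) * hA t + Real.exp (-(μ * t)) * hB t - (2 * μ * u t) * i
    exact mul_left_cancel₀ (by positivity) j
  have hpos : ∀ X, 0 < X → 0 < A * X ^ 2 + B := fun X hX ↦ by
    have h := hu (Real.log X / μ)
    rw [hsol, mul_div_cancel₀ _ hμ.ne', Real.exp_neg, Real.exp_log hX] at h
    have h' := mul_pos h hX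
    field_simp at h'
    linarith
  have hA0 : 0 ≤ A := by
    by_contra! hneg
    have h := hpos (√((|B| + 1) / -A)) (Real.sqrt_pos.2 (div_pos (by positivity) (by linarith)))
    rw [Real.sq_sqrt (div_nonneg (by positivity) (by linarith))] at h
    have : A * ((|B| + 1) / -A) = -(|B| + 1) := by
      have hne := hneg.ne
      field_simp
    linarith [le_abs_self B]
  have hB0 : 0 ≤ B := by
    by_contra! hneg
    have h := hpos (√(-B / (2 * (A + 1)))) (Real.sqrt_pos.2 (div_pos (by linarith) (by linarith)))
    rw [Real.sq_sqrt (div_nonneg (by linarith) (by linarith))] at h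
    have i : A * (-B / (2 * (A + 1))) + B = B * ((A + 2) / (2 * (A + 1))) := by
      field_simp; ring
    have j : 0 < (A + 2) / (2 * (A + 1)) := by positivity
    nlinarith
  rcases hA0.eq_or_lt with hA' | hA'
  · have hB' : 0 < B := by
      have := hpos 1 one_pos
      rw [← hA'] at this
      linarith
    exact Or.inr (Or.inl ⟨B, hB', fun t ↦ by rw [hsol, ← hA']; ring⟩)
  rcases hB0.eq_or_lt with hB' | hB'
  · exact Or.inl ⟨A, hA', fun t ↦ by rw [hsol, ← hB']; ring⟩
  · refine Or.inr (Or.inr ⟨2 * (√A * √B), (Real.log √A - Real.log √B) / μ, by positivity,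
      fun t ↦ ?_⟩)
    have sA : √A ^ 2 = A := Real.sq_sqrt hA0
    have sB : √B ^ 2 = B := Real.sq_sqrt hB0
    have pA : 0 < √A := Real.sqrt_pos.2 hA'
    have pB : 0 < √B := Real.sqrt_pos.2 hB'
    have e : μ * (t + (Real.log √A - Real.log √B) / μ)
        = μ * t + Real.log (√A / √B) := by
      rw [Real.log_div pA.ne' pB.ne']; field_simp
    rw [hsol, e, Real.cosh_eq, neg_add, Real.exp_add, Real.exp_add, Real.exp_neg (Real.log _),
      Real.exp_log (by positivity)]
    nth_rewrite 1 [← sA]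
    nth_rewrite 1 [← sB]
    field_simp

/-- The functions `f` for which `exp (-f / m)` is a positive solution of `u'' = μ² u`. -/
theorem potential_of_positive_solution {m μ : ℝ} (hm : 0 < m) (hμ : 0 < μ) {h u' : ℝ → ℝ}
    (h1 : ∀ t, HasDerivAt (fun t ↦ Real.exp (-h t / m)) (u' t) t)
    (h2 : ∀ t, HasDerivAt u' (μ ^ 2 * Real.exp (-h t / m)) t) :
    (∃ c, (∀ t, h t = m * μ * t + c) ∨ ∀ t, h t = -(m * μ) * t + c) ∨
    ∃ a b, ∀ t, h t = -m * Real.log (Real.cosh (μ * (t + a))) + b := by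
  have hlog : ∀ t, h t = -m * Real.log (Real.exp (-h t / m)) := fun t ↦ by
    rw [Real.log_exp]; field_simp
  rcases positive_solution_of_deriv_deriv hμ h1 h2 fun t ↦ Real.exp_pos _ with
    ⟨A, hA, hu⟩ | ⟨A, hA, hu⟩ | ⟨A, a, hA, hu⟩
  · refine Or.inl ⟨-m * Real.log A, Or.inr fun t ↦ ?_⟩
    rw [hlog, hu, Real.log_mul hA.ne' (Real.exp_pos _).ne', Real.log_exp]
    ring
  · refine Or.inl ⟨-m * Real.log A, Or.inl fun t ↦ ?_⟩
    rw [hlog, hu, Real.log_mul hA.ne' (Real.exp_pos _).ne', Real.log_exp]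
    ring
  · refine Or.inr ⟨a, -m * Real.log A, fun t ↦ ?_⟩
    rw [hlog, hu, Real.log_mul hA.ne' (Real.cosh_pos _).ne']
    ring

end PositiveSolutions

section BianchiCartanVranceanuFrame

open Filter Topology ContinuousLinearMap

/-- The elementary endomorphism `U ↦ Uᵢ ∂ⱼ`. -/
noncomputable def elemEnd (i j : Fin 3) :
    EuclideanSpace ℝ (Fin 3) →L[ℝ] EuclideanSpace ℝ (Fin 3) :=
  (dcoord i).smulRight (EuclideanSpace.single j 1)

theorem elemEnd_apply (i j k : Fin 3) (U : EuclideanSpace ℝ (Fin 3)) :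
    elemEnd i j U k = if k = j then U i else 0 := by
  change (U i • EuclideanSpace.single j (1 : ℝ)) k = _
  simp

/-- The elementary bilinear map `(U, V) ↦ Uᵢ Vⱼ ∂ₖ`. -/
noncomputable def elemBilin (i j k : Fin 3) : EuclideanSpace ℝ (Fin 3) →L[ℝ]
    EuclideanSpace ℝ (Fin 3) →L[ℝ] EuclideanSpace ℝ (Fin 3) :=
  (dcoord i).smulRight (elemEnd j k)

theorem elemBilin_apply (i j k l : Fin 3) (U V : EuclideanSpace ℝ (Fin 3)) :
    elemBilin i j k U V l = if l = k then U i * V j else 0 := by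
  change (U i • elemEnd j k V) l = _
  rw [PiLp.smul_apply, elemEnd_apply]
  simp

/-- The orthonormal frame of `E³(κ, τ)`. -/
noncomputable def bcvFrame (κ τ : ℝ) (y : EuclideanSpace ℝ (Fin 3)) :
    EuclideanSpace ℝ (Fin 3) →L[ℝ] EuclideanSpace ℝ (Fin 3) :=
  (1 + κ / 4 * (y 0 ^ 2 + y 1 ^ 2)) • (elemEnd 0 0 + elemEnd 1 1) + elemEnd 2 2
    + τ • (y 1 • elemEnd 0 2 - y 0 • elemEnd 1 2)

theorem bcvFrame_apply (κ τ : ℝ) (y U : EuclideanSpace ℝ (Fin 3)) :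
    bcvFrame κ τ y U 0 = (1 + κ / 4 * (y 0 ^ 2 + y 1 ^ 2)) * U 0 ∧
    bcvFrame κ τ y U 1 = (1 + κ / 4 * (y 0 ^ 2 + y 1 ^ 2)) * U 1 ∧
    bcvFrame κ τ y U 2 = U 2 + τ * (y 1 * U 0 - y 0 * U 1) := by
  simp [bcvFrame, elemEnd_apply]

theorem contDiff_bcvFrame (κ τ : ℝ) : ContDiff ℝ ∞ (bcvFrame κ τ) := by
  unfold bcvFrame
  fun_prop

theorem hasFDerivAt_apply_euclidean (i : Fin 3) (y : EuclideanSpace ℝ (Fin 3)) :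
    HasFDerivAt (fun y : EuclideanSpace ℝ (Fin 3) ↦ y i) (dcoord i) y :=
  (dcoord i).hasFDerivAt

theorem dcoord_apply (i : Fin 3) (y : EuclideanSpace ℝ (Fin 3)) : dcoord i y = y i := rfl

theorem fderiv_bcvFrame (κ τ : ℝ) (y u U : EuclideanSpace ℝ (Fin 3)) :
    fderiv ℝ (bcvFrame κ τ) y u U 0 = κ / 2 * (y 0 * u 0 + y 1 * u 1) * U 0 ∧
    fderiv ℝ (bcvFrame κ τ) y u U 1 = κ / 2 * (y 0 * u 0 + y 1 * u 1) * U 1 ∧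
    fderiv ℝ (bcvFrame κ τ) y u U 2 = τ * (u 1 * U 0 - u 0 * U 1) := by
  have h (i : Fin 3) := hasFDerivAt_apply_euclidean i y
  have hd : HasFDerivAt (bcvFrame κ τ) _ y :=
    ((((((h 0).pow 2).add ((h 1).pow 2)).const_mul (κ / 4)).const_add 1).smul_const
      (elemEnd 0 0 + elemEnd 1 1)).add_const (elemEnd 2 2) |>.add
      ((((h 1).smul_const (elemEnd 0 2)).sub ((h 0).smul_const (elemEnd 1 2))).const_smul τ)
  rw [hd.fderiv]
  simp [elemEnd_apply, dcoord_apply]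
  exact ⟨Or.inl (by ring), Or.inl (by ring)⟩

/-- The coefficients of the Levi-Civita connection of `E³(κ, τ)` in the orthonormal frame. -/
noncomputable def bcvConnection (κ τ : ℝ) (y : EuclideanSpace ℝ (Fin 3)) :
    EuclideanSpace ℝ (Fin 3) →L[ℝ] EuclideanSpace ℝ (Fin 3) →L[ℝ] EuclideanSpace ℝ (Fin 3) :=
  y 1 • (κ / 2) • (elemBilin 0 0 1 - elemBilin 0 1 0)
    + y 0 • (κ / 2) • (elemBilin 1 1 0 - elemBilin 1 0 1)
    + τ • (elemBilin 0 2 1 + elemBilin 2 0 1 - elemBilin 1 2 0 - elemBilin 2 1 0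
      + elemBilin 1 0 2 - elemBilin 0 1 2)

theorem bcvConnection_apply (κ τ : ℝ) (y U V : EuclideanSpace ℝ (Fin 3)) :
    bcvConnection κ τ y U V 0
      = -(κ / 2) * y 1 * U 0 * V 1 + κ / 2 * y 0 * U 1 * V 1 - τ * (U 1 * V 2 + U 2 * V 1) ∧
    bcvConnection κ τ y U V 1
      = κ / 2 * y 1 * U 0 * V 0 - κ / 2 * y 0 * U 1 * V 0 + τ * (U 0 * V 2 + U 2 * V 0) ∧
    bcvConnection κ τ y U V 2 = τ * (U 1 * V 0 - U 0 * V 1) := by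
  refine ⟨?_, ?_, ?_⟩ <;> simp [bcvConnection, elemBilin_apply] <;> ring

theorem hasFDerivAt_bcvConnection (κ τ : ℝ) (y : EuclideanSpace ℝ (Fin 3)) :
    HasFDerivAt (bcvConnection κ τ)
      ((dcoord 1).smulRight ((κ / 2) • (elemBilin 0 0 1 - elemBilin 0 1 0))
        + (dcoord 0).smulRight ((κ / 2) • (elemBilin 1 1 0 - elemBilin 1 0 1))) y :=
  (((hasFDerivAt_apply_euclidean 1 y).smul_const _).add
    ((hasFDerivAt_apply_euclidean 0 y).smul_const _)).add_const _

theorem fderiv_bcvConnection (κ τ : ℝ) (y u U V : EuclideanSpace ℝ (Fin 3)) :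
    fderiv ℝ (bcvConnection κ τ) y u U V 0
      = -(κ / 2) * u 1 * U 0 * V 1 + κ / 2 * u 0 * U 1 * V 1 ∧
    fderiv ℝ (bcvConnection κ τ) y u U V 1
      = κ / 2 * u 1 * U 0 * V 0 - κ / 2 * u 0 * U 1 * V 0 ∧
    fderiv ℝ (bcvConnection κ τ) y u U V 2 = 0 := by
  rw [(hasFDerivAt_bcvConnection κ τ y).fderiv]
  refine ⟨?_, ?_, ?_⟩ <;> simp [elemBilin_apply, dcoord_apply] <;> ring

theorem bcvForm_bcvFrame {κ : ℝ} (τ : ℝ) {y : EuclideanSpace ℝ (Fin 3)} (hy : y ∈ bcvDomain κ)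
    (U V : EuclideanSpace ℝ (Fin 3)) :
    bcvForm κ τ y (bcvFrame κ τ y U) (bcvFrame κ τ y V)
      = U 0 * V 0 + U 1 * V 1 + U 2 * V 2 := by
  have hs : 1 + κ / 4 * (y 0 ^ 2 + y 1 ^ 2) ≠ 0 := ne_of_gt hy
  obtain ⟨a0, a1, a2⟩ := bcvFrame_apply κ τ y U
  obtain ⟨b0, b1, b2⟩ := bcvFrame_apply κ τ y V
  rw [bcvForm_apply, a0, a1, a2, b0, b1, b2, conformalFactor]
  generalize 1 + κ / 4 * (y 0 ^ 2 + y 1 ^ 2) = s at hs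
  field_simp
  ring

theorem bijective_bcvFrame {κ : ℝ} (τ : ℝ) {y : EuclideanSpace ℝ (Fin 3)}
    (hy : y ∈ bcvDomain κ) : Function.Bijective (bcvFrame κ τ y) := by
  have hinj : Function.Injective (bcvFrame κ τ y : EuclideanSpace ℝ (Fin 3) →ₗ[ℝ]
      EuclideanSpace ℝ (Fin 3)) := by
    rw [← LinearMap.ker_eq_bot, LinearMap.ker_eq_bot']
    intro U hU
    have hU' : bcvFrame κ τ y U = 0 := hU
    have h := bcvForm_bcvFrame τ hy U U
    rw [hU', map_zero] at h
    ext i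
    fin_cases i <;> simp <;> nlinarith [sq_nonneg (U 0), sq_nonneg (U 1), sq_nonneg (U 2)]
  exact ⟨hinj, LinearMap.injective_iff_surjective.1 hinj⟩

theorem bcvForm_isInvertible {κ : ℝ} (τ : ℝ) {y : EuclideanSpace ℝ (Fin 3)}
    (hy : y ∈ bcvDomain κ) : (bcvForm κ τ y).IsInvertible :=
  isInvertible_of_pos (bcvForm_pos κ τ ⟨y, hy⟩)

theorem christoffel_bcvForm {κ : ℝ} (τ : ℝ) {y : EuclideanSpace ℝ (Fin 3)}
    (hy : y ∈ bcvDomain κ) (U V : EuclideanSpace ℝ (Fin 3)) :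
    christoffel (bcvForm κ τ) y (bcvFrame κ τ y U) (bcvFrame κ τ y V)
      + fderiv ℝ (bcvFrame κ τ) y (bcvFrame κ τ y U) V
      = bcvFrame κ τ y (bcvConnection κ τ y U V) := by
  refine christoffel_frame (fun U V ↦ U 0 * V 0 + U 1 * V 1 + U 2 * V 2)
    ((contDiffAt_bcvForm κ τ ⟨y, hy⟩).differentiableAt (by simp)) (bcvForm_isInvertible τ hy)
    (fun v w ↦ by rw [bcvForm_apply, bcvForm_apply]; ring)
    ((contDiff_bcvFrame κ τ).differentiable (by simp) y) (bijective_bcvFrame τ hy).2 ?_ ?_ ?_ U V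
  · filter_upwards [(bcvDomain κ).isOpen.mem_nhds hy] with p hp V Z using bcvForm_bcvFrame τ hp V Z
  · intro U V Z
    obtain ⟨a0, a1, a2⟩ := bcvConnection_apply κ τ y U V
    obtain ⟨b0, b1, b2⟩ := bcvConnection_apply κ τ y U Z
    rw [a0, a1, a2, b0, b1, b2]
    ring
  · intro U V
    obtain ⟨a0, a1, a2⟩ := bcvFrame_apply κ τ y (bcvConnection κ τ y U V)
    obtain ⟨b0, b1, b2⟩ := bcvFrame_apply κ τ y (bcvConnection κ τ y V U)
    obtain ⟨c0, c1, c2⟩ := bcvConnection_apply κ τ y U V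
    obtain ⟨d0, d1, d2⟩ := bcvConnection_apply κ τ y V U
    obtain ⟨e0, e1, e2⟩ := fderiv_bcvFrame κ τ y (bcvFrame κ τ y U) V
    obtain ⟨f0, f1, f2⟩ := fderiv_bcvFrame κ τ y (bcvFrame κ τ y V) U
    obtain ⟨g0, g1, g2⟩ := bcvFrame_apply κ τ y U
    obtain ⟨h0, h1, h2⟩ := bcvFrame_apply κ τ y V
    ext i
    fin_cases i
    · simp only [Fin.zero_eta, PiLp.sub_apply]
      rw [a0, b0, e0, f0, c0, d0, g0, g1, h0, h1]
      ring
    · simp only [Fin.mk_one, PiLp.sub_apply]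
      rw [a1, b1, e1, f1, c1, d1, g0, g1, h0, h1]
      ring
    · simp only [Fin.reduceFinMk, PiLp.sub_apply]
      rw [a2, b2, e2, f2, c0, d0, c1, d1, c2, d2, g0, g1, h0, h1]
      ring

theorem coordRicci_bcvForm {κ : ℝ} (τ : ℝ) {y : EuclideanSpace ℝ (Fin 3)}
    (hy : y ∈ bcvDomain κ) (V W : EuclideanSpace ℝ (Fin 3)) :
    coordRicci (bcvForm κ τ) y (bcvFrame κ τ y V) (bcvFrame κ τ y W)
      = (κ - 2 * τ ^ 2) * (V 0 * W 0 + V 1 * W 1) + 2 * τ ^ 2 * (V 2 * W 2) := by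
  have hG := contDiffAt_bcvForm κ τ ⟨y, hy⟩
  have hnear : ∀ᶠ p in 𝓝 y, p ∈ bcvDomain κ := (bcvDomain κ).isOpen.mem_nhds hy
  have key := curvatureEndo_frame (Ω := bcvConnection κ τ) (e := bcvFrame κ τ)
    ((contDiffAt_christoffel hG (bcvForm_isInvertible τ hy)).differentiableAt (by simp))
    (christoffel_symm (hG.differentiableAt (by simp)) (bcvForm_isInvertible τ hy)
      (.of_forall fun p v w ↦ by rw [bcvForm_apply, bcvForm_apply]; ring))
    (contDiff_bcvFrame κ τ).contDiffAt (hasFDerivAt_bcvConnection κ τ y).differentiableAt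
    (by filter_upwards [hnear] with p hp U V using christoffel_bcvForm τ hp U V)
  let e : EuclideanSpace ℝ (Fin 3) ≃ₗ[ℝ] EuclideanSpace ℝ (Fin 3) :=
    LinearEquiv.ofBijective (bcvFrame κ τ y : _ →ₗ[ℝ] _) (bijective_bcvFrame τ hy)
  have he : ∀ U, e U = bcvFrame κ τ y U := fun U ↦ rfl
  unfold coordRicci
  rw [← LinearMap.trace_conj' _ e.symm,
    LinearMap.trace_eq_sum_inner _ (EuclideanSpace.basisFun (Fin 3) ℝ)]
  simp only [LinearEquiv.conj_apply, LinearMap.comp_apply, LinearEquiv.coe_coe,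
    LinearEquiv.symm_symm, he, ContinuousLinearMap.coe_coe, key]
  simp only [← he, LinearEquiv.symm_apply_apply]
  have c0 := fun U V ↦ (bcvConnection_apply κ τ y U V).1
  have c1 := fun U V ↦ (bcvConnection_apply κ τ y U V).2.1
  have c2 := fun U V ↦ (bcvConnection_apply κ τ y U V).2.2
  have d0 := fun u U V ↦ (fderiv_bcvConnection κ τ y u U V).1
  have d1 := fun u U V ↦ (fderiv_bcvConnection κ τ y u U V).2.1
  have d2 := fun u U V ↦ (fderiv_bcvConnection κ τ y u U V).2.2
  have f0 := fun U ↦ (bcvFrame_apply κ τ y U).1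
  have f1 := fun U ↦ (bcvFrame_apply κ τ y U).2.1
  simp only [EuclideanSpace.basisFun_apply, EuclideanSpace.inner_single_left, Fin.sum_univ_three,
    PiLp.sub_apply, PiLp.add_apply, he, c0, c1, c2, d0, d1, d2, f0, f1]
  simp
  ring

end BianchiCartanVranceanuFrame

section BianchiCartanVranceanuChart

open Filter Topology ContinuousLinearMap

open Classical in
/-- The extension by zero of a function on the coordinate domain. -/
noncomputable def bcvExtend {κ : ℝ} (f : bcvDomain κ → ℝ) (y : EuclideanSpace ℝ (Fin 3)) : ℝ :=
  if h : y ∈ bcvDomain κ then f ⟨y, h⟩ else 0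

theorem bcvExtend_apply {κ : ℝ} (f : bcvDomain κ → ℝ) {y : EuclideanSpace ℝ (Fin 3)}
    (hy : y ∈ bcvDomain κ) : bcvExtend f y = f ⟨y, hy⟩ :=
  dif_pos hy

theorem bcvDomain_extChartAt_symm {κ : ℝ} (x : bcvDomain κ) :
    ∀ᶠ y in 𝓝 (x : EuclideanSpace ℝ (Fin 3)),
      ((extChartAt 𝓘(ℝ, EuclideanSpace ℝ (Fin 3)) x).symm y : EuclideanSpace ℝ (Fin 3)) = y := by
  have h := extChartAt_target_mem_nhds (I := 𝓘(ℝ, EuclideanSpace ℝ (Fin 3))) x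
  have hx : extChartAt 𝓘(ℝ, EuclideanSpace ℝ (Fin 3)) x x = x := rfl
  rw [hx] at h
  filter_upwards [h] with y hy
  exact (extChartAt 𝓘(ℝ, EuclideanSpace ℝ (Fin 3)) x).right_inv hy

theorem comp_extChartAt_symm_eventuallyEq {κ : ℝ} (f : bcvDomain κ → ℝ) (x : bcvDomain κ) :
    f ∘ (extChartAt 𝓘(ℝ, EuclideanSpace ℝ (Fin 3)) x).symm
      =ᶠ[𝓝 (x : EuclideanSpace ℝ (Fin 3))] bcvExtend f := by
  filter_upwards [bcvDomain_extChartAt_symm x, (bcvDomain κ).isOpen.mem_nhds x.2] with y hy hy'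
  rw [bcvExtend_apply f hy']
  exact congrArg f (Subtype.ext hy)

theorem bcvDomain_extChartAt_symm_eventually {κ : ℝ} (x : bcvDomain κ) :
    ((↑) : bcvDomain κ → EuclideanSpace ℝ (Fin 3))
        ∘ (extChartAt 𝓘(ℝ, EuclideanSpace ℝ (Fin 3)) x).symm
      =ᶠ[𝓝 (x : EuclideanSpace ℝ (Fin 3))] id :=
  bcvDomain_extChartAt_symm x

theorem bilinearComp_fderiv_of_eventuallyEq_id {E : Type*} [NormedAddCommGroup E]
    [NormedSpace ℝ E] (B : E → E →L[ℝ] E →L[ℝ] ℝ) {ψ : E → E} {y : E} (h : ψ =ᶠ[𝓝 y] id) :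
    (B (ψ y)).bilinearComp (fderiv ℝ ψ y) (fderiv ℝ ψ y) = B y := by
  rw [h.fderiv_eq, h.self_of_nhds, fderiv_id]
  rfl

theorem bcvSpace_metricInChart (κ τ : ℝ) (x : bcvDomain κ) :
    (bcvSpace κ τ).metricInChart x =ᶠ[𝓝 (x : EuclideanSpace ℝ (Fin 3))] bcvForm κ τ := by
  let X := bcvSpace κ τ
  let Φ : X.M → EuclideanSpace ℝ (Fin 3) := ((↑) : bcvDomain κ → _)
  have hΦ' : ContMDiff 𝓘(ℝ, EuclideanSpace ℝ (Fin 3)) 𝓘(ℝ, EuclideanSpace ℝ (Fin 3)) ∞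
    ((↑) : bcvDomain κ → EuclideanSpace ℝ (Fin 3)) := contMDiff_subtype_val
  have hΦ : ContMDiff X.I 𝓘(ℝ, EuclideanSpace ℝ (Fin 3)) ∞ Φ := hΦ'
  have hX : ∀ p, X.metric.inner p = inducedForm X.I Φ (bcvForm κ τ) p := fun _ ↦ rfl
  let ψ : EuclideanSpace ℝ (Fin 3) → EuclideanSpace ℝ (Fin 3) :=
    ((↑) : bcvDomain κ → _) ∘ (extChartAt 𝓘(ℝ, EuclideanSpace ℝ (Fin 3)) x).symm
  have h : (bcvSpace κ τ).metricInChart x =ᶠ[𝓝 (x : EuclideanSpace ℝ (Fin 3))]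
      fun y ↦ (bcvForm κ τ (ψ y)).bilinearComp (fderiv ℝ ψ y) (fderiv ℝ ψ y) :=
    X.metricInChart_eventuallyEq hΦ hX x
  refine h.trans ?_
  filter_upwards [(bcvDomain_extChartAt_symm_eventually x).eventually_nhds] with y hy
  exact bilinearComp_fderiv_of_eventuallyEq_id _ hy

theorem bcvSpace_inner (κ τ : ℝ) (x : bcvDomain κ) (v w : EuclideanSpace ℝ (Fin 3)) :
    (bcvSpace κ τ).metric.inner x v w = bcvForm κ τ (x : EuclideanSpace ℝ (Fin 3)) v w := by
  let X := bcvSpace κ τ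
  let Φ : X.M → EuclideanSpace ℝ (Fin 3) := ((↑) : bcvDomain κ → _)
  have hΦ' : ContMDiff 𝓘(ℝ, EuclideanSpace ℝ (Fin 3)) 𝓘(ℝ, EuclideanSpace ℝ (Fin 3)) ∞
    ((↑) : bcvDomain κ → EuclideanSpace ℝ (Fin 3)) := contMDiff_subtype_val
  have hΦ : ContMDiff X.I 𝓘(ℝ, EuclideanSpace ℝ (Fin 3)) ∞ Φ := hΦ'
  have hX : ∀ p, X.metric.inner p = inducedForm X.I Φ (bcvForm κ τ) p := fun _ ↦ rfl
  let ψ : EuclideanSpace ℝ (Fin 3) → EuclideanSpace ℝ (Fin 3) :=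
    ((↑) : bcvDomain κ → _) ∘ (extChartAt 𝓘(ℝ, EuclideanSpace ℝ (Fin 3)) x).symm
  have h : (bcvSpace κ τ).metric.inner x v w
      = (bcvForm κ τ x).bilinearComp (fderiv ℝ ψ x) (fderiv ℝ ψ x) v w :=
    X.inner_eq hΦ hX x v w
  have hψ : ψ =ᶠ[𝓝 (x : EuclideanSpace ℝ (Fin 3))] id := bcvDomain_extChartAt_symm_eventually x
  rw [h, hψ.fderiv_eq, fderiv_id]
  rfl

variable {κ τ m lam : ℝ} {f : bcvDomain κ → ℝ}

theorem contDiffAt_bcvExtend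
    (hf : ContMDiff 𝓘(ℝ, EuclideanSpace ℝ (Fin 3)) 𝓘(ℝ, ℝ) ∞ f) {y : EuclideanSpace ℝ (Fin 3)}
    (hy : y ∈ bcvDomain κ) : ContDiffAt ℝ ∞ (bcvExtend f) y := by
  have h : ContDiffAt ℝ ∞ (f ∘ (extChartAt 𝓘(ℝ, EuclideanSpace ℝ (Fin 3))
      (⟨y, hy⟩ : bcvDomain κ)).symm) y :=
    ((bcvSpace κ 0).eventually_contDiffAt hf ⟨y, hy⟩).self_of_nhds
  exact h.congr_of_eventuallyEq (comp_extChartAt_symm_eventuallyEq f ⟨y, hy⟩).symm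

theorem bcvSpace_equation (hf : (bcvSpace κ τ).IsGradientQuasiEinstein m lam f)
    {y : EuclideanSpace ℝ (Fin 3)} (hy : y ∈ bcvDomain κ) (v w : EuclideanSpace ℝ (Fin 3)) :
    coordRicci (bcvForm κ τ) y v w + coordHessian (bcvForm κ τ) (bcvExtend f) y v w
      - 1 / m * (fderiv ℝ (bcvExtend f) y v * fderiv ℝ (bcvExtend f) y w)
      = lam * bcvForm κ τ y v w := by
  let x : bcvDomain κ := ⟨y, hy⟩
  let φ := f ∘ (extChartAt 𝓘(ℝ, EuclideanSpace ℝ (Fin 3)) x).symm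
  let G : EuclideanSpace ℝ (Fin 3) → EuclideanSpace ℝ (Fin 3) →L[ℝ]
    EuclideanSpace ℝ (Fin 3) →L[ℝ] ℝ := (bcvSpace κ τ).metricInChart x
  have e : coordRicci G y v w + coordHessian G φ y v w - 1 / m * (fderiv ℝ φ y v * fderiv ℝ φ y w)
      = lam * (bcvSpace κ τ).metric.inner x v w :=
    hf.equation_in_chart x v w
  have hφ : φ =ᶠ[𝓝 y] bcvExtend f := comp_extChartAt_symm_eventuallyEq f x
  have hG : G =ᶠ[𝓝 y] bcvForm κ τ := bcvSpace_metricInChart κ τ x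
  rw [coordRicci_congr hG, coordHessian_congr hG hφ, hφ.fderiv_eq, bcvSpace_inner] at e
  exact e

theorem bcvSpace_laplacian (κ τ : ℝ) (g : bcvDomain κ → ℝ) (x : bcvDomain κ) :
    (bcvSpace κ τ).laplacian g x
      = coordLaplacian (bcvForm κ τ) (bcvExtend g) (x : EuclideanSpace ℝ (Fin 3)) := by
  let φ := g ∘ (extChartAt 𝓘(ℝ, EuclideanSpace ℝ (Fin 3)) x).symm
  let G : EuclideanSpace ℝ (Fin 3) → EuclideanSpace ℝ (Fin 3) →L[ℝ]
    EuclideanSpace ℝ (Fin 3) →L[ℝ] ℝ := (bcvSpace κ τ).metricInChart x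
  have e : (bcvSpace κ τ).laplacian g x = coordLaplacian G φ (x : EuclideanSpace ℝ (Fin 3)) := rfl
  have hφ : φ =ᶠ[𝓝 (x : EuclideanSpace ℝ (Fin 3))] bcvExtend g :=
    comp_extChartAt_symm_eventuallyEq g x
  have hG : G =ᶠ[𝓝 (x : EuclideanSpace ℝ (Fin 3))] bcvForm κ τ := bcvSpace_metricInChart κ τ x
  rw [e]
  unfold coordLaplacian
  rw [coordHessian_congr hG hφ, hG.self_of_nhds]

end BianchiCartanVranceanuChart

section BianchiCartanVranceanuEquations

open Filter Topology ContinuousLinearMap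

theorem coordHessian_exp_const_mul {E : Type*} [NormedAddCommGroup E] [NormedSpace ℝ E]
    (G : E → E →L[ℝ] E →L[ℝ] ℝ) {φ : E → ℝ} {y : E} (hφ : ContDiffAt ℝ ∞ φ y) (c : ℝ) (v w : E) :
    coordHessian G (fun p ↦ Real.exp (c * φ p)) y v w = Real.exp (c * φ y) * c *
      (coordHessian G φ y v w + c * (fderiv ℝ φ y v * fderiv ℝ φ y w)) := by
  have h1 : ∀ᶠ p in 𝓝 y, fderiv ℝ (fun p ↦ Real.exp (c * φ p)) p
      = Real.exp (c * φ p) • c • fderiv ℝ φ p := by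
    filter_upwards [(hφ.of_le (m := 1) (by simp)).eventually (by simp)] with p hp
    exact (((hp.differentiableAt (by simp)).hasFDerivAt.const_mul c).exp).fderiv
  have hd := (hφ.differentiableAt (by simp)).hasFDerivAt
  have hd2 : HasFDerivAt (fderiv ℝ φ) _ y :=
    ((hφ.fderiv_right (m := ∞) (by simp)).differentiableAt (by simp)).hasFDerivAt
  have h2 : fderiv ℝ (fun p ↦ Real.exp (c * φ p) • c • fderiv ℝ φ p) y = _ :=
    ((hd.const_mul c).exp.smul (hd2.const_smul c)).fderiv
  rw [coordHessian_apply, coordHessian_apply, h1.self_of_nhds, EventuallyEq.fderiv_eq h1, h2]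
  simp
  ring

/-- The derivative of a function along a vector of the orthonormal frame of `E³(κ, τ)`. -/
noncomputable def bcvDeriv (κ τ : ℝ) (i : Fin 3) (φ : EuclideanSpace ℝ (Fin 3) → ℝ)
    (y : EuclideanSpace ℝ (Fin 3)) : ℝ :=
  fderiv ℝ φ y (bcvFrame κ τ y (EuclideanSpace.single i 1))

variable {κ τ : ℝ} {φ ψ : EuclideanSpace ℝ (Fin 3) → ℝ} {y : EuclideanSpace ℝ (Fin 3)}

theorem fderiv_bcvFrame_apply (κ τ : ℝ) (φ : EuclideanSpace ℝ (Fin 3) → ℝ)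
    (y Z : EuclideanSpace ℝ (Fin 3)) : fderiv ℝ φ y (bcvFrame κ τ y Z)
      = Z 0 * bcvDeriv κ τ 0 φ y + Z 1 * bcvDeriv κ τ 1 φ y + Z 2 * bcvDeriv κ τ 2 φ y := by
  have hZ : Z = Z 0 • EuclideanSpace.single 0 (1 : ℝ) + Z 1 • EuclideanSpace.single 1 (1 : ℝ)
      + Z 2 • EuclideanSpace.single 2 (1 : ℝ) := by
    ext i
    fin_cases i <;> simp
  conv_lhs => rw [hZ]
  simp only [map_add, map_smul, smul_eq_mul, bcvDeriv]

theorem bcvDeriv_congr {i : Fin 3} (h : φ =ᶠ[𝓝 y] ψ) :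
    bcvDeriv κ τ i φ y = bcvDeriv κ τ i ψ y := by
  rw [bcvDeriv, h.fderiv_eq, bcvDeriv]

theorem bcvDeriv_coord_mul_add (a b : ℝ) (i k : Fin 3) (hφ : DifferentiableAt ℝ φ y)
    (hψ : DifferentiableAt ℝ ψ y) :
    bcvDeriv κ τ i (fun p ↦ a * (p k * φ p) + b * ψ p) y
      = a * (bcvFrame κ τ y (EuclideanSpace.single i 1) k * φ y + y k * bcvDeriv κ τ i φ y)
        + b * bcvDeriv κ τ i ψ y := by
  have h : HasFDerivAt (fun p ↦ a * (p k * φ p) + b * ψ p) _ y :=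
    (((hasFDerivAt_apply_euclidean k y).mul hφ.hasFDerivAt).const_mul a).add
    (hψ.hasFDerivAt.const_mul b)
  rw [bcvDeriv, h.fderiv]
  simp [bcvDeriv, dcoord_apply]
  ring

theorem bcvDeriv_const_mul (b : ℝ) (i : Fin 3) (hψ : DifferentiableAt ℝ ψ y) :
    bcvDeriv κ τ i (fun p ↦ b * ψ p) y = b * bcvDeriv κ τ i ψ y := by
  rw [bcvDeriv, (hψ.hasFDerivAt.const_mul b).fderiv]
  simp [bcvDeriv]

theorem bcvDeriv_const (b : ℝ) (i : Fin 3) : bcvDeriv κ τ i (fun _ ↦ b) y = 0 := by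
  simp [bcvDeriv]

theorem contDiffAt_bcvDeriv (i : Fin 3) (hφ : ContDiffAt ℝ ∞ φ y) :
    ContDiffAt ℝ ∞ (bcvDeriv κ τ i φ) y :=
  (hφ.fderiv_right (m := ∞) (by simp)).clm_apply
    ((contDiff_bcvFrame κ τ).contDiffAt.clm_apply contDiffAt_const)

theorem coordHessian_bcvFrame (hy : y ∈ bcvDomain κ) (hφ : ContDiffAt ℝ ∞ φ y) (i j : Fin 3) :
    coordHessian (bcvForm κ τ) φ y (bcvFrame κ τ y (EuclideanSpace.single i 1))
        (bcvFrame κ τ y (EuclideanSpace.single j 1))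
      = bcvDeriv κ τ i (bcvDeriv κ τ j φ) y - fderiv ℝ φ y (bcvFrame κ τ y
        (bcvConnection κ τ y (EuclideanSpace.single i 1) (EuclideanSpace.single j 1))) := by
  have hd2 : HasFDerivAt (fderiv ℝ φ) _ y :=
    ((hφ.fderiv_right (m := ∞) (by simp)).differentiableAt (by simp)).hasFDerivAt
  have he := ((contDiff_bcvFrame κ τ).differentiable (by simp) y).hasFDerivAt.clm_apply
    (hasFDerivAt_const (EuclideanSpace.single j (1 : ℝ)) y)
  have h := (hd2.clm_apply he).fderiv
  have h' : bcvDeriv κ τ i (bcvDeriv κ τ j φ) y = _ :=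
    congrArg (fun L ↦ L (bcvFrame κ τ y (EuclideanSpace.single i 1))) h
  rw [h', ← christoffel_bcvForm τ hy, coordHessian_apply, map_add]
  simp
  ring

theorem bcvDeriv_comm (hy : y ∈ bcvDomain κ) (hφ : ContDiffAt ℝ ∞ φ y) (i j : Fin 3) :
    bcvDeriv κ τ i (bcvDeriv κ τ j φ) y - bcvDeriv κ τ j (bcvDeriv κ τ i φ) y
      = fderiv ℝ φ y (bcvFrame κ τ y
        (bcvConnection κ τ y (EuclideanSpace.single i 1) (EuclideanSpace.single j 1)))
        - fderiv ℝ φ y (bcvFrame κ τ y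
        (bcvConnection κ τ y (EuclideanSpace.single j 1) (EuclideanSpace.single i 1))) := by
  have h1 := coordHessian_bcvFrame (τ := τ) hy hφ i j
  have h2 := coordHessian_bcvFrame (τ := τ) hy hφ j i
  have hΓ := christoffel_symm
    ((contDiffAt_bcvForm κ τ ⟨y, hy⟩).differentiableAt (by simp)) (bcvForm_isInvertible τ hy)
    (.of_forall fun p v w ↦ by rw [bcvForm_apply, bcvForm_apply]; ring)
  rw [coordHessian_apply, isSymmSndFDerivAt_of_contDiffAt hφ, hΓ, ← coordHessian_apply] at h1
  linarith

theorem bcvDeriv_comm_zero_one (hy : y ∈ bcvDomain κ) (hφ : ContDiffAt ℝ ∞ φ y) :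
    bcvDeriv κ τ 0 (bcvDeriv κ τ 1 φ) y - bcvDeriv κ τ 1 (bcvDeriv κ τ 0 φ) y
      = -(κ / 2) * y 1 * bcvDeriv κ τ 0 φ y + κ / 2 * y 0 * bcvDeriv κ τ 1 φ y
        - 2 * τ * bcvDeriv κ τ 2 φ y := by
  rw [bcvDeriv_comm hy hφ, fderiv_bcvFrame_apply, fderiv_bcvFrame_apply]
  simp only [bcvConnection_apply]
  simp
  ring

theorem bcvDeriv_comm_zero_two (hy : y ∈ bcvDomain κ) (hφ : ContDiffAt ℝ ∞ φ y) :
    bcvDeriv κ τ 0 (bcvDeriv κ τ 2 φ) y = bcvDeriv κ τ 2 (bcvDeriv κ τ 0 φ) y := by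
  rw [← sub_eq_zero, bcvDeriv_comm hy hφ, fderiv_bcvFrame_apply, fderiv_bcvFrame_apply]
  simp only [bcvConnection_apply]
  simp

theorem bcvDeriv_comm_one_two (hy : y ∈ bcvDomain κ) (hφ : ContDiffAt ℝ ∞ φ y) :
    bcvDeriv κ τ 1 (bcvDeriv κ τ 2 φ) y = bcvDeriv κ τ 2 (bcvDeriv κ τ 1 φ) y := by
  rw [← sub_eq_zero, bcvDeriv_comm hy hφ, fderiv_bcvFrame_apply, fderiv_bcvFrame_apply]
  simp only [bcvConnection_apply]
  simp

variable {m lam : ℝ} {f : bcvDomain κ → ℝ}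

/-- The function `u = exp (-f / m)`, in terms of which the quasi-Einstein equation is linear. -/
noncomputable def bcvExp (m : ℝ) (f : bcvDomain κ → ℝ) (y : EuclideanSpace ℝ (Fin 3)) : ℝ :=
  Real.exp (-(1 / m) * bcvExtend f y)

theorem contDiffAt_bcvExp
    (hf : ContMDiff 𝓘(ℝ, EuclideanSpace ℝ (Fin 3)) 𝓘(ℝ, ℝ) ∞ f) (hy : y ∈ bcvDomain κ) :
    ContDiffAt ℝ ∞ (bcvExp m f) y :=
  (contDiffAt_const.mul (contDiffAt_bcvExtend hf hy)).exp

theorem coordHessian_bcvExp (hf : (bcvSpace κ τ).IsGradientQuasiEinstein m lam f)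
    (hy : y ∈ bcvDomain κ) (V W : EuclideanSpace ℝ (Fin 3)) :
    coordHessian (bcvForm κ τ) (bcvExp m f) y (bcvFrame κ τ y V) (bcvFrame κ τ y W)
      = -(bcvExp m f y / m) * ((lam - κ + 2 * τ ^ 2) * (V 0 * W 0 + V 1 * W 1)
        + (lam - 2 * τ ^ 2) * (V 2 * W 2)) := by
  have h := bcvSpace_equation hf hy (bcvFrame κ τ y V) (bcvFrame κ τ y W)
  rw [coordRicci_bcvForm τ hy, bcvForm_bcvFrame τ hy] at h
  refine (coordHessian_exp_const_mul _ (contDiffAt_bcvExtend hf.1 hy) (-(1 / m)) _ _).trans ?_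
  rw [bcvExp]
  linear_combination (-(1 / m) * Real.exp (-(1 / m) * bcvExtend f y)) * h

theorem bcvDeriv_bcvDeriv_bcvExp (hf : (bcvSpace κ τ).IsGradientQuasiEinstein m lam f)
    (hy : y ∈ bcvDomain κ) (i j : Fin 3) :
    bcvDeriv κ τ i (bcvDeriv κ τ j (bcvExp m f)) y = fderiv ℝ (bcvExp m f) y (bcvFrame κ τ y
        (bcvConnection κ τ y (EuclideanSpace.single i 1) (EuclideanSpace.single j 1)))
      - bcvExp m f y / m * ((lam - κ + 2 * τ ^ 2) *
        ((EuclideanSpace.single i (1 : ℝ) : EuclideanSpace ℝ (Fin 3)) 0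
            * (EuclideanSpace.single j (1 : ℝ) : EuclideanSpace ℝ (Fin 3)) 0
          + (EuclideanSpace.single i (1 : ℝ) : EuclideanSpace ℝ (Fin 3)) 1
            * (EuclideanSpace.single j (1 : ℝ) : EuclideanSpace ℝ (Fin 3)) 1)
        + (lam - 2 * τ ^ 2) * ((EuclideanSpace.single i (1 : ℝ) : EuclideanSpace ℝ (Fin 3)) 2
            * (EuclideanSpace.single j (1 : ℝ) : EuclideanSpace ℝ (Fin 3)) 2)) := by
  have h1 := coordHessian_bcvExp hf hy (EuclideanSpace.single i 1) (EuclideanSpace.single j 1)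
  have h2 := coordHessian_bcvFrame (τ := τ) hy (contDiffAt_bcvExp (m := m) hf.1 hy) i j
  linarith

/-- The linear system for the frame derivatives of `u = exp (-f / m)`. -/
theorem bcvExp_system (hf : (bcvSpace κ τ).IsGradientQuasiEinstein m lam f)
    (hy : y ∈ bcvDomain κ) :
    (bcvDeriv κ τ 0 (bcvDeriv κ τ 0 (bcvExp m f)) y
        = κ / 2 * (y 1 * bcvDeriv κ τ 1 (bcvExp m f) y)
          + -((lam - κ + 2 * τ ^ 2) / m) * bcvExp m f y ∧
      bcvDeriv κ τ 0 (bcvDeriv κ τ 1 (bcvExp m f)) y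
        = -(κ / 2) * (y 1 * bcvDeriv κ τ 0 (bcvExp m f) y)
          + -τ * bcvDeriv κ τ 2 (bcvExp m f) y ∧
      bcvDeriv κ τ 0 (bcvDeriv κ τ 2 (bcvExp m f)) y = τ * bcvDeriv κ τ 1 (bcvExp m f) y) ∧
    (bcvDeriv κ τ 1 (bcvDeriv κ τ 0 (bcvExp m f)) y
        = -(κ / 2) * (y 0 * bcvDeriv κ τ 1 (bcvExp m f) y)
          + τ * bcvDeriv κ τ 2 (bcvExp m f) y ∧
      bcvDeriv κ τ 1 (bcvDeriv κ τ 1 (bcvExp m f)) y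
        = κ / 2 * (y 0 * bcvDeriv κ τ 0 (bcvExp m f) y)
          + -((lam - κ + 2 * τ ^ 2) / m) * bcvExp m f y ∧
      bcvDeriv κ τ 1 (bcvDeriv κ τ 2 (bcvExp m f)) y = -τ * bcvDeriv κ τ 0 (bcvExp m f) y) ∧
    bcvDeriv κ τ 2 (bcvDeriv κ τ 2 (bcvExp m f)) y = -((lam - 2 * τ ^ 2) / m) * bcvExp m f y := by
  refine ⟨⟨?_, ?_, ?_⟩, ⟨?_, ?_, ?_⟩, ?_⟩ <;>
  · rw [bcvDeriv_bcvDeriv_bcvExp hf hy, fderiv_bcvFrame_apply]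
    simp only [bcvConnection_apply]
    simp
    try ring

end BianchiCartanVranceanuEquations

section BianchiCartanVranceanuRigidity

open Filter Topology ContinuousLinearMap

variable {κ τ m lam : ℝ} {f : bcvDomain κ → ℝ} {y : EuclideanSpace ℝ (Fin 3)}

theorem bcvExp_pos (m : ℝ) (f : bcvDomain κ → ℝ) (y : EuclideanSpace ℝ (Fin 3)) :
    0 < bcvExp m f y :=
  Real.exp_pos _

theorem zero_mem_bcvDomain (κ : ℝ) : (0 : EuclideanSpace ℝ (Fin 3)) ∈ bcvDomain κ := by
  change (0 : ℝ) < _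
  simp

theorem eventually_mem_bcvDomain (hy : y ∈ bcvDomain κ) : ∀ᶠ p in 𝓝 y, p ∈ bcvDomain κ :=
  (bcvDomain κ).isOpen.mem_nhds hy

/-- If the bundle curvature does not vanish, only a space of constant curvature can carry a
quasi-Einstein structure. -/
theorem bcvSpace_base_curvature_eq (hm : m ≠ 0) (hτ : τ ≠ 0)
    (hf : (bcvSpace κ τ).IsGradientQuasiEinstein m lam f) : κ = 4 * τ ^ 2 := by
  have hy := zero_mem_bcvDomain κ
  have hu := contDiffAt_bcvExp (m := m) hf.1 hy
  have hd (i : Fin 3) : DifferentiableAt ℝ (bcvDeriv κ τ i (bcvExp m f)) 0 :=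
    (contDiffAt_bcvDeriv i hu).differentiableAt (by simp)
  obtain ⟨⟨e00, -, e02⟩, ⟨-, e11, e12⟩, e22⟩ := bcvExp_system hf hy
  have h := bcvDeriv_comm_zero_one (τ := τ) hy (contDiffAt_bcvDeriv (κ := κ) (τ := τ) 2 hu)
  have h1 : bcvDeriv κ τ 1 (bcvDeriv κ τ 2 (bcvExp m f)) =ᶠ[𝓝 0]
      fun p ↦ -τ * bcvDeriv κ τ 0 (bcvExp m f) p := by
    filter_upwards [eventually_mem_bcvDomain hy] with p hp using (bcvExp_system hf hp).2.1.2.2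
  have h2 : bcvDeriv κ τ 0 (bcvDeriv κ τ 2 (bcvExp m f)) =ᶠ[𝓝 0]
      fun p ↦ τ * bcvDeriv κ τ 1 (bcvExp m f) p := by
    filter_upwards [eventually_mem_bcvDomain hy] with p hp using (bcvExp_system hf hp).1.2.2
  rw [bcvDeriv_congr h1, bcvDeriv_congr h2, bcvDeriv_const_mul _ _ (hd 0),
    bcvDeriv_const_mul _ _ (hd 1), e00, e11, e02, e12, e22] at h
  have hu0 := (bcvExp_pos m f 0).ne'
  have h3 : bcvExp m f 0 * (κ - 4 * τ ^ 2) = 0 := by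
    field_simp at h
    linear_combination (-1 / 4) * h
  linarith [(mul_eq_zero.1 h3).resolve_left hu0]

theorem bcvDeriv_two_apply (κ : ℝ) (φ : EuclideanSpace ℝ (Fin 3) → ℝ)
    (y : EuclideanSpace ℝ (Fin 3)) :
    bcvDeriv κ 0 2 φ y = fderiv ℝ φ y (EuclideanSpace.single 2 1) := by
  rw [bcvDeriv]
  congr 1
  obtain ⟨h0, h1, h2⟩ := bcvFrame_apply κ 0 y (EuclideanSpace.single 2 1)
  ext i
  fin_cases i
  · simp only [Fin.zero_eta]; rw [h0]; simp
  · simp only [Fin.mk_one]; rw [h1]; simp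
  · simp only [Fin.reduceFinMk]; rw [h2]; simp

theorem bcvExp_mul_deriv_eq_zero (hm : m ≠ 0)
    (hf : (bcvSpace κ 0).IsGradientQuasiEinstein m lam f) (hy : y ∈ bcvDomain κ) :
    lam * bcvDeriv κ 0 0 (bcvExp m f) y = 0 ∧ lam * bcvDeriv κ 0 1 (bcvExp m f) y = 0 := by
  have hu := contDiffAt_bcvExp (m := m) hf.1 hy
  have hud := hu.differentiableAt (by simp)
  have h22 : bcvDeriv κ 0 2 (bcvDeriv κ 0 2 (bcvExp m f)) =ᶠ[𝓝 y]
      fun p ↦ -((lam - 2 * 0 ^ 2) / m) * bcvExp m f p := by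
    filter_upwards [eventually_mem_bcvDomain hy] with p hp using (bcvExp_system hf hp).2.2
  have h02 : bcvDeriv κ 0 0 (bcvDeriv κ 0 2 (bcvExp m f)) =ᶠ[𝓝 y] fun _ ↦ 0 := by
    filter_upwards [eventually_mem_bcvDomain hy] with p hp
    simpa using (bcvExp_system hf hp).1.2.2
  have h12 : bcvDeriv κ 0 1 (bcvDeriv κ 0 2 (bcvExp m f)) =ᶠ[𝓝 y] fun _ ↦ 0 := by
    filter_upwards [eventually_mem_bcvDomain hy] with p hp
    simpa using (bcvExp_system hf hp).2.1.2.2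
  have c0 := bcvDeriv_comm_zero_two (τ := 0) hy (contDiffAt_bcvDeriv (κ := κ) (τ := 0) 2 hu)
  have c1 := bcvDeriv_comm_one_two (τ := 0) hy (contDiffAt_bcvDeriv (κ := κ) (τ := 0) 2 hu)
  rw [bcvDeriv_congr h22, bcvDeriv_congr h02, bcvDeriv_const, bcvDeriv_const_mul _ _ hud] at c0
  rw [bcvDeriv_congr h22, bcvDeriv_congr h12, bcvDeriv_const, bcvDeriv_const_mul _ _ hud] at c1
  constructor
  · field_simp at c0; linarith
  · field_simp at c1; linarith

theorem bcvExp_mul_deriv_two_eq_zero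
    (hf : (bcvSpace κ 0).IsGradientQuasiEinstein m lam f) (hm : m ≠ 0) (hy : y ∈ bcvDomain κ) :
    (lam - κ) * bcvDeriv κ 0 2 (bcvExp m f) y = 0 := by
  have hu := contDiffAt_bcvExp (m := m) hf.1 hy
  have hd (i : Fin 3) : DifferentiableAt ℝ (bcvDeriv κ 0 i (bcvExp m f)) y :=
    (contDiffAt_bcvDeriv i hu).differentiableAt (by simp)
  have h00 : bcvDeriv κ 0 0 (bcvDeriv κ 0 0 (bcvExp m f)) =ᶠ[𝓝 y]
      fun p ↦ κ / 2 * (p 1 * bcvDeriv κ 0 1 (bcvExp m f) p)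
          + -((lam - κ + 2 * 0 ^ 2) / m) * bcvExp m f p := by
    filter_upwards [eventually_mem_bcvDomain hy] with p hp using (bcvExp_system hf hp).1.1
  have h02 : ∀ᶠ p in 𝓝 y, bcvDeriv κ 0 0 (bcvDeriv κ 0 2 (bcvExp m f)) p = 0 := by
    filter_upwards [eventually_mem_bcvDomain hy] with p hp
    simpa using (bcvExp_system hf hp).1.2.2
  have h20 : bcvDeriv κ 0 2 (bcvDeriv κ 0 0 (bcvExp m f)) =ᶠ[𝓝 y] fun _ ↦ 0 := by
    filter_upwards [eventually_mem_bcvDomain hy, h02] with p hp h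
    exact (bcvDeriv_comm_zero_two hp (contDiffAt_bcvExp hf.1 hp)).symm.trans h
  have h21 : bcvDeriv κ 0 2 (bcvDeriv κ 0 1 (bcvExp m f)) y = 0 := by
    rw [← bcvDeriv_comm_one_two hy hu]
    simpa using (bcvExp_system hf hy).2.1.2.2
  have c := bcvDeriv_comm_zero_two (τ := 0) hy (contDiffAt_bcvDeriv (κ := κ) (τ := 0) 0 hu)
  rw [bcvDeriv_congr h20, bcvDeriv_congr h00, bcvDeriv_const,
    bcvDeriv_coord_mul_add _ _ _ _ (hd 1) (hu.differentiableAt (by simp)), h21,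
    (bcvFrame_apply _ _ _ _).2.1] at c
  simp at c
  rcases c with (c | c) | c
  · simp [c]
  · exact absurd c hm
  · simp [c]

theorem bcvSpace_lam_eq (hm : 0 < m) (hκ : κ < 0)
    (hf : (bcvSpace κ 0).IsGradientQuasiEinstein m lam f) : lam = κ := by
  by_contra hne
  have hκ' : lam - κ ≠ 0 := sub_ne_zero.2 hne
  have h2 : ∀ {p}, p ∈ bcvDomain κ → bcvDeriv κ 0 2 (bcvExp m f) p = 0 := fun hp ↦
    (mul_eq_zero.1 (bcvExp_mul_deriv_two_eq_zero hf hm.ne' hp)).resolve_left hκ'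
  have hlam : lam = 0 := by
    have hy := zero_mem_bcvDomain κ
    have h22 : bcvDeriv κ 0 2 (bcvExp m f) =ᶠ[𝓝 0] fun _ ↦ 0 := by
      filter_upwards [eventually_mem_bcvDomain hy] with p hp using h2 hp
    have e := (bcvExp_system hf hy).2.2
    rw [bcvDeriv_congr h22, bcvDeriv_const] at e
    have := (bcvExp_pos m f 0).ne'
    field_simp at e
    simpa [this] using e.symm
  subst hlam
  have h1 : ∀ {p}, p ∈ bcvDomain κ → bcvDeriv κ 0 0 (bcvExp m f) p = 0 := fun {y} hy ↦ by
    have hu := contDiffAt_bcvExp (m := m) hf.1 hy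
    have hud := hu.differentiableAt (by simp)
    have hd (i : Fin 3) : DifferentiableAt ℝ (bcvDeriv κ 0 i (bcvExp m f)) y :=
      (contDiffAt_bcvDeriv i hu).differentiableAt (by simp)
    have h11 : bcvDeriv κ 0 1 (bcvDeriv κ 0 1 (bcvExp m f)) =ᶠ[𝓝 y]
        fun p ↦ κ / 2 * (p 0 * bcvDeriv κ 0 0 (bcvExp m f) p)
            + -((0 - κ + 2 * 0 ^ 2) / m) * bcvExp m f p := by
      filter_upwards [eventually_mem_bcvDomain hy] with p hp using (bcvExp_system hf hp).2.1.2.1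
    have h01 : bcvDeriv κ 0 0 (bcvDeriv κ 0 1 (bcvExp m f)) =ᶠ[𝓝 y]
        fun p ↦ -(κ / 2) * (p 1 * bcvDeriv κ 0 0 (bcvExp m f) p)
            + -0 * bcvDeriv κ 0 2 (bcvExp m f) p := by
      filter_upwards [eventually_mem_bcvDomain hy] with p hp using (bcvExp_system hf hp).1.2.1
    have c := bcvDeriv_comm_zero_one (τ := 0) hy (contDiffAt_bcvDeriv (κ := κ) (τ := 0) 1 hu)
    obtain ⟨⟨e00, e01, -⟩, ⟨e10, e11, -⟩, -⟩ := bcvExp_system hf hy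
    rw [bcvDeriv_congr h11, bcvDeriv_congr h01,
      bcvDeriv_coord_mul_add _ _ _ _ (hd 0) hud, bcvDeriv_coord_mul_add _ _ _ _ (hd 0) (hd 2),
      (bcvFrame_apply _ _ _ _).1, (bcvFrame_apply _ _ _ _).2.1, e00, e10, e01, e11, h2 hy] at c
    have hz : (m + 1) * bcvDeriv κ 0 0 (bcvExp m f) y = 0 := by
      have := hm.ne'
      simp at c
      field_simp at c
      linear_combination c / 16
    simpa [(by positivity : m + 1 ≠ 0)] using hz
  have hy := zero_mem_bcvDomain κ
  have h00 : bcvDeriv κ 0 0 (bcvExp m f) =ᶠ[𝓝 0] fun _ ↦ 0 := by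
    filter_upwards [eventually_mem_bcvDomain hy] with p hp using h1 hp
  have e := (bcvExp_system hf hy).1.1
  rw [bcvDeriv_congr h00, bcvDeriv_const] at e
  have := (bcvExp_pos m f 0).ne'
  simp [hκ.ne, hm.ne', this] at e

theorem bcvExp_deriv_horizontal_eq_zero (hm : m ≠ 0) (hκ : κ < 0)
    (hf : (bcvSpace κ 0).IsGradientQuasiEinstein m κ f) (hy : y ∈ bcvDomain κ)
    {Z : EuclideanSpace ℝ (Fin 3)} (hZ : Z 2 = 0) : fderiv ℝ (bcvExp m f) y Z = 0 := by
  obtain ⟨U, rfl⟩ := (bijective_bcvFrame 0 hy).2 Z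
  obtain ⟨h0, h1⟩ := bcvExp_mul_deriv_eq_zero hm hf hy
  rw [(bcvFrame_apply _ _ _ _).2.2] at hZ
  have hU : U 2 = 0 := by simpa using hZ
  rw [fderiv_bcvFrame_apply, (mul_eq_zero.1 h0).resolve_left hκ.ne,
    (mul_eq_zero.1 h1).resolve_left hκ.ne, hU]
  simp

theorem axis_mem_bcvDomain (κ t : ℝ) :
    t • (EuclideanSpace.single 2 1 : EuclideanSpace ℝ (Fin 3)) ∈ bcvDomain κ := by
  change (0 : ℝ) < _
  simp

theorem bcvExp_eq_axis (hm : m ≠ 0) (hκ : κ < 0)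
    (hf : (bcvSpace κ 0).IsGradientQuasiEinstein m κ f) (hy : y ∈ bcvDomain κ) :
    bcvExp m f y = bcvExp m f (y 2 • EuclideanSpace.single 2 1) := by
  set P : EuclideanSpace ℝ (Fin 3) := y 2 • EuclideanSpace.single 2 1 with hP
  have hmem : ∀ s ∈ Set.Icc (0 : ℝ) 1, P + s • (y - P) ∈ bcvDomain κ := fun s hs ↦ by
    have hy' : 0 < 1 + κ / 4 * (y 0 ^ 2 + y 1 ^ 2) := hy
    change 0 < 1 + κ / 4 * ((P + s • (y - P)) 0 ^ 2 + (P + s • (y - P)) 1 ^ 2)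
    have e0 : (P + s • (y - P)) 0 = s * y 0 := by simp [hP]
    have e1 : (P + s • (y - P)) 1 = s * y 1 := by simp [hP]
    have hs2 : s ^ 2 ≤ 1 := pow_le_one₀ hs.1 hs.2
    rw [e0, e1]
    nlinarith [mul_nonneg (mul_nonneg (neg_nonneg.2 hκ.le) (sub_nonneg.2 hs2))
      (add_nonneg (sq_nonneg (y 0)) (sq_nonneg (y 1)))]
  have hder : ∀ s ∈ Set.Icc (0 : ℝ) 1,
      HasDerivAt (fun s : ℝ ↦ bcvExp m f (P + s • (y - P))) 0 s := fun s hs ↦ by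
    have h1 : HasDerivAt (fun s : ℝ ↦ P + s • (y - P)) (y - P) s := by
      simpa using ((hasDerivAt_id s).smul_const (y - P)).const_add P
    have h2 := ((contDiffAt_bcvExp (m := m) hf.1 (hmem s hs)).differentiableAt
      (by simp)).hasFDerivAt.comp_hasDerivAt s h1
    rwa [bcvExp_deriv_horizontal_eq_zero hm hκ hf (hmem s hs) (by simp [hP])] at h2
  have h := constant_of_has_deriv_right_zero
    (fun s hs ↦ (hder s hs).continuousAt.continuousWithinAt)
    (fun s hs ↦ (hder s ⟨hs.1, hs.2.le⟩).hasDerivWithinAt) 1 (by simp)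
  simpa using h

theorem bcvExtend_eq_axis (hm : m ≠ 0) (hκ : κ < 0)
    (hf : (bcvSpace κ 0).IsGradientQuasiEinstein m κ f) (hy : y ∈ bcvDomain κ) :
    bcvExtend f y = bcvExtend f (y 2 • EuclideanSpace.single 2 1) := by
  have h := Real.exp_injective (bcvExp_eq_axis hm hκ hf hy)
  field_simp at h
  linarith

/-- The potential functions on `ℍ²_κ × ℝ`. -/
theorem bcvSpace_potential (hm : 0 < m) (hκ : κ < 0)
    (hf : (bcvSpace κ 0).IsGradientQuasiEinstein m κ f) :
    (∃ c, (∀ p : bcvDomain κ, f p = √(-(m * κ)) * p.1 2 + c) ∨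
      ∀ p : bcvDomain κ, f p = -√(-(m * κ)) * p.1 2 + c) ∨
    ∃ a b, ∀ p : bcvDomain κ,
      f p = -m * Real.log (Real.cosh (√(-κ / m) * (p.1 2 + a))) + b := by
  have hq : 0 < -κ / m := div_pos (neg_pos.2 hκ) hm
  have hμ := Real.sqrt_pos.2 hq
  have hmμ : √(-(m * κ)) = m * √(-κ / m) := by
    rw [← Real.sqrt_sq hm.le, ← Real.sqrt_mul (by positivity), Real.sqrt_sq hm.le]
    congr 1
    field_simp
  have hP : ∀ t, HasDerivAt (fun t : ℝ ↦ t • (EuclideanSpace.single 2 1 : EuclideanSpace ℝ (Fin 3)))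
      (EuclideanSpace.single 2 1) t := fun t ↦ by
    simpa using (hasDerivAt_id t).smul_const (EuclideanSpace.single 2 1 : EuclideanSpace ℝ (Fin 3))
  have hder : ∀ {φ : EuclideanSpace ℝ (Fin 3) → ℝ} (t : ℝ),
      ContDiffAt ℝ ∞ φ (t • EuclideanSpace.single 2 1) →
      HasDerivAt (fun t : ℝ ↦ φ (t • EuclideanSpace.single 2 1))
        (bcvDeriv κ 0 2 φ (t • EuclideanSpace.single 2 1)) t := fun t hφ ↦ by
    rw [bcvDeriv_two_apply]
    exact (hφ.differentiableAt (by simp)).hasFDerivAt.comp_hasDerivAt t (hP t)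
  have hu := fun t ↦ contDiffAt_bcvExp (m := m) hf.1 (axis_mem_bcvDomain κ t)
  have he : ∀ t : ℝ, Real.exp (-bcvExtend f (t • EuclideanSpace.single 2 1) / m)
      = bcvExp m f (t • EuclideanSpace.single 2 1) := fun t ↦ by
    rw [bcvExp]
    congr 1
    ring
  have key := potential_of_positive_solution hm hμ
    (h := fun t ↦ bcvExtend f (t • EuclideanSpace.single 2 1))
    (u' := fun t ↦ bcvDeriv κ 0 2 (bcvExp m f) (t • EuclideanSpace.single 2 1))
    (fun t ↦ by simpa only [he] using hder t (hu t))
    (fun t ↦ by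
      refine (hder t (contDiffAt_bcvDeriv 2 (hu t))).congr_deriv ?_
      rw [(bcvExp_system hf (axis_mem_bcvDomain κ t)).2.2, he, Real.sq_sqrt hq.le]
      ring)
  have hfp : ∀ p : bcvDomain κ, f p = bcvExtend f (p.1 2 • EuclideanSpace.single 2 1) := fun p ↦
    (bcvExtend_apply f p.2).symm.trans (bcvExtend_eq_axis hm.ne' hκ hf p.2)
  rw [hmμ]
  rcases key with ⟨c, h | h⟩ | ⟨a, b, h⟩
  · exact .inl ⟨c, .inl fun p ↦ (hfp p).trans (h _)⟩
  · exact .inl ⟨c, .inr fun p ↦ (hfp p).trans (h _)⟩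
  · exact .inr ⟨a, b, fun p ↦ (hfp p).trans (h _)⟩

theorem bcvForm_single_two (κ : ℝ) (y : EuclideanSpace ℝ (Fin 3)) :
    bcvForm κ 0 y (EuclideanSpace.single 2 1) = dcoord 2 := by
  ext w
  rw [bcvForm_apply, dcoord_apply]
  simp

theorem isStatic_bcvSpace (hf : (bcvSpace κ 0).IsGradientQuasiEinstein 1 κ f) :
    (bcvSpace κ 0).IsStatic κ f := by
  refine fun (x : bcvDomain κ) ↦ ?_
  have hx : (x : EuclideanSpace ℝ (Fin 3)) ∈ bcvDomain κ := x.2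
  have h1 : bcvExtend (fun p ↦ Real.exp (-f p)) =ᶠ[𝓝 (x : EuclideanSpace ℝ (Fin 3))]
      bcvExp 1 f := by
    filter_upwards [eventually_mem_bcvDomain hx] with p hp
    rw [bcvExtend_apply _ hp, bcvExp, bcvExtend_apply _ hp]
    simp
  have h2 : bcvExp 1 f x = Real.exp (-f x) := by
    rw [bcvExp, bcvExtend_apply f hx]
    simp
  have h3 : coordHessian (bcvForm κ 0) (bcvExp 1 f) x
      = (dcoord 2).smulRight ((-κ * bcvExp 1 f x) • dcoord 2) := by
    ext v w
    obtain ⟨V, rfl⟩ := (bijective_bcvFrame 0 hx).2 v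
    obtain ⟨W, rfl⟩ := (bijective_bcvFrame 0 hx).2 w
    rw [coordHessian_bcvExp hf hx]
    simp [dcoord_apply, (bcvFrame_apply _ _ _ _).2.2]
    ring
  have h4 : (bcvForm κ 0 x).inverse (dcoord 2) = EuclideanSpace.single 2 1 := by
    rw [← bcvForm_single_two κ x]
    obtain ⟨e, he⟩ := bcvForm_isInvertible 0 hx
    rw [← he, inverse_equiv]
    simp
  have h5 : ((bcvForm κ 0 x).inverse.comp (coordHessian (bcvForm κ 0) (bcvExp 1 f) x) :
      EuclideanSpace ℝ (Fin 3) →ₗ[ℝ] EuclideanSpace ℝ (Fin 3))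
      = (dcoord 2 : EuclideanSpace ℝ (Fin 3) →ₗ[ℝ] ℝ).smulRight
        ((-κ * bcvExp 1 f x) • EuclideanSpace.single 2 (1 : ℝ)) := by
    ext v : 1
    simp [h3, h4]
  have h6 : (bcvSpace κ 0).laplacian (fun p ↦ Real.exp (-f p)) x = -κ * bcvExp 1 f x := by
    refine (bcvSpace_laplacian κ 0 (fun p ↦ Real.exp (-f p)) x).trans ?_
    unfold coordLaplacian
    rw [coordHessian_congr .rfl h1, h5, LinearMap.trace_smulRight]
    simp [dcoord_apply]
  refine (congrArg₂ (· + ·) h6 (congrArg (κ * ·) h2.symm)).trans ?_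
  ring

end BianchiCartanVranceanuRigidity

/-- The identity, as an isometry. -/
noncomputable def RiemannianManifold.Isometry.refl (X : RiemannianManifold) :
    RiemannianManifold.Isometry X X where
  toDiffeomorph := Diffeomorph.refl X.I X.M ∞
  inner_map x v w := by
    have h : mfderiv X.I X.I (Diffeomorph.refl X.I X.M ∞) x
        = ContinuousLinearMap.id ℝ (TangentSpace X.I x) := mfderiv_id
    rw [h]
    rfl

end QuasiEinstein

open QuasiEinstein in
theorem theorem2 (κ τ : ℝ) (hκτ : κ ≠ 0 ∨ τ ≠ 0) (m lam : ℝ) (hm : 0 < m)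
    (f : (E3 κ τ).M → ℝ) (hf : (E3 κ τ).IsGradientQuasiEinstein m lam f) :
    ((E3 κ τ).IsEinstein ∨
      (κ < 0 ∧ τ = 0 ∧ lam = κ ∧
        ∃ Φ : RiemannianManifold.Isometry (hyperbolicPlaneTimesLine κ) (E3 κ τ),
          (∃ c : ℝ, (∀ p, f (Φ.toDiffeomorph p) = √(-(m * κ)) * height κ p + c) ∨
            (∀ p, f (Φ.toDiffeomorph p) = -√(-(m * κ)) * height κ p + c)) ∨
          (∃ a b : ℝ, ∀ p, f (Φ.toDiffeomorph p) =
            -m * Real.log (Real.cosh (√(-lam / m) * (height κ p + a))) + b))) ∧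
    (m = 1 → κ ≠ 4 * τ ^ 2 → (E3 κ τ).IsStatic lam f) := by
  rcases lt_or_ge 0 κ with hκ | hκ
  · by_cases hτ : τ = 0
    · have hE : E3 κ τ = sphereTimesLine κ hκ := by rw [E3, dif_pos hκ, dif_pos hτ]
      revert f
      rw [hE]
      exact fun f hf ↦ (not_quasiEinstein_sphereTimesLine hκ hm hf).elim
    · have hE : E3 κ τ = bergerSphere κ τ hκ hτ := by rw [E3, dif_pos hκ, dif_neg hτ]
      revert f
      rw [hE]
      intro f hf
      have h := bergerSphere_quasiEinstein hκ hτ hf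
      exact ⟨.inl (isEinstein_bergerSphere hκ hτ h), fun _ hne ↦ absurd h hne⟩
  · have hE : E3 κ τ = bcvSpace κ τ := by rw [E3, dif_neg hκ.not_gt]
    revert f
    rw [hE]
    intro f hf
    by_cases hτ : τ = 0
    · subst hτ
      have hκ' : κ < 0 := lt_of_le_of_ne hκ (hκτ.resolve_right fun h ↦ h rfl)
      obtain rfl := bcvSpace_lam_eq hm hκ' hf
      refine ⟨.inr ⟨hκ', rfl, rfl, .refl _, bcvSpace_potential hm hκ' hf⟩, ?_⟩
      rintro rfl -
      exact isStatic_bcvSpace hf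
    · have h := bcvSpace_base_curvature_eq hm.ne' hτ hf
      have : 0 < τ ^ 2 := by positivity
      linarith
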